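/- **Conventions.** Let $d\ge 1$, let $S^1\subset\mathbb C$ be the unit circle, bounding the open disk $\mathbb D$, and let $f(z)=z^d$. *Degree.* The circle and its subsets are circularly ordered by the sign $C(a,b,c)\in\{-1,0,1\}$ of the signed area of the triangle $abc$. An *interval* of a circularly ordered set $X$ is a subset $J$ with a linear order such that $a<b<c$ in $J$ implies $C(a,b,c)=1$, and such that $a<b$ in $J$, $x\in X$, $C(a,x,b)=1$ imply $x\in J$. The *degree* of a map between circularly ordered sets is the minimum size of a partition of the source into intervals on each of which the map is injective and preserves the circular order ($\infty$ if there is no finite such partition). *Invariant relations.* An equivalence relation $R$ on $S^1$ is *treelike* if it is closed in $S^1\times S^1$ and distinct classes have disjoint convex hulls. A treelike $R$ is *degree-$d$-invariant* if (i) $s\mathrel R t$ implies $s^d\mathrel R t^d$, and (ii) for each class $C$, the degrees of the restrictions of $f$ to the classes contained in $f^{-1}(C)$ sum to $d$. *Gaps.* The leaves of $\mathrm{Lam}(R)$ make up the union over all classes $A$ of $\partial(\mathrm{hull}(A))\cap\mathbb D$. A *gap* is a connected component $G$ of the complement of this union in $\mathbb D$; its trace is $X_G=\overline G\cap S^1$.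 The gap is *collapsed* if $X_G$ is a single $R$-class and *intact* otherwise. For an intact gap $G$, the quotients $X_G/R$ and $f(X_G)/R$ inherit circular orders from $S^1$, and the degree of $G$ is the degree of the induced map $X_G/R\to f(X_G)/R$. The degree of a class $A$ is the degree of $f|_A:A\to S^1$. The *criticality* of a class or an intact gap is its degree minus $1$, and it is *critical* if its degree is greater than $1$. **Proposition.** Let $d\ge1$ and let $R$ be a degree-$d$-invariant equivalence relation on $S^1$. Then $$\sum_{A\ \text{critical class of }R}(\deg A-1)\;+\;\sum_{G\ \text{intact critical gap of }\mathrm{Lam}(R)}(\deg G-1)\;=\;d-1 .$$ -/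

import Mathlib

open Set

noncomputable section

/-! ### Degree of a map between circularly ordered sets

A circular order on `X` is presented by its positively oriented triples: `C a b c` says that the
orientation of `(a, b, c)` is `+1`.  The orientation is `-1` when `C c b a` holds, and `0` exactly
when `a, b, c` are not distinct. -/

/-- An interval of a circularly ordered set `(X, C)`: a subset `J` with a linear order such that
`a < b < c` in `J` implies that `(a, b, c)` is positively oriented, and such that every point `x`
lying (circularly) between two points `a < b` of `J` belongs to `J`. -/
def IsCircInterval {X : Type*} (C : X → X → X → Prop) (J : Set X) : Prop :=
  ∃ _ : LinearOrder J,
    (∀ a b c : J, a < b → b < c → C a b c) ∧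
    (∀ (a b : J) (x : X), a < b → C a x b → x ∈ J)

/-- The circular order is preserved by `f` on `J`: `f` restricts to an isomorphism of `J` onto
its image, as circularly ordered sets. -/
def PreservesCircOrderOn {X Y : Type*} (C : X → X → X → Prop) (C' : Y → Y → Y → Prop)
    (f : X → Y) (J : Set X) : Prop :=
  InjOn f J ∧ ∀ a ∈ J, ∀ b ∈ J, ∀ c ∈ J, (C' (f a) (f b) (f c) ↔ C a b c)

/-- The degree of a map between circularly ordered sets: the minimum size of a partition of the
source into intervals on each of which the circular order is preserved
(`⊤` if there is no finite one). -/
def circDegree {X Y : Type*} (C : X → X → X → Prop) (C' : Y → Y → Y → Prop) (f : X → Y) : ℕ∞ :=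
  ⨅ P ∈ {P : Set (Set X) | Setoid.IsPartition P ∧
      ∀ J ∈ P, IsCircInterval C J ∧ PreservesCircOrderOn C C' f J}, P.encard

/-- The circular order of the unit circle: the triangle `a b c` has positive signed area. -/
def circlePos (a b c : Circle) : Prop :=
  0 < ((starRingEnd ℂ) ((b : ℂ) - a) * ((c : ℂ) - a)).im

/-- The degree of the restriction of `z ↦ z ^ d` to a subset `A` of the circle. -/
def powDegreeOn (d : ℕ) (A : Set Circle) : ℕ∞ :=
  circDegree (fun a b c : A => circlePos a b c) circlePos (fun z : A => (z : Circle) ^ d)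

/-! ### Treelike and degree-`d`-invariant equivalence relations -/

/-- The convex hull, in the plane, of a subset of the unit circle. -/
def circleHull (A : Set Circle) : Set ℂ := convexHull ℝ ((fun z : Circle => (z : ℂ)) '' A)

structure IsTreelike (R : Setoid Circle) : Prop where
  isClosed : IsClosed {p : Circle × Circle | R p.1 p.2}
  disjoint_hulls : ∀ A ∈ R.classes, ∀ B ∈ R.classes, A ≠ B →
    Disjoint (circleHull A) (circleHull B)

/-- Degree-`d`-invariance of a (treelike) equivalence relation on the circle.  In
`total_degree`, the equivalence classes on `C^{1/d}` are the classes contained in the preimage of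
`C`, and the sum is taken in `ℕ∞`, where every family is summable. -/
structure IsDegreeInvariant (d : ℕ) (R : Setoid Circle) : Prop where
  treelike : IsTreelike R
  map_rel : ∀ s t : Circle, R s t → R (s ^ d) (t ^ d)
  total_degree : ∀ C ∈ R.classes,
    ∑' A : {A : Set Circle // A ∈ R.classes ∧ A ⊆ (fun z : Circle => z ^ d) ⁻¹' C},
      powDegreeOn d A = d

/-! ### The lamination of a treelike equivalence relation and its gaps -/

/-- The union of the leaves of `Lam(R)`: the boundaries of the convex hulls of the classes,
intersected with the open disk. -/
def leafUnion (R : Setoid Circle) : Set ℂ :=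
  ⋃ A ∈ R.classes, frontier (circleHull A) ∩ Metric.ball 0 1

/-- A gap of `Lam(R)`: a connected component of the complement of the leaves in the open disk. -/
def IsGap (R : Setoid Circle) (G : Set ℂ) : Prop :=
  ∃ x ∈ Metric.ball (0 : ℂ) 1 \ leafUnion R,
    G = connectedComponentIn (Metric.ball (0 : ℂ) 1 \ leafUnion R) x

/-- The subset of the circle touched by a gap. -/
def gapTrace (G : Set ℂ) : Set Circle := {z : Circle | (z : ℂ) ∈ closure G}

/-- An intact gap: a gap that does not touch the circle in a single equivalence class. -/
def IsIntactGap (R : Setoid Circle) (G : Set ℂ) : Prop :=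
  IsGap R G ∧ gapTrace G ∉ R.classes

/-- A subset of the circle mod `R`. -/
abbrev ModR (R : Setoid Circle) (X : Set Circle) : Type :=
  Quotient (R.comap (Subtype.val : X → Circle))

/-- The circular order of `X` mod `R`: three distinct elements are positively oriented when they
have positively oriented representatives in `X`.  (For `X` the trace of an intact gap, the
orientation does not depend on the representatives.) -/
def modPos (R : Setoid Circle) (X : Set Circle) (u v w : ModR R X) : Prop :=
  u ≠ v ∧ v ≠ w ∧ u ≠ w ∧ ∃ a b c : X,
    Quotient.mk _ a = u ∧ Quotient.mk _ b = v ∧ Quotient.mk _ c = w ∧ circlePos a b c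

/-- The map induced by `z ↦ z ^ d` from `X` mod `R` to its image mod `R`. -/
def powMod {d : ℕ} {R : Setoid Circle} (hR : IsDegreeInvariant d R) (X : Set Circle) :
    ModR R X → ModR R ((fun z : Circle => z ^ d) '' X) :=
  Quotient.map (fun z : X => ⟨(z : Circle) ^ d, mem_image_of_mem _ z.2⟩)
    (fun a b h => hR.map_rel a b h)

/-- The degree of an intact gap: the degree of the map induced by `z ↦ z ^ d` on the intersection
of the gap with the circle mod `R`. -/
def gapDegree {d : ℕ} {R : Setoid Circle} (hR : IsDegreeInvariant d R) (G : Set ℂ) : ℕ∞ :=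
  circDegree (modPos R (gapTrace G)) (modPos R ((fun z : Circle => z ^ d) '' gapTrace G))
    (powMod hR (gapTrace G))

/-- The critical classes: those that map with degree greater than `1`. -/
def criticalClasses (d : ℕ) (R : Setoid Circle) : Set (Set Circle) :=
  {A | A ∈ R.classes ∧ 1 < powDegreeOn d A}

/-- The intact critical gaps: the intact gaps that map with degree greater than `1`. -/
def intactCriticalGaps {d : ℕ} {R : Setoid Circle} (hR : IsDegreeInvariant d R) :
    Set (Set ℂ) :=
  {G | IsIntactGap R G ∧ 1 < gapDegree hR G}

end

noncomputable section

/-! ### Extended sums -/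

/-! Cut the circle open at a base point and lift it to the line by `circ`; the formula then comes
from counting lifts of `d`-th roots (`fib`) in intervals. A class contains at most as many points of
a fibre as its degree. Over a given class both the fibre sizes and the degrees sum to `d`, so
equality holds for every class (`encard_fibre_eq_powDegreeOn`). Hence two related points have
equally many preimages in any union of classes (`encard_saturated_fib`).

An arc is an interval between consecutive points of a class, and the intact gaps are the regions
directly beneath those arcs that have a gap (`isIntactGap_iff`). Represent each class touched by
such a gap by its right end. Saturation makes `⌊d * z - δ⌋ - ⌊d * z - δ'⌋` independent of the right
end `z` whenever `δ` and `δ'` are related (`floor_sub_floor_eq`). It follows that the degree of the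
gap beneath `(s, t)` is the number of right ends with the same image as `s` (`circDegree_gap`).

Take criticality as weight. The main claim (`total_region_arc`) is that all that lies beneath an arc
`(a, b)` weighs as much as the number of points of `(a, b)` with the same image as `a`. If the arc
has a gap, these points are right ends, counted by the gap, or lie beneath maximal related pairs,
counted by `total_span` (`total_region_gapped`). But related pairs may accumulate to the ends of an
arc, leaving no gap, so the general case is an induction on `n` with `d * (b - a) ≤ n + 1`. A
shortest related pair of length at least `n / d` locates the weight: outside its class or one arc of
it, there is no room for two critical points with the same image, and what is beneath is a gap or
shorter arcs. Applied to the arcs of the class of the base point, this counts a whole fibre of `d`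
points but one (`total_weight_eq`). -/

theorem enat_hasSum {α : Type*} (f : α → ℕ∞) : HasSum f (⨆ s : Finset α, ∑ a ∈ s, f a) :=
  hasSum_of_isLUB _ (isLUB_iSup)

theorem enat_summable {α : Type*} (f : α → ℕ∞) : Summable f := ⟨_, enat_hasSum f⟩

theorem toENNReal_tsum {α : Type*} (f : α → ℕ∞) :
    ((∑' a, f a : ℕ∞) : ENNReal) = ∑' a, (f a : ENNReal) :=
  (((enat_summable f).hasSum.map ENat.toENNRealRingHom ENat.continuous_toENNReal).tsum_eq).symm

/-- The sum of a weight over a set, in `[0, ∞]`. -/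
def total {α : Type*} (c : α → ENNReal) (S : Set α) : ENNReal := ∑' x : S, c x

theorem total_biUnion {α ι : Type*} (c : α → ENNReal) {T : Set ι} {S : ι → Set α}
    (h : T.PairwiseDisjoint S) : total c (⋃ i ∈ T, S i) = ∑' i : T, total c (S i) :=
  ENNReal.tsum_biUnion' h

theorem total_union {α : Type*} (c : α → ENNReal) {S T : Set α} (h : Disjoint S T) :
    total c (S ∪ T) = total c S + total c T :=
  ENNReal.summable.tsum_union_disjoint h ENNReal.summable

theorem total_singleton {α : Type*} (c : α → ENNReal) (x : α) : total c {x} = c x :=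
  tsum_singleton x c

theorem total_eq_of_subset {α : Type*} (c : α → ENNReal) {S T : Set α} (h : S ⊆ T)
    (h0 : ∀ x ∈ T, x ∉ S → c x = 0) : total c T = total c S := by
  have hT : T = S ∪ (T \ S) := by rw [union_sdiff_cancel h]
  have h1 : total c (T \ S) = 0 := by
    unfold total
    rw [ENNReal.tsum_eq_zero]
    exact fun x => h0 _ x.2.1 x.2.2
  rw [hT, total_union c disjoint_sdiff_right, h1, add_zero]

theorem encard_biUnion_eq_tsum {α ι : Type*} {T : Set ι} {S : ι → Set α}
    (h : T.PairwiseDisjoint S) :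
    ((⋃ i ∈ T, S i).encard : ENNReal) = ∑' i : T, ((S i).encard : ENNReal) := by
  have := total_biUnion (fun _ : α => (1 : ENNReal)) h
  unfold total at this
  simpa only [ENNReal.tsum_set_one] using this

/-- A set on which a map is constant has at most as many elements as the degree of the map. -/
theorem encard_le_circDegree {X Y : Type*} (C : X → X → X → Prop) (C' : Y → Y → Y → Prop)
    (f : X → Y) (F : Set X) (hF : ∀ x ∈ F, ∀ y ∈ F, f x = f y) :
    F.encard ≤ circDegree C C' f := by
  refine le_iInf₂ fun P hP => ?_
  obtain ⟨hp, hJ⟩ := hP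
  have hex : ∀ x : X, ∃ J ∈ P, x ∈ J := fun x => (hp.2 x).exists.imp fun J hJ => ⟨hJ.1, hJ.2⟩
  choose g hg hxg using hex
  -- Each point of `F` goes to its block; injectivity of `f` on blocks separates points with equal
  -- images.
  refine encard_le_encard_of_injOn (f := g) (fun x _ => hg x) ?_
  intro x hx y hy hxy
  exact (hJ _ (hg x)).2.1 (hxg x) (hxy ▸ hxg y) (hF x hx y hy)

/-! ### Lifting to the line -/

/-- The covering of the circle by the line, with period `1`. -/
def circ (t : ℝ) : Circle := Circle.exp (2 * Real.pi * t)

theorem circ_eq_circ {s t : ℝ} : circ s = circ t ↔ ∃ m : ℤ, s = t + m := by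
  unfold circ
  rw [Circle.exp_eq_exp]
  have hpi : (2 * Real.pi) ≠ 0 := by positivity
  refine exists_congr fun m => ?_
  constructor
  · intro h
    apply mul_left_cancel₀ hpi
    linarith
  · rintro rfl
    ring

theorem circ_add_int (t : ℝ) (m : ℤ) : circ (t + m) = circ t := circ_eq_circ.2 ⟨m, rfl⟩

theorem circ_add_one (t : ℝ) : circ (t + 1) = circ t := by
  simpa using circ_add_int t 1

theorem continuous_circ : Continuous circ := by
  unfold circ
  fun_prop

theorem circ_pow (t : ℝ) (d : ℕ) : circ t ^ d = circ (d * t) := by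
  unfold circ
  rw [← Circle.exp_nsmul]
  congr 1
  simp only [nsmul_eq_mul]
  ring

theorem exists_circ_eq (z : Circle) (a : ℝ) : ∃ t ∈ Ico a (a + 1), circ t = z := by
  obtain ⟨r, hr⟩ := Circle.exp_surjective z
  have hpi : (2 * Real.pi) ≠ 0 := by positivity
  refine ⟨r / (2 * Real.pi) - ⌊r / (2 * Real.pi) - a⌋, ⟨?_, ?_⟩, ?_⟩
  · linarith [Int.floor_le (r / (2 * Real.pi) - a)]
  · linarith [Int.lt_floor_add_one (r / (2 * Real.pi) - a)]
  · have : circ (r / (2 * Real.pi)) = z := by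
      rw [← hr, circ]
      congr 1
      field_simp
    rw [← this, circ_eq_circ]
    exact ⟨-⌊r / (2 * Real.pi) - a⌋, by push_cast; ring⟩

theorem eq_of_circ_eq {s t : ℝ} (h : circ s = circ t) (h1 : s < t + 1) (h2 : t < s + 1) :
    s = t := by
  obtain ⟨m, hm⟩ := circ_eq_circ.1 h
  have h3 : (m : ℝ) < 1 := by linarith
  have h4 : (-1 : ℝ) < m := by linarith
  have h5 : m = 0 := by
    have h3' : m < 1 := by exact_mod_cast h3
    have h4' : -1 < m := by exact_mod_cast h4
    omega
  simpa [h5] using hm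

theorem coe_circ (t : ℝ) :
    (circ t : ℂ) = ⟨Real.cos (2 * Real.pi * t), Real.sin (2 * Real.pi * t)⟩ := by
  rw [circ, Circle.coe_exp]
  exact Complex.ext (Complex.exp_ofReal_mul_I_re _) (Complex.exp_ofReal_mul_I_im _)

theorem circ_re (t : ℝ) : (circ t : ℂ).re = Real.cos (2 * Real.pi * t) := by rw [coe_circ]

theorem circ_im (t : ℝ) : (circ t : ℂ).im = Real.sin (2 * Real.pi * t) := by rw [coe_circ]

/-- The lifts to the line of the `d`-th roots of `circ δ`. -/
def fib (d : ℕ) (δ : ℝ) : Set ℝ := {τ | ∃ m : ℤ, d * τ = δ + m}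

theorem mem_fib_iff {d : ℕ} {δ τ : ℝ} : τ ∈ fib d δ ↔ circ τ ^ d = circ δ := by
  rw [circ_pow, circ_eq_circ]; rfl

/-- The fibre consists of the points `(δ + m) / d`, so counting it in an interval amounts to
counting integers `m`. -/
theorem encard_fib_of_iff {d : ℕ} (hd : 1 ≤ d) (δ : ℝ) (S : Set ℝ) (F : Finset ℤ)
    (h : ∀ m : ℤ, (δ + m) / d ∈ S ↔ m ∈ F) : (S ∩ fib d δ).encard = F.card := by
  have hd0 : (d : ℝ) ≠ 0 := by positivity
  have : S ∩ fib d δ = (fun m : ℤ => (δ + m) / (d : ℝ)) '' F := by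
    ext τ
    constructor
    · rintro ⟨hS, m, hm⟩
      have : τ = (δ + m) / d := by rw [← hm]; field_simp
      exact ⟨m, Finset.mem_coe.2 ((h m).1 (this ▸ hS)), this.symm⟩
    · rintro ⟨m, hm, rfl⟩
      exact ⟨(h m).2 (Finset.mem_coe.1 hm), m, by field_simp⟩
  rw [this, Function.Injective.encard_image, encard_coe_eq_coe_finsetCard]
  intro a b hab
  simp only at hab
  rw [div_left_inj' hd0] at hab
  exact_mod_cast add_left_cancel hab

/-! ### Fibre points in intervals of each type. -/

section Count
variable {d : ℕ} (hd : 1 ≤ d) (δ u v : ℝ)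
include hd

theorem encard_fib_Ioc :
    (Ioc u v ∩ fib d δ).encard = ((⌊d * v - δ⌋ - ⌊d * u - δ⌋).toNat : ℕ) := by
  have hd0 : (0 : ℝ) < d := by positivity
  rw [← Int.card_Ioc]
  refine encard_fib_of_iff hd δ _ _ fun m => ?_
  rw [Finset.mem_Ioc, mem_Ioc, Int.floor_lt, Int.le_floor, lt_div_iff₀ hd0, div_le_iff₀ hd0]
  constructor <;> rintro ⟨h1, h2⟩ <;> constructor <;> linarith

theorem encard_fib_Ico :
    (Ico u v ∩ fib d δ).encard = ((⌈d * v - δ⌉ - ⌈d * u - δ⌉).toNat : ℕ) := by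
  have hd0 : (0 : ℝ) < d := by positivity
  rw [← Int.card_Ico]
  refine encard_fib_of_iff hd δ _ _ fun m => ?_
  rw [Finset.mem_Ico, mem_Ico, Int.lt_ceil, Int.ceil_le, le_div_iff₀ hd0, div_lt_iff₀ hd0]
  constructor <;> rintro ⟨h1, h2⟩ <;> constructor <;> linarith

theorem encard_fib_Ioo :
    (Ioo u v ∩ fib d δ).encard = ((⌈d * v - δ⌉ - ⌊d * u - δ⌋ - 1).toNat : ℕ) := by
  have hd0 : (0 : ℝ) < d := by positivity
  rw [← Int.card_Ioo]
  refine encard_fib_of_iff hd δ _ _ fun m => ?_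
  rw [Finset.mem_Ioo, mem_Ioo, Int.lt_ceil, Int.floor_lt, lt_div_iff₀ hd0, div_lt_iff₀ hd0]
  constructor <;> rintro ⟨h1, h2⟩ <;> constructor <;> linarith

theorem encard_fib_Icc :
    (Icc u v ∩ fib d δ).encard = ((⌊d * v - δ⌋ + 1 - ⌈d * u - δ⌉).toNat : ℕ) := by
  have hd0 : (0 : ℝ) < d := by positivity
  rw [← Int.card_Icc]
  refine encard_fib_of_iff hd δ _ _ fun m => ?_
  rw [Finset.mem_Icc, mem_Icc, Int.ceil_le, Int.le_floor, le_div_iff₀ hd0, div_le_iff₀ hd0]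
  constructor <;> rintro ⟨h1, h2⟩ <;> constructor <;> linarith

end Count

theorem encard_fib_period {d : ℕ} (hd : 1 ≤ d) (δ a : ℝ) :
    (Ico a (a + 1) ∩ fib d δ).encard = d := by
  rw [encard_fib_Ico hd]
  have : (d * (a + 1) - δ : ℝ) = d * a - δ + d := by ring
  rw [this, Int.ceil_add_natCast]
  simp

theorem encard_circ_image {S : Set ℝ} (hS : ∀ x ∈ S, ∀ y ∈ S, circ x = circ y → x = y) :
    (circ '' S).encard = S.encard :=
  InjOn.encard_image fun x hx y hy h => hS x hx y hy h

theorem encard_roots {d : ℕ} (hd : 1 ≤ d) (c : Circle) : {z : Circle | z ^ d = c}.encard = d := by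
  obtain ⟨δ, -, rfl⟩ := exists_circ_eq c 0
  rw [← encard_fib_period hd δ 0, ← encard_circ_image]
  · congr 1
    ext z
    constructor
    · intro hz
      obtain ⟨t, ht, rfl⟩ := exists_circ_eq z 0
      exact ⟨t, ⟨ht, mem_fib_iff.2 hz⟩, rfl⟩
    · rintro ⟨t, ht, rfl⟩
      exact mem_fib_iff.1 ht.2
  · intro x hx y hy h
    exact eq_of_circ_eq h (by linarith [hx.1.2, hy.1.1]) (by linarith [hx.1.1, hy.1.2])

/-! ### The circular order in lifted coordinates -/

/-- With `x = π (b - a)` and `y = π (c - b)` this is `sin 2x + sin 2y - sin 2(x + y) = 4 sin x sin y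
sin (x + y)`, so the orientation can be read off the lifts. -/
theorem circle_area (a b c : ℝ) :
    ((starRingEnd ℂ) ((circ b : ℂ) - circ a) * ((circ c : ℂ) - circ a)).im =
      4 * Real.sin (Real.pi * (b - a)) * Real.sin (Real.pi * (c - b)) *
        Real.sin (Real.pi * (c - a)) := by
  have h1 : ((starRingEnd ℂ) ((circ b : ℂ) - circ a) * ((circ c : ℂ) - circ a)).im =
      Real.sin (2 * Real.pi * c - 2 * Real.pi * b) + Real.sin (2 * Real.pi * b - 2 * Real.pi * a)
        - Real.sin (2 * Real.pi * c - 2 * Real.pi * a) := by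
    simp only [Complex.mul_im, Complex.conj_re, Complex.conj_im, Complex.sub_re, Complex.sub_im,
      circ_re, circ_im, Real.sin_sub]
    ring
  have e1 : 2 * Real.pi * c - 2 * Real.pi * b = 2 * (Real.pi * (c - b)) := by ring
  have e2 : 2 * Real.pi * b - 2 * Real.pi * a = 2 * (Real.pi * (b - a)) := by ring
  have e3 : 2 * Real.pi * c - 2 * Real.pi * a = 2 * (Real.pi * (b - a) + Real.pi * (c - b)) := by
    ring
  have e4 : Real.pi * (c - a) = Real.pi * (b - a) + Real.pi * (c - b) := by ring
  rw [h1, e1, e2, e3, e4]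
  generalize Real.pi * (b - a) = x
  generalize Real.pi * (c - b) = y
  rw [Real.sin_two_mul, Real.sin_two_mul, Real.sin_two_mul, Real.sin_add, Real.cos_add]
  have hx := Real.sin_sq_add_cos_sq x
  have hy := Real.sin_sq_add_cos_sq y
  have hx' : Real.cos x ^ 2 = 1 - Real.sin x ^ 2 := by linarith
  have hy' : Real.cos y ^ 2 = 1 - Real.sin y ^ 2 := by linarith
  ring_nf
  simp only [hx', hy']
  ring

theorem sin_pi_pos {t : ℝ} (h0 : 0 < t) (h1 : t < 1) : 0 < Real.sin (Real.pi * t) :=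
  Real.sin_pos_of_pos_of_lt_pi (by positivity) (by nlinarith [Real.pi_pos])

theorem sin_pi_nonneg {t : ℝ} (h0 : 0 ≤ t) (h1 : t ≤ 1) : 0 ≤ Real.sin (Real.pi * t) :=
  Real.sin_nonneg_of_nonneg_of_le_pi (by positivity) (by nlinarith [Real.pi_pos])

theorem circlePos_of_lt {a b c : ℝ} (h1 : a < b) (h2 : b < c) (h3 : c < a + 1) :
    circlePos (circ a) (circ b) (circ c) := by
  unfold circlePos
  rw [circle_area]
  have := sin_pi_pos (t := b - a) (by linarith) (by linarith)
  have := sin_pi_pos (t := c - b) (by linarith) (by linarith)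
  have := sin_pi_pos (t := c - a) (by linarith) (by linarith)
  positivity

theorem circlePos_rotate {a b c : Circle} (h : circlePos a b c) : circlePos b c a := by
  unfold circlePos at *
  simp only [Complex.mul_im, Complex.conj_re, Complex.conj_im, Complex.sub_re, Complex.sub_im] at *
  linarith

theorem circlePos_asymm {a b c : Circle} (h : circlePos a b c) : ¬ circlePos c b a := by
  unfold circlePos at *
  simp only [Complex.mul_im, Complex.conj_re, Complex.conj_im, Complex.sub_re, Complex.sub_im] at *
  linarith

theorem circlePos_ne {a b c : Circle} (h : circlePos a b c) : a ≠ b ∧ b ≠ c ∧ a ≠ c := by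
  refine ⟨?_, ?_, ?_⟩ <;> rintro rfl <;> unfold circlePos at h <;>
    simp only [Complex.mul_im, Complex.conj_re, Complex.conj_im, Complex.sub_re,
      Complex.sub_im] at h <;> linarith

/-- Three numbers in increasing order, up to rotation. -/
def CyclicLt (a b c : ℝ) : Prop := (a < b ∧ b < c) ∨ (b < c ∧ c < a) ∨ (c < a ∧ a < b)

theorem circlePos_of_cyclicLt {a b c s : ℝ} (ha : a ∈ Ico s (s + 1)) (hb : b ∈ Ico s (s + 1))
    (hc : c ∈ Ico s (s + 1)) (h : CyclicLt a b c) : circlePos (circ a) (circ b) (circ c) := by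
  obtain ⟨ha1, ha2⟩ := ha
  obtain ⟨hb1, hb2⟩ := hb
  obtain ⟨hc1, hc2⟩ := hc
  rcases h with h | h | h
  · exact circlePos_of_lt h.1 h.2 (by linarith)
  · exact circlePos_rotate (circlePos_rotate (circlePos_of_lt h.1 h.2 (by linarith)))
  · exact circlePos_rotate (circlePos_of_lt h.1 h.2 (by linarith))

theorem cyclicLt_of_circlePos {a b c s : ℝ} (ha : a ∈ Ico s (s + 1)) (hb : b ∈ Ico s (s + 1))
    (hc : c ∈ Ico s (s + 1)) (h : circlePos (circ a) (circ b) (circ c)) : CyclicLt a b c := by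
  by_contra hn
  obtain ⟨h1, h2, h3⟩ := circlePos_ne h
  have h1' : a ≠ b := fun e => h1 (by rw [e])
  have h2' : b ≠ c := fun e => h2 (by rw [e])
  have h3' : a ≠ c := fun e => h3 (by rw [e])
  refine circlePos_asymm h (circlePos_of_cyclicLt hc hb ha ?_)
  unfold CyclicLt at *
  rcases lt_or_gt_of_ne h1' with h1 | h1 <;> rcases lt_or_gt_of_ne h2' with h2 | h2 <;>
    rcases lt_or_gt_of_ne h3' with h3 | h3 <;> simp_all [not_lt_of_gt]

/-! ### Chords of the unit disk -/

/-- The signed height of a point above the chord from `circ u` to `circ v`, positive on the side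
of the arc `(u, v)`.  For `v = u + 1` the chord is degenerate and the line is tangent to the
circle at `circ u`. -/
def chordHeight (u v : ℝ) (x : ℂ) : ℝ :=
  (x * (starRingEnd ℂ) (circ ((u + v) / 2) : ℂ)).re - Real.cos (Real.pi * (v - u))

theorem chordHeight_eq (u v : ℝ) (x : ℂ) : chordHeight u v x =
    x.re * Real.cos (Real.pi * (u + v)) + x.im * Real.sin (Real.pi * (u + v)) -
      Real.cos (Real.pi * (v - u)) := by
  have : 2 * Real.pi * ((u + v) / 2) = Real.pi * (u + v) := by ring
  simp only [chordHeight, Complex.mul_re, Complex.conj_re, Complex.conj_im, circ_re, circ_im, this]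
  ring

theorem chordHeight_circ (u v w : ℝ) : chordHeight u v (circ w) =
    2 * Real.sin (Real.pi * (w - u)) * Real.sin (Real.pi * (v - w)) := by
  have e1 : Real.pi * (v - u) = Real.pi * (w - u) + Real.pi * (v - w) := by ring
  have e2 : 2 * Real.pi * w - Real.pi * (u + v) = Real.pi * (w - u) - Real.pi * (v - w) := by ring
  rw [chordHeight_eq, circ_re, circ_im, ← Real.cos_sub, e2, e1, Real.cos_add, Real.cos_sub]
  ring

theorem chordHeight_combo (u v : ℝ) (x y : ℂ) {a b : ℝ} (h : a + b = 1) :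
    chordHeight u v (a • x + b • y) = a * chordHeight u v x + b * chordHeight u v y := by
  obtain rfl : b = 1 - a := by linarith
  simp only [chordHeight_eq, Complex.add_re, Complex.add_im, Complex.smul_re, Complex.smul_im,
    smul_eq_mul]
  ring

/-- The complementary arc has the same chord seen from the other side; this turns bounds above a
chord into bounds below it. -/
theorem chordHeight_swap (u v : ℝ) (x : ℂ) :
    chordHeight v (u + 1) x = - chordHeight u v x := by
  have e1 : Real.pi * (v + (u + 1)) = Real.pi * (u + v) + Real.pi := by ring
  have e2 : Real.pi * (u + 1 - v) = Real.pi - Real.pi * (v - u) := by ring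
  rw [chordHeight_eq, chordHeight_eq, e1, e2, Real.cos_add_pi, Real.sin_add_pi, Real.cos_pi_sub]
  ring

theorem continuous_chordHeight : Continuous fun p : (ℝ × ℝ) × ℂ => chordHeight p.1.1 p.1.2 p.2 := by
  simp only [chordHeight_eq]
  fun_prop

theorem continuous_chordHeight_right (u v : ℝ) : Continuous (chordHeight u v) := by
  simp only [funext (chordHeight_eq u v)]
  fun_prop

theorem chordHeight_circ_nonneg {u v w : ℝ} (h1 : u ≤ w) (h2 : w ≤ v) (h3 : v ≤ u + 1) :
    0 ≤ chordHeight u v (circ w) := by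
  rw [chordHeight_circ]
  have := sin_pi_nonneg (t := w - u) (by linarith) (by linarith)
  have := sin_pi_nonneg (t := v - w) (by linarith) (by linarith)
  positivity

theorem chordHeight_circ_pos {u v w : ℝ} (h1 : u < w) (h2 : w < v) (h3 : v ≤ u + 1) :
    0 < chordHeight u v (circ w) := by
  rw [chordHeight_circ]
  have := sin_pi_pos (t := w - u) (by linarith) (by linarith)
  have := sin_pi_pos (t := v - w) (by linarith) (by linarith)
  positivity

theorem chordHeight_nonneg_of_mem_hull {u v : ℝ} {A : Set Circle}
    (hA : ∀ z ∈ A, 0 ≤ chordHeight u v z) {x : ℂ} (hx : x ∈ circleHull A) :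
    0 ≤ chordHeight u v x := by
  have hconv : Convex ℝ {x : ℂ | 0 ≤ chordHeight u v x} := by
    intro x hx y hy a b ha hb hab
    simp only [mem_ofPred_eq] at *
    rw [chordHeight_combo u v x y hab]
    positivity
  refine convexHull_min ?_ hconv hx
  rintro _ ⟨z, hz, rfl⟩
  exact hA z hz

theorem chordHeight_full_pos {u : ℝ} {x : ℂ} (hx : ‖x‖ < 1) : 0 < chordHeight u (u + 1) x := by
  have h1 : Real.pi * (u + 1 - u) = Real.pi := by ring
  rw [chordHeight, h1, Real.cos_pi]
  have h2 := Complex.abs_re_le_norm (x * (starRingEnd ℂ) (circ ((u + (u + 1)) / 2) : ℂ))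
  rw [norm_mul, RCLike.norm_conj, Circle.norm_coe, mul_one] at h2
  have := (abs_le.1 h2).1
  linarith

/-- In the orthonormal frame whose first axis points to the middle of the arc, the point is `(c, y)`
and the ends of the chord are `(c, -s)` and `(c, s)`; the unit disk forces `|y| ≤ s`. -/
theorem mem_segment_of_chordHeight_eq_zero {u v : ℝ} {x : ℂ} (h0 : u < v) (h1 : v < u + 1)
    (hx : ‖x‖ ≤ 1) (h : chordHeight u v x = 0) :
    x ∈ segment ℝ (circ u : ℂ) (circ v : ℂ) := by
  set c := Real.cos (Real.pi * (v - u)) with hc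
  set s := Real.sin (Real.pi * (v - u)) with hs
  set C := Real.cos (Real.pi * (u + v)) with hC
  set S := Real.sin (Real.pi * (u + v)) with hS
  have hspos : 0 < s := sin_pi_pos (by linarith) (by linarith)
  have hcs : s ^ 2 + c ^ 2 = 1 := Real.sin_sq_add_cos_sq _
  have hCS : S ^ 2 + C ^ 2 = 1 := Real.sin_sq_add_cos_sq _
  rw [chordHeight_eq] at h
  set y := -x.re * S + x.im * C with hy
  have hh : x.re * C + x.im * S = c := by linarith
  have hxre : x.re = c * C - y * S := by
    rw [← hh, hy]; linear_combination (-x.re) * hCS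
  have hxim : x.im = c * S + y * C := by
    rw [← hh, hy]; linear_combination (-x.im) * hCS
  have hn : x.re ^ 2 + x.im ^ 2 ≤ 1 := by
    have := Complex.sq_norm x
    rw [Complex.normSq_apply] at this
    nlinarith [norm_nonneg x]
  have hy2 : y ^ 2 ≤ s ^ 2 := by
    have : x.re ^ 2 + x.im ^ 2 = c ^ 2 + y ^ 2 := by
      rw [hxre, hxim]; linear_combination (c ^ 2 + y ^ 2) * hCS
    linarith
  have hys := abs_le_of_sq_le_sq' hy2 hspos.le
  have eu : 2 * Real.pi * u = Real.pi * (u + v) - Real.pi * (v - u) := by ring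
  have ev : 2 * Real.pi * v = Real.pi * (u + v) + Real.pi * (v - u) := by ring
  refine ⟨(1 - y / s) / 2, (1 + y / s) / 2, ?_, ?_, by ring, ?_⟩
  · have : y / s ≤ 1 := by rw [div_le_one hspos]; exact hys.2
    linarith
  · have : -1 ≤ y / s := by rw [le_div_iff₀ hspos]; linarith [hys.1]
    linarith
  · apply Complex.ext
    · simp only [Complex.add_re, Complex.smul_re, smul_eq_mul, circ_re, eu, ev, Real.cos_add,
        Real.cos_sub, ← hc, ← hs, ← hC, ← hS]
      rw [hxre]; field_simp; ring
    · simp only [Complex.add_im, Complex.smul_im, smul_eq_mul, circ_im, eu, ev, Real.sin_add,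
        Real.sin_sub, ← hc, ← hs, ← hC, ← hS]
      rw [hxim]; field_simp; ring

theorem segment_subset_circleHull {A : Set Circle} {z w : Circle} (hz : z ∈ A) (hw : w ∈ A) :
    segment ℝ (z : ℂ) w ⊆ circleHull A :=
  segment_subset_convexHull (mem_image_of_mem _ hz) (mem_image_of_mem _ hw)

theorem circleHull_subset_closedBall (A : Set Circle) :
    circleHull A ⊆ Metric.closedBall (0 : ℂ) 1 := by
  refine convexHull_min ?_ (convex_closedBall _ _)
  rintro _ ⟨z, -, rfl⟩
  simp [Circle.norm_coe]

/-- Crossing chords have a common point. -/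
theorem chords_meet {a b c e : ℝ} (h1 : a < b) (h2 : b < c) (h3 : c < e) (h4 : e < a + 1) :
    (segment ℝ (circ a : ℂ) (circ c) ∩ segment ℝ (circ b : ℂ) (circ e)).Nonempty := by
  have hb : 0 < chordHeight a c (circ b) := chordHeight_circ_pos h1 h2 (by linarith)
  have he : chordHeight a c (circ e) < 0 := by
    have := chordHeight_circ_pos (u := c) (v := a + 1) (w := e) h3 h4 (by linarith)
    rw [chordHeight_swap] at this
    linarith
  set p := chordHeight a c (circ b)
  set q := chordHeight a c (circ e)
  have hpq : 0 < p - q := by linarith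
  -- These weights cancel the height above the first chord, positive at `b` and negative at `e`.
  set x : ℂ := (-q / (p - q)) • (circ b : ℂ) + (p / (p - q)) • (circ e : ℂ) with hx
  have hsum : -q / (p - q) + p / (p - q) = 1 := by field_simp; ring
  have hq0 : 0 ≤ -q / (p - q) := div_nonneg (by linarith) hpq.le
  have hp0 : 0 ≤ p / (p - q) := div_nonneg hb.le hpq.le
  have hseg : x ∈ segment ℝ (circ b : ℂ) (circ e) := ⟨_, _, hq0, hp0, hsum, rfl⟩
  refine ⟨x, mem_segment_of_chordHeight_eq_zero (by linarith) (by linarith) ?_ ?_, hseg⟩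
  · have := convex_closedBall (0 : ℂ) 1
    have := this.segment_subset (x := circ b) (y := circ e)
      (by simp [Circle.norm_coe]) (by simp [Circle.norm_coe]) hseg
    simpa using this
  · rw [hx, chordHeight_combo _ _ _ _ hsum]
    change -q / (p - q) * p + p / (p - q) * q = 0
    ring

/-- The oriented area spanned by a chord and a point, in terms of the height. -/
theorem area_eq_chordHeight (u v : ℝ) (x : ℂ) :
    ((starRingEnd ℂ) (x - circ u) * ((circ v : ℂ) - circ u)).im =
      2 * Real.sin (Real.pi * (v - u)) * chordHeight u v x := by
  have eu : 2 * Real.pi * u = Real.pi * (u + v) - Real.pi * (v - u) := by ring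
  have ev : 2 * Real.pi * v = Real.pi * (u + v) + Real.pi * (v - u) := by ring
  rw [chordHeight_eq]
  simp only [Complex.mul_im, Complex.conj_re, Complex.conj_im, Complex.sub_re, Complex.sub_im,
      circ_re, circ_im, eu, ev, Real.sin_sub, Real.cos_sub, Real.sin_add, Real.cos_add]
  generalize Real.pi * (u + v) = p
  generalize Real.pi * (v - u) = q
  have hp := Real.sin_sq_add_cos_sq p
  linear_combination (-2 * Real.sin q * Real.cos q) * hp

/-- A point of the disk on the inner side of the three edges of an inscribed triangle belongs to
the triangle. -/
theorem mem_convexHull_triangle {s w t : ℝ} (h1 : s < w) (h2 : w < t) (h3 : t < s + 1) {x : ℂ}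
    (hst : 0 ≤ chordHeight s t x) (hsw : chordHeight s w x ≤ 0) (hwt : chordHeight w t x ≤ 0) :
    x ∈ convexHull ℝ ({(circ s : ℂ), (circ w : ℂ), (circ t : ℂ)} : Set ℂ) := by
  set a : ℂ := (circ s : ℂ)
  set b : ℂ := (circ w : ℂ)
  set c : ℂ := (circ t : ℂ)
  have s1 := sin_pi_pos (t := t - s) (by linarith) (by linarith)
  have s2 := sin_pi_pos (t := w - s) (by linarith) (by linarith)
  have s3 := sin_pi_pos (t := t - w) (by linarith) (by linarith)
  have A1 : 0 ≤ ((starRingEnd ℂ) (x - a) * (c - a)).im := by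
    rw [area_eq_chordHeight]; positivity
  have A2 : ((starRingEnd ℂ) (x - a) * (b - a)).im ≤ 0 := by
    rw [area_eq_chordHeight]; exact mul_nonpos_of_nonneg_of_nonpos (by positivity) hsw
  have A3 : ((starRingEnd ℂ) (x - b) * (c - b)).im ≤ 0 := by
    rw [area_eq_chordHeight]; exact mul_nonpos_of_nonneg_of_nonpos (by positivity) hwt
  have D : 0 < ((starRingEnd ℂ) (b - a) * (c - a)).im := circlePos_of_lt h1 h2 h3
  set D0 := ((starRingEnd ℂ) (b - a) * (c - a)).im with hD0
  set l1 := ((starRingEnd ℂ) (x - a) * (c - a)).im with hl1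
  set l2 := ((starRingEnd ℂ) (x - a) * (b - a)).im with hl2
  set l3 := ((starRingEnd ℂ) (x - b) * (c - b)).im with hl3
  -- Barycentric coordinates: signed areas of the three subtriangles divided by the area of the
  -- triangle.
  have hsum : -l3 / D0 + l1 / D0 + -l2 / D0 = 1 := by
    have : -l3 + l1 + -l2 = D0 := by
      rw [hl1, hl2, hl3, hD0]
      simp only [Complex.mul_im, Complex.conj_re, Complex.conj_im, Complex.sub_re, Complex.sub_im]
      ring
    rw [← add_div, ← add_div, this, div_self D.ne']
  have hx : x = (-l3 / D0) • a + (l1 / D0) • b + (-l2 / D0) • c := by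
    have h : D0 • x = (-l3) • a + l1 • b + (-l2) • c := by
      rw [hl1, hl2, hl3, hD0]
      apply Complex.ext <;>
      simp only [Complex.mul_im, Complex.conj_re, Complex.conj_im, Complex.sub_re, Complex.sub_im,
        Complex.add_re, Complex.add_im, Complex.smul_re, Complex.smul_im, smul_eq_mul] <;> ring
    have h' : x = D0⁻¹ • (D0 • x) := by rw [smul_smul, inv_mul_cancel₀ D.ne', one_smul]
    rw [h', h]
    simp only [smul_add, smul_smul, div_eq_inv_mul]
  rw [hx]
  have hconv := convex_convexHull ℝ ({a, b, c} : Set ℂ)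
  have hsub := subset_convexHull ℝ ({a, b, c} : Set ℂ)
  have := hconv.sum_mem (t := Finset.univ) (w := ![-l3 / D0, l1 / D0, -l2 / D0])
    (z := ![a, b, c]) ?_ ?_ ?_
  · simpa [Fin.sum_univ_three] using this
  · intro i _
    fin_cases i
    · exact div_nonneg (by linarith) D.le
    · exact div_nonneg (by linarith) D.le
    · exact div_nonneg (by linarith) D.le
  · simpa [Fin.sum_univ_three] using hsum
  · intro i _
    fin_cases i <;> exact hsub (by simp)

/-! ### The lifted relation -/

/-- The relation on the line induced by a relation on the circle. -/
def Lift (R : Setoid Circle) (s t : ℝ) : Prop := R (circ s) (circ t)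

/-- The class of `circ a`. -/
def cls (R : Setoid Circle) (a : ℝ) : Set Circle := {z | R z (circ a)}

section Lift
variable {R : Setoid Circle}

theorem Lift.refl (s : ℝ) : Lift R s s := R.refl _
theorem Lift.symm {s t : ℝ} (h : Lift R s t) : Lift R t s := R.symm h
theorem Lift.trans {s t u : ℝ} (h : Lift R s t) (h' : Lift R t u) : Lift R s u := R.trans h h'
theorem lift_of_circ_eq {s t : ℝ} (h : circ s = circ t) : Lift R s t := by
  unfold Lift; rw [h]
theorem lift_add_one (s : ℝ) : Lift R s (s + 1) := lift_of_circ_eq (circ_add_one s).symm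
theorem lift_add_int (s : ℝ) (m : ℤ) : Lift R s (s + m) := lift_of_circ_eq (circ_add_int s m).symm

theorem cls_mem_classes (a : ℝ) : cls R a ∈ R.classes := ⟨circ a, rfl⟩

theorem exists_eq_cls {A : Set Circle} (hA : A ∈ R.classes) : ∃ a, A = cls R a := by
  obtain ⟨y, rfl⟩ := hA
  obtain ⟨t, -, rfl⟩ := exists_circ_eq y 0
  exact ⟨t, rfl⟩

theorem mem_cls {s a : ℝ} : circ s ∈ cls R a ↔ Lift R s a := Iff.rfl

theorem cls_eq_cls {a b : ℝ} : cls R a = cls R b ↔ Lift R a b := by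
  constructor
  · intro h
    have : circ a ∈ cls R a := R.refl _
    rwa [h] at this
  · intro h
    ext z
    exact ⟨fun hz => R.trans hz h, fun hz => R.trans hz (R.symm h)⟩

theorem eq_cls_of_mem {A : Set Circle} (hA : A ∈ R.classes) {a : ℝ} (h : circ a ∈ A) :
    A = cls R a := by
  obtain ⟨b, rfl⟩ := exists_eq_cls hA
  exact cls_eq_cls.2 (Lift.symm h)

variable (hT : IsTreelike R)
include hT

theorem isClosed_lift : IsClosed {p : ℝ × ℝ | Lift R p.1 p.2} :=
  hT.isClosed.preimage ((continuous_circ.comp continuous_fst).prodMk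
    (continuous_circ.comp continuous_snd))

theorem lift_of_crossing {a b c e : ℝ} (h1 : a < b) (h2 : b < c) (h3 : c < e) (h4 : e < a + 1)
    (hac : Lift R a c) (hbe : Lift R b e) : Lift R a b := by
  by_contra hn
  have hne : cls R a ≠ cls R b := fun h => hn (cls_eq_cls.1 h)
  have := hT.disjoint_hulls _ (cls_mem_classes a) _ (cls_mem_classes b) hne
  obtain ⟨x, hx, hx'⟩ := chords_meet h1 h2 h3 h4
  exact Set.disjoint_left.1 this
    (segment_subset_circleHull (mem_cls.2 (Lift.refl a)) (mem_cls.2 hac.symm) hx)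
    (segment_subset_circleHull (mem_cls.2 (Lift.refl b)) (mem_cls.2 hbe.symm) hx')

end Lift

/-! ### Degrees of classes and fibres -/

section Degree
variable {d : ℕ} {R : Setoid Circle}

theorem encard_fibre_le_powDegreeOn (A : Set Circle) (c : Circle) :
    {z | z ∈ A ∧ z ^ d = c}.encard ≤ powDegreeOn d A := by
  have h := encard_le_circDegree (fun a b c : A => circlePos a b c) circlePos
    (fun z : A => (z : Circle) ^ d) {z : A | (z : Circle) ^ d = c}
    (fun x hx y hy => by rw [mem_ofPred_eq] at hx hy; rw [hx, hy])
  have h2 : {z | z ∈ A ∧ z ^ d = c} = Subtype.val '' {z : A | (z : Circle) ^ d = c} := by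
    ext z; simp [and_comm]
  rw [h2, Subtype.val_injective.encard_image]
  exact h

theorem cls_pow_subset (hR : IsDegreeInvariant d R) {a b : ℝ}
    (h : Lift R (d * a) b) : cls R a ⊆ (fun z : Circle => z ^ d) ⁻¹' cls R b := by
  intro z hz
  have h1 : R (z ^ d) (circ a ^ d) := hR.map_rel _ _ hz
  rw [circ_pow] at h1
  exact R.trans h1 h

theorem pairwiseDisjoint_classes (P : Set Circle → Set Circle) (hP : ∀ A, P A ⊆ A)
    (T : Set (Set Circle)) (hT : T ⊆ R.classes) : T.PairwiseDisjoint P := by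
  intro A hA B hB hAB
  refine Set.disjoint_left.2 fun z hzA hzB => hAB ?_
  exact R.eq_of_mem_classes (hT hA) (hP _ hzA) (hT hB) (hP _ hzB)

/-- Every point of the class of `circ b` has in each class over it as many preimages as the
degree of that class. -/
theorem encard_fibre_eq_powDegreeOn (hd : 1 ≤ d) (hR : IsDegreeInvariant d R) {a b : ℝ}
    (h : Lift R (d * a) b) :
    {z | z ∈ cls R a ∧ z ^ d = circ b}.encard = powDegreeOn d (cls R a) := by
  set T : Set (Set Circle) :=
    {A | A ∈ R.classes ∧ A ⊆ (fun z : Circle => z ^ d) ⁻¹' cls R b} with hTdef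
  have hsum := hR.total_degree (cls R b) (cls_mem_classes b)
  have hsum' : ∑' A : T, (powDegreeOn d (A : Set Circle) : ENNReal) = d := by
    rw [← toENNReal_tsum]
    exact (congrArg ENat.toENNReal hsum).trans (by simp)
  have hunion : (⋃ A ∈ T, {z | z ∈ A ∧ z ^ d = circ b}) = {z : Circle | z ^ d = circ b} := by
    ext z
    simp only [mem_iUnion, mem_ofPred_eq]
    constructor
    · rintro ⟨A, hA, hz, h⟩
      exact h
    · intro hz
      obtain ⟨t, -, rfl⟩ := exists_circ_eq z 0
      refine ⟨cls R t, ⟨cls_mem_classes t, cls_pow_subset hR ?_⟩, Lift.refl t, hz⟩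
      rw [circ_pow] at hz
      exact lift_of_circ_eq hz
  have hcount := encard_biUnion_eq_tsum (T := T) (S := fun A => {z | z ∈ A ∧ z ^ d = circ b})
    (pairwiseDisjoint_classes (R := R) _ (fun A z hz => hz.1) T fun A hA => hA.1)
  rw [hunion, encard_roots hd] at hcount
  by_contra hne
  -- The fibre sizes are bounded termwise by the degrees and both families sum to `d`, so one strict
  -- inequality is contradictory.
  have hlt := lt_of_le_of_ne (encard_fibre_le_powDegreeOn (d := d) (cls R a) (circ b)) hne
  have := ENNReal.tsum_lt_tsum
    (f := fun A : T => (({z | z ∈ (A : Set Circle) ∧ z ^ d = circ b}.encard : ℕ∞) : ENNReal))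
    (g := fun A : T => (powDegreeOn d (A : Set Circle) : ENNReal))
    (i := ⟨cls R a, cls_mem_classes a, cls_pow_subset hR h⟩)
    (by rw [← hcount]; simp)
    (fun A => ENat.toENNReal_le.2 (encard_fibre_le_powDegreeOn _ _)) (ENat.toENNReal_lt.2 hlt)
  rw [hsum', ← hcount] at this
  simp at this

/-- The fibre in `T` splits over the classes in `T`, and each contributes its degree, whichever
point of the target class is chosen. -/
theorem encard_saturated_fibre (hd : 1 ≤ d) (hR : IsDegreeInvariant d R) {T : Set Circle}
    (hT : ∀ z ∈ T, ∀ w, R z w → w ∈ T) {b c : ℝ} (h : Lift R b c) :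
    {z | z ∈ T ∧ z ^ d = circ b}.encard = {z | z ∈ T ∧ z ^ d = circ c}.encard := by
  set 𝒯 : Set (Set Circle) :=
    {A | A ∈ R.classes ∧ A ⊆ (fun z : Circle => z ^ d) ⁻¹' cls R b ∧ A ⊆ T} with hTdef
  have key : ∀ e : ℝ, Lift R e b → ({z | z ∈ T ∧ z ^ d = circ e}.encard : ENNReal) =
      ∑' A : 𝒯, (powDegreeOn d (A : Set Circle) : ENNReal) := by
    intro e he
    have hunion : {z | z ∈ T ∧ z ^ d = circ e} = ⋃ A ∈ 𝒯, {z | z ∈ A ∧ z ^ d = circ e} := by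
      ext z
      simp only [mem_iUnion, mem_ofPred_eq]
      constructor
      · rintro ⟨hzT, hz⟩
        obtain ⟨t, -, rfl⟩ := exists_circ_eq z 0
        refine ⟨cls R t, ⟨cls_mem_classes t, cls_pow_subset hR ?_,
          fun w hw => hT _ hzT _ (R.symm hw)⟩, Lift.refl t, hz⟩
        rw [circ_pow] at hz
        exact (lift_of_circ_eq hz).trans he
      · rintro ⟨A, hA, hz, h⟩
        exact ⟨hA.2.2 hz, h⟩
    rw [hunion, encard_biUnion_eq_tsum
      (pairwiseDisjoint_classes (R := R) _ (fun A z hz => hz.1) 𝒯 fun A hA => hA.1)]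
    refine tsum_congr fun A => ?_
    obtain ⟨A, hA, hA2, hA3⟩ := A
    obtain ⟨t, rfl⟩ := exists_eq_cls hA
    have h1 : Lift R (d * t) b := by
      have := hA2 (mem_cls.2 (Lift.refl t))
      simpa only [mem_preimage, circ_pow, mem_cls] using this
    simp only
    rw [encard_fibre_eq_powDegreeOn hd hR (h1.trans he.symm)]
  have := (key b (Lift.refl b)).trans (key c h.symm).symm
  exact ENat.toENNReal_inj.1 this

theorem encard_lift_fibre {S : Set ℝ} (hinj : ∀ x ∈ S, ∀ y ∈ S, circ x = circ y → x = y) (b : ℝ) :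
    (S ∩ fib d b).encard = {z | z ∈ circ '' S ∧ z ^ d = circ b}.encard := by
  rw [← encard_circ_image fun x hx y hy => hinj x hx.1 y hy.1]
  congr 1
  ext z
  constructor
  · rintro ⟨t, ht, rfl⟩
    exact ⟨⟨t, ht.1, rfl⟩, mem_fib_iff.1 ht.2⟩
  · rintro ⟨⟨t, ht, rfl⟩, hz⟩
    exact ⟨t, ⟨ht, mem_fib_iff.2 hz⟩, rfl⟩

/-- Related points have equally many preimages in a saturated set. -/
theorem encard_saturated_fib (hd : 1 ≤ d) (hR : IsDegreeInvariant d R) {S : Set ℝ}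
    (hinj : ∀ x ∈ S, ∀ y ∈ S, circ x = circ y → x = y)
    (hS : ∀ x ∈ S, ∀ y, Lift R x y → ∃ m : ℤ, y + m ∈ S) {b c : ℝ} (h : Lift R b c) :
    (S ∩ fib d b).encard = (S ∩ fib d c).encard := by
  rw [encard_lift_fibre hinj, encard_lift_fibre hinj]
  refine encard_saturated_fibre hd hR ?_ h
  rintro _ ⟨x, hx, rfl⟩ w hw
  obtain ⟨y, -, rfl⟩ := exists_circ_eq w 0
  obtain ⟨m, hm⟩ := hS x hx y hw
  exact ⟨_, hm, circ_add_int y m⟩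

end Degree

/-! ### Arcs, gaps and their weights, in lifted coordinates -/

section Combinatorics
variable {d : ℕ} {R : Setoid Circle}

/-- When some of the points agree up to a period, transitivity replaces the crossing, so later uses
need no strict inequalities. -/
theorem lift_of_weak_crossing (hT : IsTreelike R) {a b c e : ℝ} (h1 : a ≤ b) (h2 : b ≤ c)
    (h3 : c ≤ e) (h4 : e ≤ a + 1) (hac : Lift R a c) (hbe : Lift R b e) : Lift R a b := by
  rcases h1.eq_or_lt with rfl | h1
  · exact Lift.refl _
  rcases h2.eq_or_lt with rfl | h2
  · exact hac
  rcases h3.eq_or_lt with rfl | h3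
  · exact hac.trans hbe.symm
  rcases h4.eq_or_lt with rfl | h4
  · exact (lift_add_one a).trans hbe.symm
  exact lift_of_crossing hT h1 h2 h3 h4 hac hbe

/-- A class meeting the interval between two related points is contained in it. -/
theorem exists_int_mem_Ioo (hT : IsTreelike R) {u v w w' : ℝ} (huv : Lift R u v)
    (h2 : u < w) (h3 : w < v) (hn : ¬ Lift R u w) (hw : Lift R w w') :
    ∃ m : ℤ, w' + m ∈ Ioo u v := by
  -- This is the lift of `w'` in `[u, u + 1)`; outside `(u, v)`, its chord to `w` would cross or
  -- touch that of `u` and `v`.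
  refine ⟨-⌊w' - u⌋, ?_⟩
  set x := w' + ((-⌊w' - u⌋ : ℤ) : ℝ) with hx
  have hx1 : u ≤ x := by rw [hx]; push_cast; linarith [Int.floor_le (w' - u)]
  have hx2 : x < u + 1 := by rw [hx]; push_cast; linarith [Int.lt_floor_add_one (w' - u)]
  have hwx : Lift R w x := hw.trans (lift_add_int _ _)
  by_contra hcon
  rcases hx1.eq_or_lt with h | h
  · exact hn (h ▸ hwx.symm)
  · have : v ≤ x := by
      by_contra h'
      exact hcon ⟨h, not_le.1 h'⟩
    exact hn (lift_of_weak_crossing hT h2.le h3.le this hx2.le huv hwx)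

/-- An arc of a class: an interval between two consecutive points of the class. -/
structure IsArc (R : Setoid Circle) (s t : ℝ) : Prop where
  lt : s < t
  le : t ≤ s + 1
  rel : Lift R s t
  none : ∀ w, s < w → w < t → ¬ Lift R s w

/-- An arc has a gap beneath it when the pairs of related points beneath it do not accumulate
to its endpoints. -/
def Gapped (R : Setoid Circle) (s t : ℝ) : Prop :=
  IsArc R s t ∧ ∃ l < t - s, ∀ u v, s < u → u ≤ v → v < t → Lift R u v → v - u ≤ l

/-- The right endpoints of the classes touched by the gap beneath an arc. -/
def rightEnds (R : Setoid Circle) (s t : ℝ) : Set ℝ :=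
  {z | z ∈ Ico s t ∧ (∀ u v, s < u → u < z → z < v → v < t → ¬ Lift R u v) ∧
    ∀ y, z < y → y < t → ¬ Lift R z y}

/-- A maximal pair of related points beneath an arc. -/
structure IsMaxPair (R : Setoid Circle) (s t u v : ℝ) : Prop where
  left : s < u
  le : u ≤ v
  right : v < t
  rel : Lift R u v
  max : ∀ u' v', s < u' → v' < t → Lift R u' v' → u' ≤ u → v ≤ v' → u' = u ∧ v' = v

/-- The classes (first summand) and the arcs (second summand) beneath a pair of related points. -/
def region (R : Setoid Circle) (x y : ℝ) : Set (Set Circle ⊕ ℝ × ℝ) :=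
  Sum.inl '' {U | U ∈ R.classes ∧ U ≠ cls R x ∧ ∃ τ ∈ Ioo x y, circ τ ∈ U} ∪
    Sum.inr '' {p | IsArc R p.1 p.2 ∧ x ≤ p.1 ∧ p.2 ≤ y}

theorem inl_mem_region {x y : ℝ} {U : Set Circle} : Sum.inl U ∈ region R x y ↔
    U ∈ R.classes ∧ U ≠ cls R x ∧ ∃ τ ∈ Ioo x y, circ τ ∈ U := by
  simp only [region, mem_union, mem_image, Sum.inl.injEq, exists_eq_right, reduceCtorEq, and_false,
    exists_false, or_false]
  rfl

theorem inr_mem_region {x y : ℝ} {p : ℝ × ℝ} : Sum.inr p ∈ region R x y ↔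
    IsArc R p.1 p.2 ∧ x ≤ p.1 ∧ p.2 ≤ y := by
  simp [region]

/-- The degree of the gap beneath an arc: the number of the right endpoints of its classes with
the same image as the left endpoint of the arc. -/
def arcDegree (d : ℕ) (R : Setoid Circle) (s t : ℝ) : ℕ∞ :=
  (rightEnds R s t ∩ fib d (d * s)).encard

/-- The criticality of a class, and of the gap beneath an arc. -/
def weight (d : ℕ) (R : Setoid Circle) : Set Circle ⊕ ℝ × ℝ → ENNReal
  | Sum.inl U => ((powDegreeOn d U - 1 : ℕ∞) : ENNReal)
  | Sum.inr p => ((arcDegree d R p.1 p.2 - 1 : ℕ∞) : ENNReal)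

theorem lift_mul (hR : IsDegreeInvariant d R) {s t : ℝ} (h : Lift R s t) :
    Lift R (d * s) (d * t) := by
  have := hR.map_rel _ _ h
  rwa [circ_pow, circ_pow] at this

theorem mem_fib_self (s : ℝ) : s ∈ fib d (d * s) := ⟨0, by simp⟩

theorem exists_lt_of_mem_fib (hd : 1 ≤ d) {δ x y : ℝ} (hx : x ∈ fib d δ) (hy : y ∈ fib d δ)
    (h : x < y) : ∃ m : ℤ, 1 ≤ m ∧ d * y - d * x = m := by
  obtain ⟨i, hi⟩ := hx
  obtain ⟨j, hj⟩ := hy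
  have hd0 : (0 : ℝ) < d := by positivity
  refine ⟨j - i, ?_, by push_cast; linarith⟩
  have : (i : ℝ) < j := by nlinarith
  have : i < j := by exact_mod_cast this
  omega

theorem two_points_of_one_lt_encard {S : Set ℝ} (h : 1 < S.encard) :
    ∃ x ∈ S, ∃ y ∈ S, x < y := by
  obtain ⟨x, y, hx, hy, hxy⟩ := one_lt_encard_iff.1 h
  rcases lt_or_gt_of_ne hxy with h | h
  · exact ⟨x, hx, y, hy, h⟩
  · exact ⟨y, hy, x, hx, h⟩

theorem one_lt_of_sub_one_ne_zero {n : ℕ∞} (h : ((n - 1 : ℕ∞) : ENNReal) ≠ 0) : 1 < n := by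
  by_contra hn
  exact h (by rw [tsub_eq_zero_of_le (not_lt.1 hn)]; simp)

/-- A critical class beneath a pair of related points contains two points with the same image. -/
theorem exists_pair_of_class (hd : 1 ≤ d) (hR : IsDegreeInvariant d R) {a b τ : ℝ}
    (hab : Lift R a b) (h2 : a < τ) (h3 : τ < b) (hn : ¬ Lift R a τ)
    (hw : weight d R (Sum.inl (cls R τ)) ≠ 0) :
    ∃ x y, x ∈ Ioo a b ∧ y ∈ Ioo a b ∧ x < y ∧ Lift R τ x ∧ Lift R τ y ∧
      ∃ m : ℤ, 1 ≤ m ∧ d * y - d * x = m := by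
  have h4 := one_lt_of_sub_one_ne_zero hw
  rw [← encard_fibre_eq_powDegreeOn hd hR (Lift.refl (d * τ))] at h4
  obtain ⟨z, w, ⟨hz, hz'⟩, ⟨hw, hw'⟩, hne⟩ := one_lt_encard_iff.1 h4
  have key : ∀ z : Circle, z ∈ cls R τ → ∃ x ∈ Ioo a b, circ x = z ∧ Lift R τ x := by
    intro z hz
    obtain ⟨t, -, rfl⟩ := exists_circ_eq z 0
    obtain ⟨m, hm⟩ := exists_int_mem_Ioo hR.treelike hab h2 h3 hn (Lift.symm hz)
    exact ⟨_, hm, circ_add_int t m, (Lift.symm hz).trans (lift_add_int t m)⟩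
  obtain ⟨x, hx, rfl, hx'⟩ := key z hz
  obtain ⟨y, hy, rfl, hy'⟩ := key w hw
  have hxf := mem_fib_iff.2 hz'
  have hyf := mem_fib_iff.2 hw'
  rcases lt_or_gt_of_ne (fun h : x = y => hne (by rw [h])) with h | h
  · exact ⟨x, y, hx, hy, h, hx', hy', exists_lt_of_mem_fib hd hxf hyf h⟩
  · exact ⟨y, x, hy, hx, h, hy', hx', exists_lt_of_mem_fib hd hyf hxf h⟩

theorem exists_pair_of_arc (hd : 1 ≤ d) {p q : ℝ} (hw : weight d R (Sum.inr (p, q)) ≠ 0) :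
    ∃ x y, x ∈ rightEnds R p q ∧ y ∈ rightEnds R p q ∧ x < y ∧
      ∃ m : ℤ, 1 ≤ m ∧ d * y - d * x = m := by
  obtain ⟨x, hx, y, hy, h⟩ := two_points_of_one_lt_encard (one_lt_of_sub_one_ne_zero hw)
  exact ⟨x, y, hx.1, hy.1, h, exists_lt_of_mem_fib hd hx.2 hy.2 h⟩

/-! ### Decomposition beneath a pair of related points -/

theorem isClosed_related (hT : IsTreelike R) (x : ℝ) : IsClosed {w | Lift R x w} :=
  (isClosed_lift hT).preimage (by fun_prop : Continuous fun w : ℝ => (x, w))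

/-- The ends are the nearest points related to `x` on either side of `τ`, which exist because
classes are closed. -/
theorem exists_arc_around (hT : IsTreelike R) {x y τ : ℝ} (h : y ≤ x + 1) (hxy : Lift R x y)
    (h1 : x < τ) (h2 : τ < y) (hn : ¬ Lift R x τ) :
    ∃ p q, IsArc R p q ∧ x ≤ p ∧ q ≤ y ∧ Lift R x p ∧ τ ∈ Ioo p q := by
  have hc := isClosed_related hT x
  obtain ⟨p, ⟨⟨hp1, hp2⟩, hp3⟩, hp⟩ := ((isCompact_Icc (a := x) (b := τ)).inter_right
    hc).exists_isGreatest ⟨x, ⟨le_rfl, h1.le⟩, Lift.refl x⟩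
  obtain ⟨q, ⟨⟨hq1, hq2⟩, hq3⟩, hq⟩ := ((isCompact_Icc (a := τ) (b := y)).inter_right
    hc).exists_isLeast ⟨y, ⟨h2.le, le_rfl⟩, hxy⟩
  have hpτ : p < τ := lt_of_le_of_ne hp2 fun h => hn (h ▸ hp3)
  have hqτ : τ < q := lt_of_le_of_ne hq1 fun h => hn (h ▸ hq3)
  refine ⟨p, q, ⟨hpτ.trans hqτ, by linarith, hp3.symm.trans hq3, ?_⟩, hp1, hq2, hp3, hpτ, hqτ⟩
  intro w hw1 hw2 hw
  have hw' : Lift R x w := hp3.trans hw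
  rcases le_total w τ with h | h
  · exact absurd (hp ⟨⟨by linarith, h⟩, hw'⟩) (not_le.2 hw1)
  · exact absurd (hq ⟨⟨h, by linarith⟩, hw'⟩) (not_le.2 hw2)

/-- The arcs of the class of `x` between `x` and `y`. -/
def arcsBetween (R : Setoid Circle) (x y : ℝ) : Set (ℝ × ℝ) :=
  {p | IsArc R p.1 p.2 ∧ x ≤ p.1 ∧ p.2 ≤ y ∧ Lift R x p.1}

theorem arcsBetween_unique {x y τ : ℝ} {p q : ℝ × ℝ} (hp : p ∈ arcsBetween R x y)
    (hq : q ∈ arcsBetween R x y) (h1 : τ ∈ Ioo p.1 p.2) (h2 : τ ∈ Ioo q.1 q.2) : p = q := by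
  have key : ∀ {p q : ℝ × ℝ}, p ∈ arcsBetween R x y → q ∈ arcsBetween R x y →
      τ ∈ Ioo p.1 p.2 → τ ∈ Ioo q.1 q.2 → q.1 ≤ p.1 ∧ p.2 ≤ q.2 := by
    intro p q hp hq h1 h2
    have hpq : Lift R p.1 q.1 := hp.2.2.2.symm.trans hq.2.2.2
    constructor
    · by_contra h
      exact hp.1.none q.1 (not_le.1 h) (h2.1.trans h1.2) hpq
    · by_contra h
      exact hp.1.none q.2 (h1.1.trans h2.2) (not_le.1 h) (hpq.trans hq.1.rel)
  have a := key hp hq h1 h2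
  have b := key hq hp h2 h1
  exact Prod.ext (le_antisymm b.1 a.1) (le_antisymm a.2 b.2)

/-- An arc beneath the pair has no point of the class of `x` strictly inside: non-crossing would
relate that point to the ends of the arc. So the arc of that class around its midpoint contains it.
-/
theorem region_eq_biUnion (hT : IsTreelike R) {x y : ℝ} (h : y ≤ x + 1) (hxy : Lift R x y) :
    region R x y = ⋃ p ∈ arcsBetween R x y, region R p.1 p.2 := by
  ext v
  simp only [mem_iUnion]
  rcases v with U | ⟨u, v⟩
  · simp only [inl_mem_region]
    constructor
    · rintro ⟨hU, hne, τ, hτ, hτU⟩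
      have hUτ := eq_cls_of_mem hU hτU
      have hn : ¬ Lift R x τ := fun h => hne (hUτ.trans (cls_eq_cls.2 h.symm))
      obtain ⟨p, q, hpq, hp, hq, hxp, hτ'⟩ := exists_arc_around hT h hxy hτ.1 hτ.2 hn
      exact ⟨(p, q), ⟨hpq, hp, hq, hxp⟩, hU, by rwa [cls_eq_cls.2 hxp.symm], τ, hτ', hτU⟩
    · rintro ⟨p, hp, hU, hne, τ, hτ, hτU⟩
      refine ⟨hU, by rwa [cls_eq_cls.2 hp.2.2.2], τ, ⟨?_, ?_⟩, hτU⟩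
      · exact hp.2.1.trans_lt hτ.1
      · exact hτ.2.trans_le hp.2.2.1
  · simp only [inr_mem_region]
    constructor
    · rintro ⟨huv, hu, hv⟩
      have hin : ∀ w, u < w → w < v → ¬ Lift R x w := by
        intro w h1 h2 hw
        have := lift_of_weak_crossing hT hu h1.le h2.le (hv.trans h) hw huv.rel
        exact huv.none w h1 h2 (this.symm.trans hw)
      have h1 : u < (u + v) / 2 := by linarith [huv.lt]
      have h2 : (u + v) / 2 < v := by linarith [huv.lt]
      obtain ⟨p, q, hpq, hp, hq, hxp, hτ⟩ :=
        exists_arc_around hT h hxy (hu.trans_lt h1) (h2.trans_le hv) (hin _ h1 h2)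
      refine ⟨(p, q), ⟨hpq, hp, hq, hxp⟩, huv, ?_, ?_⟩
      · by_contra hcon
        exact hin p (not_le.1 hcon) (hτ.1.trans h2) hxp
      · by_contra hcon
        exact hin q (h1.trans hτ.2) (not_le.1 hcon) (hxp.trans hpq.rel)
    · rintro ⟨p, hp, huv, hu, hv⟩
      exact ⟨huv, hp.2.1.trans hu, hv.trans hp.2.2.1⟩

theorem pairwiseDisjoint_region (hT : IsTreelike R) {x y : ℝ} (h : y ≤ x + 1) :
    (arcsBetween R x y).PairwiseDisjoint fun p => region R p.1 p.2 := by
  intro p hp q hq hpq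
  refine Set.disjoint_left.2 fun v hv hv' => hpq ?_
  rcases v with U | ⟨u, v⟩
  · rw [inl_mem_region] at hv hv'
    obtain ⟨hU, hne, τ, hτ, hτU⟩ := hv
    obtain ⟨-, -, σ, hσ, hσU⟩ := hv'
    have hτσ : Lift R τ σ := by
      rw [eq_cls_of_mem hU hσU] at hτU
      exact hτU
    obtain ⟨m, hm⟩ := exists_int_mem_Ioo hT hp.1.rel hτ.1 hτ.2 (hp.1.none τ hτ.1 hτ.2) hτσ
    have h1 := hp.2.1
    have h2 := hp.2.2.1
    have h3 := hq.2.1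
    have h4 := hq.2.2.1
    have : σ + m = σ := eq_of_circ_eq (circ_add_int σ m) (by linarith [hm.1, hm.2, hσ.1, hσ.2])
      (by linarith [hm.1, hm.2, hσ.1, hσ.2])
    exact arcsBetween_unique hp hq (this ▸ hm) hσ
  · rw [inr_mem_region] at hv hv'
    simp only at hv hv'
    have := hv.1.lt
    exact arcsBetween_unique (τ := (u + v) / 2) hp hq ⟨by linarith, by linarith⟩
      ⟨by linarith, by linarith⟩

theorem injOn_circ_Ioo {p q : ℝ} (h : q ≤ p + 1) :
    ∀ x ∈ Ioo p q, ∀ y ∈ Ioo p q, circ x = circ y → x = y := fun x hx y hy e =>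
  eq_of_circ_eq e (by linarith [hx.2, hy.1]) (by linarith [hx.1, hy.2])

/-- If the total weight beneath each arc of the class of `x` is the number of preimages there, then
the same holds beneath the pair `(x, y)`. -/
theorem total_region_pair (hd : 1 ≤ d) (hR : IsDegreeInvariant d R) {x y : ℝ} (h : y ≤ x + 1)
    (hxy : Lift R x y)
    (hP : ∀ p ∈ arcsBetween R x y, total (weight d R) (region R p.1 p.2) =
      ((Ioo p.1 p.2 ∩ fib d (d * p.1)).encard : ENNReal)) :
    total (weight d R) (region R x y) =
      (({τ | τ ∈ Ioo x y ∧ ¬ Lift R x τ} ∩ fib d (d * x)).encard : ENNReal) := by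
  have hT := hR.treelike
  rw [region_eq_biUnion hT h hxy, total_biUnion _ (pairwiseDisjoint_region hT h)]
  have hU : {τ | τ ∈ Ioo x y ∧ ¬ Lift R x τ} ∩ fib d (d * x) =
      ⋃ p ∈ arcsBetween R x y, (Ioo p.1 p.2 ∩ fib d (d * x)) := by
    ext τ
    simp only [mem_iUnion]
    constructor
    · rintro ⟨⟨hτ, hn⟩, hf⟩
      obtain ⟨p, q, hpq, hp, hq, hxp, hτ'⟩ := exists_arc_around hT h hxy hτ.1 hτ.2 hn
      exact ⟨(p, q), ⟨hpq, hp, hq, hxp⟩, hτ', hf⟩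
    · rintro ⟨p, hp, hτ, hf⟩
      refine ⟨⟨⟨hp.2.1.trans_lt hτ.1, hτ.2.trans_le hp.2.2.1⟩, fun hn => ?_⟩, hf⟩
      exact hp.1.none τ hτ.1 hτ.2 (hp.2.2.2.symm.trans hn)
  rw [hU, encard_biUnion_eq_tsum]
  · refine tsum_congr fun p => ?_
    obtain ⟨p, hp⟩ := p
    simp only
    -- `hP` counts the fibre through the arc's own endpoint; the interior of the arc is a union of
    -- classes, so the fibre through `x` has as many points there.
    rw [hP p hp, encard_saturated_fib hd hR (injOn_circ_Ioo hp.1.le) ?_ (lift_mul hR hp.2.2.2)]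
    intro w hw w' hww'
    exact exists_int_mem_Ioo hT hp.1.rel hw.1 hw.2 (hp.1.none w hw.1 hw.2) hww'
  · intro p hp q hq hpq
    refine Set.disjoint_left.2 fun τ hτ hτ' => hpq ?_
    exact arcsBetween_unique hp hq hτ.1 hτ'.1

/-- The degree of a class, counted in a set of lifts. -/
theorem powDegreeOn_cls_eq (hd : 1 ≤ d) (hR : IsDegreeInvariant d R) {x : ℝ} {S : Set ℝ}
    (hinj : ∀ x ∈ S, ∀ y ∈ S, circ x = circ y → x = y)
    (hall : ∀ w, Lift R x w → ∃ m : ℤ, w + m ∈ S) :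
    powDegreeOn d (cls R x) = ({τ | τ ∈ S ∧ Lift R x τ} ∩ fib d (d * x)).encard := by
  rw [← encard_fibre_eq_powDegreeOn hd hR (Lift.refl (d * x)),
    encard_lift_fibre fun x hx y hy => hinj x hx.1 y hy.1]
  congr 1
  ext z
  constructor
  · rintro ⟨hz, hz'⟩
    obtain ⟨t, -, rfl⟩ := exists_circ_eq z 0
    obtain ⟨m, hm⟩ := hall t (Lift.symm hz)
    exact ⟨⟨t + m, ⟨hm, (Lift.symm hz).trans (lift_add_int t m)⟩, circ_add_int t m⟩, hz'⟩
  · rintro ⟨⟨t, ht, rfl⟩, hz'⟩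
    exact ⟨Lift.symm ht.2, hz'⟩

theorem one_le_powDegreeOn_cls (hd : 1 ≤ d) (hR : IsDegreeInvariant d R) (x : ℝ) :
    1 ≤ powDegreeOn d (cls R x) := by
  rw [← encard_fibre_eq_powDegreeOn hd hR (Lift.refl (d * x)), one_le_encard_iff_nonempty]
  exact ⟨circ x, Lift.refl x, circ_pow x d⟩

theorem sub_one_add_one {n : ℕ∞} (h : 1 ≤ n) : ((n - 1 : ℕ∞) : ENNReal) + 1 = n := by
  have : n - 1 + 1 = n := tsub_add_cancel_of_le h
  exact_mod_cast congrArg ENat.toENNReal this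

/-- The total weight of a class and of all that lies beneath its span. -/
theorem total_span (hd : 1 ≤ d) (hR : IsDegreeInvariant d R) {x y : ℝ} (hle : x ≤ y)
    (h : y < x + 1) (hxy : Lift R x y) (hall : ∀ w, Lift R x w → ∃ m : ℤ, w + m ∈ Icc x y)
    (hP : ∀ p ∈ arcsBetween R x y, total (weight d R) (region R p.1 p.2) =
      ((Ioo p.1 p.2 ∩ fib d (d * p.1)).encard : ENNReal)) :
    weight d R (Sum.inl (cls R x)) + total (weight d R) (region R x y) =
      ((Ico x y ∩ fib d (d * y)).encard : ENNReal) := by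
  have hinj : ∀ u ∈ Icc x y, ∀ v ∈ Icc x y, circ u = circ v → u = v := fun u hu v hv e =>
    eq_of_circ_eq e (by linarith [hu.2, hv.1]) (by linarith [hu.1, hv.2])
  have h1 := total_region_pair hd hR h.le hxy hP
  have h2 := powDegreeOn_cls_eq hd hR hinj hall
  have h3 : ({τ | τ ∈ Icc x y ∧ Lift R x τ} ∩ fib d (d * x)) ∪
      ({τ | τ ∈ Ioo x y ∧ ¬ Lift R x τ} ∩ fib d (d * x)) = Icc x y ∩ fib d (d * x) := by
    ext τ
    constructor
    · rintro (⟨h, h'⟩ | ⟨h, h'⟩)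
      · exact ⟨h.1, h'⟩
      · exact ⟨Ioo_subset_Icc_self h.1, h'⟩
    · rintro ⟨h, h'⟩
      by_cases hτ : Lift R x τ
      · exact Or.inl ⟨⟨h, hτ⟩, h'⟩
      · refine Or.inr ⟨⟨⟨lt_of_le_of_ne h.1 ?_, lt_of_le_of_ne h.2 ?_⟩, hτ⟩, h'⟩
        · rintro rfl; exact hτ (Lift.refl _)
        · rintro rfl; exact hτ hxy
  have h4 : weight d R (Sum.inl (cls R x)) + 1 + total (weight d R) (region R x y) =
      ((Icc x y ∩ fib d (d * x)).encard : ENNReal) := by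
    rw [weight, sub_one_add_one (one_le_powDegreeOn_cls hd hR x), h1, h2, ← h3,
      encard_union_eq, ENat.toENNReal_add]
    exact Set.disjoint_left.2 fun τ hτ hτ' => hτ'.1.2 hτ.1.2
  have hd0 : (0 : ℝ) ≤ d := by positivity
  have hfl : 0 ≤ ⌊(d * y - d * x : ℝ)⌋ := Int.floor_nonneg.2 (by nlinarith)
  -- `[x, y]` holds `⌊d (y - x)⌋ + 1` points of the fibre through `x`, while `[x, y)` holds `⌊d (y -
  -- x)⌋` of that through `y`; the difference absorbs the `- 1` in the criticality of the class.
  have h5 : ((Icc x y ∩ fib d (d * x)).encard : ENNReal) =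
      ((Ico x y ∩ fib d (d * y)).encard : ENNReal) + 1 := by
    have e : (d * x - d * y : ℝ) = -(d * y - d * x) := by ring
    rw [encard_fib_Icc hd, encard_fib_Ico hd, e, Int.ceil_neg]
    simp only [sub_self, Int.ceil_zero, zero_sub, neg_neg, sub_zero]
    rw [Int.toNat_add hfl zero_le_one]
    simp
  have h6 : weight d R (Sum.inl (cls R x)) + total (weight d R) (region R x y) + 1 =
      ((Ico x y ∩ fib d (d * y)).encard : ENNReal) + 1 := by
    rw [← h5, ← h4]; ring
  exact (ENNReal.add_left_inj ENNReal.one_ne_top).1 h6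

end Combinatorics

section Gaps
variable {d : ℕ} {R : Setoid Circle}

/-! ### Maximal pairs beneath an arc -/

/-- A longest related pair around `τ` of length at most `l` exists by compactness. The bound
excludes `(s, t)` itself, after which the arc condition keeps the ends away from `s` and `t`. -/
theorem exists_isMaxPair (hT : IsTreelike R) {s t τ : ℝ} (hG : Gapped R s t) (h1 : s < τ)
    (h2 : τ < t) : ∃ u v, IsMaxPair R s t u v ∧ τ ∈ Icc u v := by
  obtain ⟨hA, l, hl, hpairs⟩ := hG
  have hl0 : 0 ≤ l := by simpa using hpairs τ τ h1 le_rfl h2 (Lift.refl τ)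
  set M : Set (ℝ × ℝ) := (Icc s τ ×ˢ Icc τ t) ∩ {p | Lift R p.1 p.2} ∩ {p | p.2 - p.1 ≤ l}
  have hM : IsCompact M := ((isCompact_Icc.prod isCompact_Icc).inter_right
    (isClosed_lift hT)).inter_right
    (isClosed_le (by fun_prop) continuous_const)
  obtain ⟨⟨u, v⟩, ⟨⟨⟨hu, hv⟩, huv⟩, hlen⟩, hmax⟩ := hM.exists_isMaxOn (f := fun p => p.2 - p.1)
    ⟨(τ, τ), ⟨⟨⟨h1.le, le_rfl⟩, ⟨le_rfl, h2.le⟩⟩, Lift.refl τ⟩, by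
      change τ - τ ≤ l; simpa using hl0⟩ (by fun_prop)
  simp only [mem_Icc] at hu hv
  replace huv : Lift R u v := huv
  replace hlen : v - u ≤ l := hlen
  have hsu : s < u := by
    refine lt_of_le_of_ne hu.1 fun h => ?_
    exact hA.none v (by linarith) (by linarith) (h ▸ huv)
  have hvt : v < t := by
    refine lt_of_le_of_ne hv.2 fun h => ?_
    exact hA.none u (by linarith) (by linarith) (hA.rel.trans (h ▸ huv.symm))
  refine ⟨u, v, ⟨hsu, hu.2.trans hv.1, hvt, huv, ?_⟩, hu.2, hv.1⟩
  intro u' v' hu' hv' hrel hle hle'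
  have hmem : (u', v') ∈ M := ⟨⟨⟨⟨hu'.le, by linarith⟩, ⟨by linarith, hv'.le⟩⟩, hrel⟩,
    hpairs u' v' hu' (by linarith) hv' hrel⟩
  have : v' - u' ≤ v - u := hmax hmem
  constructor <;> linarith

/-- A pair that overlaps the maximal one without lying inside it either encloses it or, by
non-crossing, is joined with it into a larger pair. -/
theorem IsMaxPair.contains (hT : IsTreelike R) {s t u v u' v' : ℝ} (hA : IsArc R s t)
    (h : IsMaxPair R s t u v) (h1 : s < u') (h3 : v' < t) (h4 : Lift R u' v')
    (h5 : u' ≤ v) (h6 : u ≤ v') : u ≤ u' ∧ v' ≤ v := by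
  have := hA.le
  have := h.left
  have := h.right
  have := h.le
  rcases lt_or_ge u' u with hu | hu
  · rcases le_or_gt v v' with hv | hv
    · exact absurd (h.max u' v' h1 h3 h4 hu.le hv).1 hu.ne
    · have hr := lift_of_weak_crossing hT hu.le h6 hv.le (by linarith) h4 h.rel
      exact absurd (h.max u' v h1 h.right (hr.trans h.rel) hu.le le_rfl).1 hu.ne
  · refine ⟨hu, ?_⟩
    by_contra hv
    have hv := not_le.1 hv
    have hr := lift_of_weak_crossing hT hu h5 hv.le (by linarith) h.rel h4
    exact absurd (h.max u v' h.left h3 (hr.trans h4) le_rfl hv.le).2 hv.ne'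

theorem IsMaxPair.unique (hT : IsTreelike R) {s t u v u' v' τ : ℝ} (hA : IsArc R s t)
    (h : IsMaxPair R s t u v) (h' : IsMaxPair R s t u' v') (h1 : τ ∈ Icc u v)
    (h2 : τ ∈ Icc u' v') : u = u' ∧ v = v' := by
  have a := h.contains hT hA h'.left h'.right h'.rel (h2.1.trans h1.2) (h1.1.trans h2.2)
  have b := h'.contains hT hA h.left h.right h.rel (h1.1.trans h2.2) (h2.1.trans h1.2)
  exact ⟨le_antisymm a.1 b.1, le_antisymm b.2 a.2⟩

theorem left_mem_rightEnds {s t : ℝ} (hA : IsArc R s t) : s ∈ rightEnds R s t :=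
  ⟨⟨le_rfl, hA.lt⟩, fun _ _ h1 h2 => absurd h1 (not_lt.2 h2.le), hA.none⟩

theorem IsMaxPair.right_mem_rightEnds (hT : IsTreelike R) {s t u v : ℝ} (hA : IsArc R s t)
    (h : IsMaxPair R s t u v) : v ∈ rightEnds R s t := by
  refine ⟨⟨(h.left.trans_le h.le).le, h.right⟩, fun u' v' h1 h2 h3 h4 h5 => ?_,
    fun y h1 h2 h3 => ?_⟩
  · have := (h.contains hT hA h1 h4 h5 h2.le (h.le.trans h3.le)).2
    linarith
  · have := (h.max u y h.left h2 (h.rel.trans h3) le_rfl h1.le).2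
    linarith

theorem IsMaxPair.not_mem_rightEnds {s t u v τ : ℝ} (h : IsMaxPair R s t u v)
    (h1 : τ ∈ Ico u v) : τ ∉ rightEnds R s t := by
  intro hz
  rcases h1.1.eq_or_lt with rfl | h2
  · exact hz.2.2 v h1.2 h.right h.rel
  · exact hz.2.1 u v h.left h2 h1.2 h.right h.rel

theorem exists_isMaxPair_of_notMem (hT : IsTreelike R) {s t τ : ℝ} (hG : Gapped R s t)
    (h1 : τ ∈ Ico s t) (h2 : τ ∉ rightEnds R s t) :
    ∃ u v, IsMaxPair R s t u v ∧ τ ∈ Ico u v := by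
  have h3 : s < τ := lt_of_le_of_ne h1.1 fun h => h2 (h ▸ left_mem_rightEnds hG.1)
  obtain ⟨u, v, h, hu, hv⟩ := exists_isMaxPair hT hG h3 h1.2
  refine ⟨u, v, h, hu, lt_of_le_of_ne hv ?_⟩
  rintro rfl
  exact h2 (h.right_mem_rightEnds hT hG.1)

/-! ### Counting between right endpoints -/

/-- A right end is the last point of its class before `t`, and no related pair encloses it. Hence a
cut just after it splits no class beneath the arc, whence the half-open interval. -/
theorem saturated_Ioc (hT : IsTreelike R) {s t z z' : ℝ} (hA : IsArc R s t)
    (hz : z ∈ rightEnds R s t) (hz' : z' ∈ rightEnds R s t) :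
    ∀ w ∈ Ioc z z', ∀ w', Lift R w w' → ∃ m : ℤ, w' + m ∈ Ioc z z' := by
  intro w hw w' hww'
  have hsw : s < w := hz.1.1.trans_lt hw.1
  have hwt : w < t := hw.2.trans_lt hz'.1.2
  obtain ⟨m, hm⟩ := exists_int_mem_Ioo hT hA.rel hsw hwt (hA.none w hsw hwt) hww'
  refine ⟨m, ?_⟩
  have hrel : Lift R w (w' + m) := hww'.trans (lift_add_int w' m)
  constructor
  · by_contra h
    rcases (not_lt.1 h).eq_or_lt with h | h
    · exact hz.2.2 w hw.1 hwt (h ▸ hrel.symm)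
    · exact hz.2.1 _ w hm.1 h hw.1 hwt hrel.symm
  · by_contra h
    have h := not_le.1 h
    rcases hw.2.eq_or_lt with h' | h'
    · exact hz'.2.2 _ h hm.2 (h' ▸ hrel)
    · exact hz'.2.1 w _ hsw h' h hm.2 hrel

/-- The interval `(z, z']` is saturated, so it contains equally many preimages of `circ δ` and `circ
δ'`. In terms of floors, the difference does not depend on the right end. -/
theorem floor_sub_floor_eq (hd : 1 ≤ d) (hR : IsDegreeInvariant d R) {s t z z' δ δ' : ℝ}
    (hA : IsArc R s t) (hz : z ∈ rightEnds R s t) (hz' : z' ∈ rightEnds R s t)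
    (h : Lift R δ δ') :
    ⌊d * z - δ⌋ - ⌊d * z - δ'⌋ = ⌊d * z' - δ⌋ - ⌊d * z' - δ'⌋ := by
  have hd0 : (0 : ℝ) ≤ d := by positivity
  wlog hlt : z ≤ z' generalizing z z'
  · exact (this hz' hz (le_of_not_ge hlt)).symm
  have hle := hA.le
  have h1 := encard_saturated_fib hd hR (S := Ioc z z') (fun x hx y hy e => eq_of_circ_eq e
    (by linarith [hx.2, hy.1, hz.1.1, hz'.1.2]) (by linarith [hx.1, hy.2, hz.1.1, hz'.1.2]))
    (saturated_Ioc hR.treelike hA hz hz') h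
  rw [encard_fib_Ioc hd, encard_fib_Ioc hd] at h1
  have h2 : ⌊d * z - δ⌋ ≤ ⌊d * z' - δ⌋ := Int.floor_le_floor (by nlinarith)
  have h3 : ⌊d * z - δ'⌋ ≤ ⌊d * z' - δ'⌋ := Int.floor_le_floor (by nlinarith)
  have h4 : (⌊d * z' - δ⌋ - ⌊d * z - δ⌋).toNat = (⌊d * z' - δ'⌋ - ⌊d * z - δ'⌋).toNat := by
    exact_mod_cast h1
  omega

/-- The count is `⌊d z - d u⌋ - ⌊d z - d v⌋`, the invariant difference for the related points `d u`
and `d v`. -/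
theorem encard_fib_maxPair (hd : 1 ≤ d) (hR : IsDegreeInvariant d R) {s t u v z z' : ℝ}
    (hA : IsArc R s t) (h : IsMaxPair R s t u v) (hz : z ∈ rightEnds R s t)
    (hz' : z' ∈ rightEnds R s t) :
    (Ico u v ∩ fib d (d * z)).encard = (Ico u v ∩ fib d (d * z')).encard := by
  have e : ∀ w z : ℝ, (d * w - d * z : ℝ) = -(d * z - d * w) := fun w z => by ring
  rw [encard_fib_Ico hd, encard_fib_Ico hd, e v z, e u z, e v z', e u z']
  simp only [Int.ceil_neg]
  have := floor_sub_floor_eq hd hR hA hz hz' (lift_mul hR h.rel)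
  congr 2
  omega

/-- The nondegenerate maximal pairs beneath an arc. -/
def maxPairs (R : Setoid Circle) (s t : ℝ) : Set (ℝ × ℝ) :=
  {p | IsMaxPair R s t p.1 p.2 ∧ p.1 < p.2}

theorem maxPairs_unique (hT : IsTreelike R) {s t τ : ℝ} (hA : IsArc R s t) {p q : ℝ × ℝ}
    (hp : p ∈ maxPairs R s t) (hq : q ∈ maxPairs R s t) (h1 : τ ∈ Icc p.1 p.2)
    (h2 : τ ∈ Icc q.1 q.2) : p = q :=
  have h := hp.1.unique hT hA hq.1 h1 h2
  Prod.ext h.1 h.2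

/-- A point of the fibre of a right endpoint between two right endpoints can be moved to a right
endpoint, provided that the fibre has enough points there. -/
theorem exists_rightEnd_of_encard_le (hd : 1 ≤ d) (hR : IsDegreeInvariant d R) {s t u v p : ℝ}
    (hG : Gapped R s t) (hu : u ∈ rightEnds R s t) (hv : v ∈ rightEnds R s t) (huv : u < v)
    (hp : p ∈ rightEnds R s t)
    (hle : (Ioc u v ∩ fib d (d * v)).encard ≤ (Ioc u v ∩ fib d (d * p)).encard) :
    ∃ z ∈ rightEnds R s t, z ∈ Ioc u v ∧ z ∈ fib d (d * p) := by
  have hT := hR.treelike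
  by_contra hcon
  push Not at hcon
  -- With no right end available, the fibre through `p` lies beneath maximal pairs, where it has as
  -- many points as the fibre through `v`; but the latter also contains `v` itself, which lies
  -- beneath none of them.
  set T : Set (ℝ × ℝ) := {q | q ∈ maxPairs R s t ∧ u < q.1 ∧ q.2 ≤ v}
  have hdisj : ∀ δ, T.PairwiseDisjoint fun q => Ico q.1 q.2 ∩ fib d δ := by
    intro δ p hp q hq hpq
    refine Set.disjoint_left.2 fun τ hτ hτ' => hpq ?_
    exact maxPairs_unique hT hG.1 hp.1 hq.1 (Ico_subset_Icc_self hτ.1) (Ico_subset_Icc_self hτ'.1)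
  have h1 : Ioc u v ∩ fib d (d * p) ⊆ ⋃ q ∈ T, (Ico q.1 q.2 ∩ fib d (d * p)) := by
    rintro τ ⟨hτ, hf⟩
    have hnot : τ ∉ rightEnds R s t := fun h => hcon τ h hτ hf
    obtain ⟨x, y, hxy, hτ'⟩ := exists_isMaxPair_of_notMem hT hG
      ⟨hu.1.1.trans hτ.1.le, hτ.2.trans_lt hv.1.2⟩ hnot
    simp only [mem_iUnion]
    refine ⟨(x, y), ⟨⟨hxy, hτ'.1.trans_lt hτ'.2⟩, ?_, ?_⟩, hτ', hf⟩
    · by_contra h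
      exact hxy.not_mem_rightEnds ⟨not_lt.1 h, hτ.1.trans hτ'.2⟩ hu
    · by_contra h
      exact hxy.not_mem_rightEnds ⟨hτ'.1.trans hτ.2, not_le.1 h⟩ hv
  have h2 : (⋃ q ∈ T, (Ico q.1 q.2 ∩ fib d (d * v))) ⊆ (Ioc u v ∩ fib d (d * v)) \ {v} := by
    intro τ hτ
    simp only [mem_iUnion] at hτ
    obtain ⟨q, hq, hτ, hf⟩ := hτ
    exact ⟨⟨⟨hq.2.1.trans_le hτ.1, hτ.2.le.trans hq.2.2⟩, hf⟩, (hτ.2.trans_le hq.2.2).ne⟩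
  have h3 : (⋃ q ∈ T, (Ico q.1 q.2 ∩ fib d (d * p))).encard =
      (⋃ q ∈ T, (Ico q.1 q.2 ∩ fib d (d * v))).encard := by
    rw [← ENat.toENNReal_inj, encard_biUnion_eq_tsum (hdisj _), encard_biUnion_eq_tsum (hdisj _)]
    exact tsum_congr fun q => by rw [encard_fib_maxPair hd hR hG.1 q.2.1.1 hp hv]
  have hmem : v ∈ Ioc u v ∩ fib d (d * v) := ⟨⟨huv, le_rfl⟩, mem_fib_self v⟩
  have h4 := encard_sdiff_singleton_add_one hmem
  have hfin : (Ioc u v ∩ fib d (d * v)).encard ≠ ⊤ := by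
    rw [encard_fib_Ioc hd]; exact ENat.natCast_ne_top _
  have h5 : (Ioc u v ∩ fib d (d * v)).encard ≤ ((Ioc u v ∩ fib d (d * v)) \ {v}).encard :=
    hle.trans ((encard_le_encard h1).trans (h3.le.trans (encard_le_encard h2)))
  rw [← h4] at h5
  have hfin' : ((Ioc u v ∩ fib d (d * v)) \ {v}).encard ≠ ⊤ := fun h => by
    rw [h] at h4
    exact hfin (by rw [← h4]; rfl)
  exact absurd h5 (not_le.2 (ENat.lt_add_one_iff hfin' |>.2 le_rfl))

/-! ### The total weight beneath an arc with a gap -/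

theorem fib_Ico_eq (hT : IsTreelike R) {s t : ℝ} (hG : Gapped R s t) (δ : ℝ) :
    Ico s t ∩ fib d δ = (rightEnds R s t ∩ fib d δ) ∪
      ⋃ q ∈ maxPairs R s t, (Ico q.1 q.2 ∩ fib d δ) := by
  ext τ
  constructor
  · rintro ⟨hτ, hf⟩
    by_cases h : τ ∈ rightEnds R s t
    · exact Or.inl ⟨h, hf⟩
    · obtain ⟨x, y, hxy, hτ'⟩ := exists_isMaxPair_of_notMem hT hG hτ h
      refine Or.inr ?_
      simp only [mem_iUnion]
      exact ⟨(x, y), ⟨hxy, hτ'.1.trans_lt hτ'.2⟩, hτ', hf⟩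
  · rintro (h | h)
    · exact ⟨h.1.1, h.2⟩
    · simp only [mem_iUnion] at h
      obtain ⟨q, hq, hτ, hf⟩ := h
      exact ⟨⟨hq.1.left.le.trans hτ.1, hτ.2.trans hq.1.right⟩, hf⟩

theorem encard_Ico_eq_Ioo_add_one (hd : 1 ≤ d) {s t : ℝ} (h : s < t) :
    ((Ico s t ∩ fib d (d * s)).encard : ENNReal) = (Ioo s t ∩ fib d (d * s)).encard + 1 := by
  have hd0 : (0 : ℝ) < d := by positivity
  rw [encard_fib_Ico hd, encard_fib_Ioo hd]
  have : 0 < ⌈(d * t - d * s : ℝ)⌉ := Int.ceil_pos.2 (by nlinarith)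
  simp only [sub_self, Int.floor_zero, Int.ceil_zero, sub_zero]
  have h2 : ⌈(d * t - d * s : ℝ)⌉.toNat = (⌈(d * t - d * s : ℝ)⌉ - 1).toNat + 1 := by omega
  rw [h2]
  simp

theorem one_le_arcDegree {s t : ℝ} (hA : IsArc R s t) : 1 ≤ arcDegree d R s t := by
  rw [arcDegree, one_le_encard_iff_nonempty]
  exact ⟨s, left_mem_rightEnds hA, mem_fib_self s⟩

/-- A degenerate maximal pair is the only point of its class beneath the arc, so the class is a
singleton and not critical. -/
theorem weight_singleton_eq_zero (hd : 1 ≤ d) (hR : IsDegreeInvariant d R) {s t τ : ℝ}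
    (hA : IsArc R s t) (h1 : s < τ) (h2 : τ < t) (h : IsMaxPair R s t τ τ) :
    weight d R (Sum.inl (cls R τ)) = 0 := by
  have hT := hR.treelike
  by_contra hw
  obtain ⟨x, y, hx, hy, hxy, hτx, hτy, -⟩ :=
    exists_pair_of_class hd hR hA.rel h1 h2 (hA.none τ h1 h2) hw
  have key : ∀ w ∈ Ioo s t, Lift R τ w → w = τ := by
    intro w hw hτw
    rcases le_total w τ with h' | h'
    · exact (h.max w τ hw.1 h2 hτw.symm h' le_rfl).1
    · exact (h.max τ w h1 hw.2 hτw le_rfl h').2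
  rw [key x hx hτx, key y hy hτy] at hxy
  exact lt_irrefl _ hxy

/-- `[s, t)` consists of right ends and of intervals `[u, v)` of maximal pairs. The fibre through
`s` meets the right ends in as many points as the degree of the gap, and `[u, v)` in the weight of
the class of `u` and all beneath `(u, v)`. The point `s` accounts for the `- 1` of the gap. -/
theorem total_region_gapped (hd : 1 ≤ d) (hR : IsDegreeInvariant d R) {s t : ℝ}
    (hG : Gapped R s t)
    (hP : ∀ p q, IsArc R p q → s < p → q < t → total (weight d R) (region R p q) =
      ((Ioo p q ∩ fib d (d * p)).encard : ENNReal)) :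
    total (weight d R) (region R s t) = ((Ioo s t ∩ fib d (d * s)).encard : ENNReal) := by
  have hT := hR.treelike
  have hA := hG.1
  -- `region` omits the class of its ends, which is put back here.
  set f : ℝ × ℝ → Set (Set Circle ⊕ ℝ × ℝ) :=
    fun q => {Sum.inl (cls R q.1)} ∪ region R q.1 q.2 with hf
  set V := ⋃ q ∈ maxPairs R s t, f q with hV
  have hspan : ∀ q ∈ maxPairs R s t,
      total (weight d R) (f q) = ((Ico q.1 q.2 ∩ fib d (d * s)).encard : ENNReal) := by
    intro q hq
    rw [hf]
    simp only
    rw [total_union, total_singleton, encard_fib_maxPair hd hR hA hq.1 (left_mem_rightEnds hA)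
      (hq.1.right_mem_rightEnds hT hA)]
    · refine total_span hd hR hq.1.le ?_ hq.1.rel ?_ fun p hp => ?_
      · linarith [hA.le, hq.1.left, hq.1.right]
      · intro w hw
        have h1 := hq.1.left
        have h2 := hq.1.le.trans_lt hq.1.right
        obtain ⟨m, hm⟩ := exists_int_mem_Ioo hT hA.rel h1 h2 (hA.none _ h1 h2) hw
        have hrel := hw.trans (lift_add_int w m)
        refine ⟨m, ?_⟩
        rcases le_total q.1 (w + m) with h | h
        · exact ⟨h, (hq.1.contains hT hA h1 hm.2 hrel hq.1.le h).2⟩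
        · have := (hq.1.contains hT hA hm.1 h2 hrel.symm (h.trans hq.1.le) le_rfl).1
          exact ⟨this, h.trans hq.1.le⟩
      · exact hP p.1 p.2 hp.1 (hq.1.left.trans_le hp.2.1) (hp.2.2.1.trans_lt hq.1.right)
    · rw [Set.disjoint_singleton_left, inl_mem_region]
      rintro ⟨-, h, -⟩
      exact h rfl
  have hmeet : ∀ q ∈ maxPairs R s t, ∀ U, Sum.inl U ∈ f q → U ∈ R.classes ∧
      ∃ τ ∈ Icc q.1 q.2, circ τ ∈ U := by
    rintro q hq U (h | h)
    · obtain rfl : U = cls R q.1 := Sum.inl.inj h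
      exact ⟨cls_mem_classes _, q.1, ⟨le_rfl, hq.2.le⟩, Lift.refl _⟩
    · obtain ⟨hU, -, τ, hτ, h⟩ := inl_mem_region.1 h
      exact ⟨hU, τ, Ioo_subset_Icc_self hτ, h⟩
  have hdisj : (maxPairs R s t).PairwiseDisjoint f := by
    intro p hp q hq hpq
    refine Set.disjoint_left.2 fun v hv hv' => hpq ?_
    rcases v with U | ⟨u, v⟩
    · obtain ⟨hU, τ, hτ, hτU⟩ := hmeet p hp U hv
      obtain ⟨-, σ, hσ, hσU⟩ := hmeet q hq U hv'
      have hτσ : Lift R τ σ := by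
        rw [eq_cls_of_mem hU hσU] at hτU
        exact hτU
      have hp' := hp.1
      have hq' := hq.1
      have a1 := hp'.left
      have a2 := hp'.right
      have b1 := hq'.left
      have b2 := hq'.right
      refine maxPairs_unique (τ := σ) hT hA hp hq ?_ hσ
      rcases le_total τ σ with h | h
      · exact ⟨hτ.1.trans h, (hp'.contains hT hA (a1.trans_le hτ.1) (hσ.2.trans_lt b2) hτσ
          hτ.2 (hτ.1.trans h)).2⟩
      · exact ⟨(hp'.contains hT hA (b1.trans_le hσ.1) (hτ.2.trans_lt a2) hτσ.symm
          (h.trans hτ.2) hτ.1).1, h.trans hτ.2⟩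
    · rcases hv with hv | hv
      · cases hv
      rcases hv' with hv' | hv'
      · cases hv'
      rw [inr_mem_region] at hv hv'
      simp only at hv hv'
      have := hv.1.lt
      exact maxPairs_unique (τ := u) hT hA hp hq ⟨by linarith, by linarith⟩
        ⟨by linarith, by linarith⟩
  have hsub : {Sum.inr (s, t)} ∪ V ⊆ region R s t := by
    rintro v (rfl | hv)
    · exact inr_mem_region.2 ⟨hA, le_rfl, le_rfl⟩
    · rw [hV] at hv
      simp only [mem_iUnion] at hv
      obtain ⟨q, hq, hv⟩ := hv
      have h1 := hq.1.left
      have h2 := hq.1.right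
      rcases v with U | ⟨u, v⟩
      · obtain ⟨hU, τ, hτ, hτU⟩ := hmeet q hq U hv
        rw [inl_mem_region]
        refine ⟨hU, ?_, τ, ⟨h1.trans_le hτ.1, hτ.2.trans_lt h2⟩, hτU⟩
        rintro rfl
        exact hA.none τ (h1.trans_le hτ.1) (hτ.2.trans_lt h2) (Lift.symm hτU)
      · rcases hv with hv | hv
        · cases hv
        rw [inr_mem_region] at hv ⊢
        exact ⟨hv.1, h1.le.trans hv.2.1, hv.2.2.trans h2.le⟩
  -- All that can remain are classes of degenerate maximal pairs.
  have hzero : ∀ v ∈ region R s t, v ∉ ({Sum.inr (s, t)} ∪ V : Set _) → weight d R v = 0 := by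
    intro v hv hnv
    rcases v with U | ⟨u, v⟩
    · obtain ⟨hU, hne, τ, hτ, hτU⟩ := inl_mem_region.1 hv
      obtain ⟨x, y, hxy, hx, hy⟩ := exists_isMaxPair hT hG hτ.1 hτ.2
      obtain rfl := eq_cls_of_mem hU hτU
      rcases hxy.le.eq_or_lt with rfl | hlt
      · obtain rfl : x = τ := le_antisymm hx hy
        exact weight_singleton_eq_zero hd hR hA hτ.1 hτ.2 hxy
      · exfalso
        refine hnv (Or.inr ?_)
        rw [hV]
        simp only [mem_iUnion]
        refine ⟨(x, y), ⟨hxy, hlt⟩, ?_⟩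
        by_cases hr : Lift R τ x
        · exact Or.inl (by rw [cls_eq_cls.2 hr]; rfl)
        · refine Or.inr (inl_mem_region.2 ⟨hU, fun h => hr (cls_eq_cls.1 h), τ, ⟨?_, ?_⟩, hτU⟩)
          · exact lt_of_le_of_ne hx fun h => hr (h ▸ Lift.refl _)
          · exact lt_of_le_of_ne hy fun h => hr (h ▸ hxy.rel.symm)
    · exfalso
      obtain ⟨huv, hu, hvt'⟩ := inr_mem_region.1 hv
      simp only at huv hu hvt'
      have hlt := huv.lt
      have hsu : s < u := by
        refine lt_of_le_of_ne hu ?_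
        rintro rfl
        rcases hvt'.eq_or_lt with rfl | hlt'
        · exact hnv (Or.inl rfl)
        · exact hA.none v hlt hlt' huv.rel
      have hvt : v < t := by
        refine lt_of_le_of_ne hvt' ?_
        rintro rfl
        exact hA.none u hsu hlt (hA.rel.trans huv.rel.symm)
      obtain ⟨x, y, hxy, hx, hy⟩ := exists_isMaxPair hT hG hsu (hlt.trans hvt)
      have hc := hxy.contains hT hA hsu hvt huv.rel hy (hx.trans hlt.le)
      refine hnv (Or.inr ?_)
      rw [hV]
      simp only [mem_iUnion]
      exact ⟨(x, y), ⟨hxy, by linarith⟩, Or.inr (inr_mem_region.2 ⟨huv, hc.1, hc.2⟩)⟩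
  rw [total_eq_of_subset _ hsub hzero, total_union, total_singleton, hV, total_biUnion _ hdisj]
  · have h1 : ∑' q : maxPairs R s t, total (weight d R) (f q) =
        ((⋃ q ∈ maxPairs R s t, (Ico q.1 q.2 ∩ fib d (d * s))).encard : ENNReal) := by
      rw [encard_biUnion_eq_tsum]
      · exact tsum_congr fun q => hspan q q.2
      · intro p hp q hq hpq
        refine Set.disjoint_left.2 fun τ hτ hτ' => hpq ?_
        exact maxPairs_unique hT hA hp hq (Ico_subset_Icc_self hτ.1) (Ico_subset_Icc_self hτ'.1)
    rw [h1]
    have h2 := encard_Ico_eq_Ioo_add_one hd (s := s) (t := t) hA.lt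
    rw [fib_Ico_eq hT hG, encard_union_eq, ENat.toENNReal_add] at h2
    · have h3 : weight d R (Sum.inr (s, t)) + 1 = (arcDegree d R s t : ENNReal) :=
        sub_one_add_one (one_le_arcDegree hA)
      refine (ENNReal.add_left_inj ENNReal.one_ne_top).1 ?_
      rw [← h2, add_right_comm, h3]
      rfl
    · refine Set.disjoint_left.2 fun τ hτ hτ' => ?_
      simp only [mem_iUnion] at hτ'
      obtain ⟨q, hq, hτ', -⟩ := hτ'
      exact hq.1.not_mem_rightEnds hτ' hτ.1
  · rw [Set.disjoint_singleton_left, hV]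
    simp only [mem_iUnion]
    rintro ⟨q, hq, h | h⟩
    · cases h
    · obtain ⟨-, h, -⟩ := inr_mem_region.1 h
      exact absurd hq.1.left (not_lt.2 h)

end Gaps

/-! ### The total weight beneath an arbitrary arc, with or without a gap. -/

section Total
variable {d : ℕ} {R : Setoid Circle}

/-- Two congruent points beneath a short arc that both avoid a long subinterval. -/
theorem no_pair_outside {D a b x y z w : ℝ} {n : ℕ} {m : ℤ} (hD : 0 < D) (hax : a ≤ x)
    (hyb : y ≤ b) (hab : D * b - D * a ≤ n + 1) (hxy : (n : ℝ) ≤ D * y - D * x)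
    (haz : a ≤ z) (hwb : w < b) (hz : z ∉ Ioo x y) (hw : w ∉ Ioo x y)
    (hm : D * w - D * z = m) (hm1 : 1 ≤ m)
    (h : (n : ℝ) < D * y - D * x ∨ (a < x ∧ y < b ∧ ¬ (z = x ∧ w = y))) : False := by
  have hlt : ∀ {p q : ℝ}, p < q → D * p < D * q := fun h => mul_lt_mul_of_pos_left h hD
  have hle : ∀ {p q : ℝ}, p ≤ q → D * p ≤ D * q := fun h => mul_le_mul_of_nonneg_left h hD.le
  have hm1' : (1 : ℝ) ≤ m := by exact_mod_cast hm1
  have e1 := hle hax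
  have e2 := hle hyb
  have e3 := hle haz
  have e4 := hlt hwb
  rcases le_or_gt w x with h1 | h1
  · have e5 := hle h1
    rcases h with h | ⟨ha, hb, -⟩
    · linarith
    · linarith [hlt hb]
  · have hw' : y ≤ w := by
      by_contra h'
      exact hw ⟨h1, not_le.1 h'⟩
    have e6 := hle hw'
    rcases le_or_gt y z with h2 | h2
    · have e7 := hle h2
      rcases h with h | ⟨ha, hb, -⟩
      · linarith
      · linarith [hlt ha]
    · have hz' : z ≤ x := by
        by_contra h'
        exact hz ⟨not_le.1 h', h2⟩
      have e8 := hle hz'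
      -- Now `z ≤ x` and `y ≤ w`, while `m` is an integer less than `n + 1`. So `m ≤ n`, which
      -- either contradicts the length of `(x, y)` or makes the two pairs coincide.
      have h3 : (m : ℝ) < n + 1 := by linarith
      have h4 : m ≤ n := by
        have : m < n + 1 := by exact_mod_cast h3
        omega
      have h5 : (m : ℝ) ≤ n := by exact_mod_cast h4
      rcases h with h | ⟨-, -, h⟩
      · linarith
      · refine h ⟨?_, ?_⟩
        · by_contra hne
          linarith [hlt (lt_of_le_of_ne hz' hne)]
        · by_contra hne
          linarith [hlt (lt_of_le_of_ne hw' (Ne.symm hne))]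

/-- Otherwise the pair `(x, y)` would separate `z` from its arc, or the two chords would cross. -/
theorem IsArc.le_of_mem_rightEnds (hT : IsTreelike R) {a b x y p q z : ℝ} (hab : b ≤ a + 1)
    (hax : a ≤ x) (hyb : y ≤ b) (hxy : Lift R x y) (hA : IsArc R p q) (hap : a ≤ p) (hqb : q ≤ b)
    (hz : z ∈ rightEnds R p q) (h1 : x < z) (h2 : z < y) : x ≤ p ∧ q ≤ y := by
  have h3 := hz.1.1
  have h4 := hz.1.2
  have hxp : x ≤ p := by
    by_contra h
    have h := not_le.1 h
    have hn : ¬ Lift R p x := hA.none x h (h1.trans h4)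
    have hyq : y < q := by
      by_contra h'
      have := lift_of_weak_crossing hT h.le (h1.trans h4).le (not_lt.1 h') (by linarith) hA.rel hxy
      exact hn this
    exact hz.2.1 x y h h1 h2 hyq hxy
  refine ⟨hxp, ?_⟩
  by_contra h
  have h := not_le.1 h
  have hpy : p < y := h3.trans_lt h2
  have := lift_of_weak_crossing hT hxp hpy.le h.le (by linarith) hxy hA.rel
  exact hA.none y hpy h (this.symm.trans hxy)

/-- Outside a long pair beneath a short arc, every weight vanishes. -/
theorem weight_eq_zero_outside (hd : 1 ≤ d) (hR : IsDegreeInvariant d R) {a b x y : ℝ} {n : ℕ}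
    (hA : IsArc R a b) (hn : d * b - d * a ≤ (n + 1 : ℝ)) (hax : a ≤ x) (hyb : y ≤ b)
    (hrel : Lift R x y) (hxy : (n : ℝ) ≤ d * y - d * x)
    (h : ((n : ℝ) < d * y - d * x ∧ IsArc R x y) ∨ (a < x ∧ y < b)) :
    ∀ v ∈ region R a b, v ∉ region R x y →
      (a < x ∧ y < b → v ≠ Sum.inl (cls R x)) → weight d R v = 0 := by
  have hT := hR.treelike
  have hd0 : (0 : ℝ) < d := by positivity
  intro v hv hnv hne
  by_contra hw
  rcases v with U | ⟨p, q⟩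
  · obtain ⟨hU, hUa, τ, hτ, hτU⟩ := inl_mem_region.1 hv
    obtain rfl := eq_cls_of_mem hU hτU
    obtain ⟨z, w, hz, hw, hzw, hτz, hτw, m, hm1, hm⟩ :=
      exists_pair_of_class hd hR hA.rel hτ.1 hτ.2 (hA.none τ hτ.1 hτ.2) hw
    have hout : ∀ w, Lift R τ w → w ∉ Ioo x y := by
      intro w hτw hwxy
      refine hnv (inl_mem_region.2 ⟨hU, fun h' => ?_, w, hwxy, hτw.symm⟩)
      rcases h with h | h
      · exact h.2.none w hwxy.1 hwxy.2 ((cls_eq_cls.1 h').symm.trans hτw)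
      · exact hne h (congrArg Sum.inl h')
    refine no_pair_outside hd0 hax hyb hn hxy hz.1.le hw.2 (hout z hτz) (hout w hτw) hm hm1 ?_
    refine h.imp (fun h => h.1) fun h => ⟨h.1, h.2, ?_⟩
    rintro ⟨rfl, -⟩
    exact hne h (congrArg Sum.inl (cls_eq_cls.2 hτz))
  · obtain ⟨hpq, hp, hq⟩ := inr_mem_region.1 hv
    obtain ⟨z, w, hz, hw, hzw, m, hm1, hm⟩ := exists_pair_of_arc hd hw
    simp only at hpq hp hq
    have hout : ∀ w ∈ rightEnds R p q, w ∉ Ioo x y := by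
      intro w hw hwxy
      exact hnv (inr_mem_region.2
        (⟨hpq, hpq.le_of_mem_rightEnds hT hA.le hax hyb hrel hp hq hw hwxy.1 hwxy.2⟩))
    refine no_pair_outside hd0 hax hyb hn hxy (hp.trans hz.1.1) (hw.1.2.trans_le hq)
      (hout z hz) (hout w hw) hm hm1 ?_
    refine h.imp (fun h => h.1) fun h => ⟨h.1, h.2, ?_⟩
    rintro ⟨rfl, rfl⟩
    exact hz.2.2 _ hzw hw.1.2 hrel

theorem encard_Ioo_eq (hd : 1 ≤ d) {a b : ℝ} {n : ℕ} (h1 : (n : ℝ) < d * b - d * a)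
    (h2 : d * b - d * a ≤ (n + 1 : ℝ)) : (Ioo a b ∩ fib d (d * a)).encard = n := by
  rw [encard_fib_Ioo hd]
  have : ⌈(d * b - d * a : ℝ)⌉ = n + 1 := by
    rw [Int.ceil_eq_iff]
    push_cast
    constructor <;> linarith
  rw [this]
  simp

/-- The total weight beneath an arc is the number of the points beneath it that have the same image
as its endpoint. -/
theorem total_region_arc (hd : 1 ≤ d) (hR : IsDegreeInvariant d R) (n : ℕ) : ∀ {a b : ℝ},
    IsArc R a b → d * b - d * a ≤ (n + 1 : ℝ) → total (weight d R) (region R a b) =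
      ((Ioo a b ∩ fib d (d * a)).encard : ENNReal) := by
  have hT := hR.treelike
  have hd0 : (0 : ℝ) < d := by positivity
  have hlt : ∀ {p q : ℝ}, p < q → d * p < d * q := fun h => mul_lt_mul_of_pos_left h hd0
  have hle : ∀ {p q : ℝ}, p ≤ q → d * p ≤ d * q := fun h => mul_le_mul_of_nonneg_left h hd0.le
  induction n with
  | zero =>
    intro a b hA hn
    -- Two points with the same image differ by at least `1 / d` and do not fit in the arc, so every
    -- weight vanishes.
    rw [encard_Ioo_eq (n := 0) hd (by simpa using hlt hA.lt) hn,
      total_eq_of_subset _ (empty_subset (region R a b)) ?_]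
    · simp [total]
    · intro v hv _
      by_contra hw
      rcases v with U | ⟨p, q⟩
      · obtain ⟨hU, hUa, τ, hτ, hτU⟩ := inl_mem_region.1 hv
        obtain rfl := eq_cls_of_mem hU hτU
        obtain ⟨z, w, hz, hw, hzw, -, -, m, hm1, hm⟩ :=
          exists_pair_of_class hd hR hA.rel hτ.1 hτ.2 (hA.none τ hτ.1 hτ.2) hw
        have hm1' : (1 : ℝ) ≤ m := by exact_mod_cast hm1
        have := hlt hz.1
        have := hlt hw.2
        norm_num at hn
        linarith
      · obtain ⟨hpq, hp, hq⟩ := inr_mem_region.1 hv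
        obtain ⟨z, w, hz, hw, hzw, m, hm1, hm⟩ := exists_pair_of_arc hd hw
        have hm1' : (1 : ℝ) ≤ m := by exact_mod_cast hm1
        have := hle (hp.trans hz.1.1)
        have := hlt (hw.1.2.trans_le hq)
        norm_num at hn
        linarith
  | succ k IH =>
    intro a b hA hn
    rcases le_or_gt (d * b - d * a : ℝ) (k + 1) with hk | hk
    · exact IH hA hk
    set n : ℕ := k + 1 with hndef
    have hn0 : (1 : ℝ) ≤ n := by rw [hndef]; push_cast; linarith [(Nat.cast_nonneg k : (0 : ℝ) ≤ k)]
    have hk' : (n : ℝ) < d * b - d * a := by rw [hndef]; push_cast; exact hk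
    have IH' : ∀ {a b : ℝ}, IsArc R a b → d * b - d * a ≤ (n : ℝ) →
        total (weight d R) (region R a b) = ((Ioo a b ∩ fib d (d * a)).encard : ENNReal) := by
      intro a b hA h
      exact IH hA (by rw [hndef] at h; push_cast at h; exact h)
    -- If all related pairs strictly beneath are shorter than `n / d`, that number is a bound `l`
    -- showing that the arc is gapped, and the arcs strictly beneath fall under the induction
    -- hypothesis.
    have gap : ∀ {p q : ℝ}, IsArc R p q → (n : ℝ) < d * q - d * p →
        (∀ u v, p < u → u ≤ v → v < q → Lift R u v → d * v - d * u < (n : ℝ)) →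
        total (weight d R) (region R p q) = ((Ioo p q ∩ fib d (d * p)).encard : ENNReal) := by
      intro p q hpq hlen hpairs
      refine total_region_gapped hd hR ⟨hpq, n / d, ?_, ?_⟩ ?_
      · rw [div_lt_iff₀ hd0]; linarith
      · intro u v h1 h2 h3 h4
        rw [le_div_iff₀ hd0]
        linarith [hpairs u v h1 h2 h3 h4]
      · intro u v huv h1 h2
        exact IH' huv (hpairs u v h1 huv.lt.le h2 huv.rel).le
    rw [encard_Ioo_eq hd hk' hn]
    -- Among the related pairs in `[a, b]` of length at least `n / d` there is a shortest, `(s, t)`.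
    have hM : IsCompact ((Icc a b ×ˢ Icc a b) ∩ {p : ℝ × ℝ | Lift R p.1 p.2} ∩
        {p : ℝ × ℝ | (n : ℝ) ≤ d * p.2 - d * p.1}) :=
      ((isCompact_Icc.prod isCompact_Icc).inter_right (isClosed_lift hT)).inter_right
        (isClosed_le continuous_const (by fun_prop))
    obtain ⟨⟨s, t⟩, ⟨⟨⟨hs, ht⟩, hst⟩, hlen⟩, hmin⟩ :=
      hM.exists_isMinOn (f := fun p => p.2 - p.1)
      ⟨(a, b), ⟨⟨⟨⟨le_rfl, hA.lt.le⟩, ⟨hA.lt.le, le_rfl⟩⟩, hA.rel⟩, hk'.le⟩⟩ (by fun_prop)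
    simp only at hs ht
    replace hst : Lift R s t := hst
    replace hlen : (n : ℝ) ≤ d * t - d * s := hlen
    have hmin' : ∀ u v, a ≤ u → v ≤ b → u ≤ v → Lift R u v → (n : ℝ) ≤ d * v - d * u →
        t - s ≤ v - u := by
      intro u v h1 h2 h3 h4 h5
      exact hmin (a := (u, v)) ⟨⟨⟨⟨h1, h3.trans h2⟩, ⟨h1.trans h3, h2⟩⟩, h4⟩, h5⟩
    have hslt : s < t := by
      by_contra h
      linarith [hle (not_lt.1 h)]
    by_cases has : Lift R a s
    · have hsa : s = a := by
        by_contra h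
        exact hA.none s (lt_of_le_of_ne hs.1 (Ne.symm h)) (hslt.trans_le ht.2) has
      have htb : t = b := by
        by_contra h
        exact hA.none t (hs.1.trans_lt hslt) (lt_of_le_of_ne ht.2 h) (has.trans hst)
      subst hsa htb
      rw [gap hA hk' fun u v h1 h2 h3 h4 => ?_, encard_Ioo_eq hd hk' hn]
      by_contra h
      have := hmin' u v h1.le h3.le h2 h4 (not_lt.1 h)
      linarith
    -- The class of `s` lies strictly beneath the arc, with extreme points `x` and `y`.
    · have hc := isClosed_related hT s
      obtain ⟨x, ⟨⟨hx1, hx2⟩, hx3⟩, hx⟩ := ((isCompact_Icc (a := a) (b := b)).inter_right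
        hc).exists_isLeast ⟨s, hs, Lift.refl s⟩
      obtain ⟨y, ⟨⟨hy1, hy2⟩, hy3⟩, hy⟩ := ((isCompact_Icc (a := a) (b := b)).inter_right
        hc).exists_isGreatest ⟨s, hs, Lift.refl s⟩
      replace hx3 : Lift R s x := hx3
      replace hy3 : Lift R s y := hy3
      have hax : a < x := lt_of_le_of_ne hx1 fun h => has (h ▸ hx3.symm)
      have hyb : y < b := lt_of_le_of_ne hy2 fun h => has (hA.rel.trans (h ▸ hy3.symm))
      have hxs : x ≤ s := hx ⟨hs, Lift.refl s⟩
      have hty : t ≤ y := hy ⟨ht, hst⟩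
      have hrel : Lift R x y := hx3.symm.trans hy3
      have e1 := hle hxs
      have e2 := hle hty
      have e3 := hlt hax
      have e4 := hlt hyb
      have hxylen : (n : ℝ) ≤ d * y - d * x := by linarith
      -- If some arc of this class is longer than `n / d`, all the weight is beneath it. If not, the
      -- arcs fall under the induction hypothesis, and the weight is that of the class and all
      -- beneath its span.
      by_cases harc : ∃ p ∈ arcsBetween R x y, (n : ℝ) < d * p.2 - d * p.1
      · obtain ⟨⟨p, q⟩, ⟨hpq, hp, hq, hxp⟩, hpqlen⟩ := harc
        simp only at hpq hp hq hxp hpqlen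
        have hsp : Lift R p s := hxp.symm.trans hx3.symm
        -- As `n ≥ 1`, the long arc and the pair `(s, t)` have no room to be disjoint; being an arc
        -- of the same class, `(p, q)` then lies inside `[s, t]`.
        have hcover : s ≤ p ∧ q ≤ t := by
          have e5 := hle hp
          have e6 := hle hq
          rcases le_or_gt s p with h1 | h1
          · refine ⟨h1, ?_⟩
            by_contra h2
            rcases le_or_gt t p with h3 | h3
            · linarith [hle h3]
            · exact hpq.none t h3 (not_le.1 h2) (hsp.trans hst)
          · exfalso
            rcases lt_or_ge s q with h3 | h3
            · exact hpq.none s h1 h3 hsp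
            · linarith [hle h3]
        have hinner : ∀ u v, p < u → u ≤ v → v < q → Lift R u v →
            d * v - d * u < (n : ℝ) := by
          intro u v h1 h2 h3 h4
          by_contra h
          have := hmin' u v (by linarith) (by linarith) h2 h4 (not_lt.1 h)
          linarith [hcover.1, hcover.2]
        rw [total_eq_of_subset _ (S := region R p q), gap hpq hpqlen hinner,
          encard_Ioo_eq hd hpqlen (by linarith [hle hp, hle hq])]
        · intro v hv
          rcases v with U | ⟨u, w⟩
          · obtain ⟨hU, hne, τ, hτ, hτU⟩ := inl_mem_region.1 hv
            have haτ : a < τ := by linarith [hτ.1]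
            have hτb : τ < b := by linarith [hτ.2]
            refine inl_mem_region.2 ⟨hU, ?_, τ, ⟨haτ, hτb⟩, hτU⟩
            rintro rfl
            exact hA.none τ haτ hτb (Lift.symm hτU)
          · obtain ⟨h1, h2, h3⟩ := inr_mem_region.1 hv
            exact inr_mem_region.2 ⟨h1, by linarith, by linarith⟩
        · intro v hv hnv
          -- The class of `p` is not in `region R p q`, but it has no point inside that arc, so it
          -- is not critical.
          by_cases hne : v = Sum.inl (cls R p)
          · subst hne
            by_contra hw
            have hnap : ¬ Lift R a p := fun h => has (h.trans hsp)
            obtain ⟨z, w, hz, hw, hzw, hpz, hpw, m, hm1, hm⟩ :=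
              exists_pair_of_class hd hR hA.rel (τ := p) (by linarith) (by linarith [hpq.lt])
                hnap hw
            exact no_pair_outside hd0 (x := p) (y := q) (by linarith) (by linarith) hn hpqlen.le
              hz.1.le hw.2 (fun h => hpq.none z h.1 h.2 hpz)
              (fun h => hpq.none w h.1 h.2 hpw) hm hm1 (Or.inl hpqlen)
          · exact weight_eq_zero_outside hd hR hA hn (by linarith) (by linarith) hpq.rel hpqlen.le
              (Or.inl ⟨hpqlen, hpq⟩) v hv hnv fun _ => hne
      · push Not at harc
        have hspan := total_span hd hR (hxs.trans (hslt.le.trans hty)) (by linarith [hA.le]) hrel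
          (fun w hw => by
            have hnax : ¬ Lift R a x := fun h => has (h.trans hx3.symm)
            obtain ⟨m, hm⟩ := exists_int_mem_Ioo hT hA.rel hax (by linarith) hnax hw
            have hsw : Lift R s (w + m) := hx3.trans (hw.trans (lift_add_int w m))
            exact ⟨m, hx ⟨Ioo_subset_Icc_self hm, hsw⟩, hy ⟨Ioo_subset_Icc_self hm, hsw⟩⟩)
          (fun p hp => IH' hp.1 (harc p hp))
        rw [total_eq_of_subset _ (S := {Sum.inl (cls R x)} ∪ region R x y), total_union,
          total_singleton, hspan]
        · rw [encard_fib_Ico hd]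
          have : ⌊(d * y - d * x : ℝ)⌋ = n := by
            rw [Int.floor_eq_iff]
            push_cast
            constructor <;> linarith
          have e : (d * x - d * y : ℝ) = -(d * y - d * x) := by ring
          rw [e, Int.ceil_neg, this]
          simp
        · rw [Set.disjoint_singleton_left, inl_mem_region]
          rintro ⟨-, h, -⟩
          exact h rfl
        · rintro v (rfl | hv)
          · refine inl_mem_region.2 ⟨cls_mem_classes x, fun h => ?_, x, ⟨hax, by linarith⟩,
              Lift.refl x⟩
            exact has ((cls_eq_cls.1 h).symm.trans hx3.symm)
          · rcases v with U | ⟨u, w⟩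
            · obtain ⟨hU, hne, τ, hτ, hτU⟩ := inl_mem_region.1 hv
              have haτ : a < τ := by linarith [hτ.1]
              have hτb : τ < b := by linarith [hτ.2]
              refine inl_mem_region.2 ⟨hU, ?_, τ, ⟨haτ, hτb⟩, hτU⟩
              rintro rfl
              exact hA.none τ haτ hτb (Lift.symm hτU)
            · obtain ⟨h1, h2, h3⟩ := inr_mem_region.1 hv
              exact inr_mem_region.2 ⟨h1, by linarith, by linarith⟩
        · intro v hv hnv
          exact weight_eq_zero_outside hd hR hA hn hax.le hyb.le hrel hxylen (Or.inr ⟨hax, hyb⟩) v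
            hv (fun h => hnv (Or.inr h)) fun _ h => hnv (Or.inl h)

/-- The total weight of all classes and all arcs. -/
theorem total_weight_eq (hd : 1 ≤ d) (hR : IsDegreeInvariant d R) (α : ℝ) :
    weight d R (Sum.inl (cls R α)) + total (weight d R) (region R α (α + 1)) + 1 = d := by
  have h1 := total_region_pair hd hR le_rfl (lift_add_one α) fun p hp => by
    have hd0 : (0 : ℝ) < d := by positivity
    -- An arc has length at most `1`, so `n = d` is large enough.
    refine total_region_arc hd hR d hp.1 ?_
    have := hp.1.le
    nlinarith
  have hinj : ∀ u ∈ Ico α (α + 1), ∀ v ∈ Ico α (α + 1), circ u = circ v → u = v :=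
    fun u hu v hv e => eq_of_circ_eq e (by linarith [hu.2, hv.1]) (by linarith [hu.1, hv.2])
  have h2 := powDegreeOn_cls_eq hd hR (x := α) hinj fun w hw => by
    refine ⟨-⌊w - α⌋, ?_, ?_⟩ <;> push_cast
    · linarith [Int.floor_le (w - α)]
    · linarith [Int.lt_floor_add_one (w - α)]
  rw [h1, add_right_comm, weight, sub_one_add_one (one_le_powDegreeOn_cls hd hR α), h2,
    ← ENat.toENNReal_add, ← encard_union_eq]
  · have : ({τ | τ ∈ Ico α (α + 1) ∧ Lift R α τ} ∩ fib d (d * α)) ∪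
        ({τ | τ ∈ Ioo α (α + 1) ∧ ¬ Lift R α τ} ∩ fib d (d * α)) =
        Ico α (α + 1) ∩ fib d (d * α) := by
      ext τ
      constructor
      · rintro (⟨h, h'⟩ | ⟨h, h'⟩)
        · exact ⟨h.1, h'⟩
        · exact ⟨Ioo_subset_Ico_self h.1, h'⟩
      · rintro ⟨h, h'⟩
        by_cases hτ : Lift R α τ
        · exact Or.inl ⟨⟨h, hτ⟩, h'⟩
        · refine Or.inr ⟨⟨⟨lt_of_le_of_ne h.1 ?_, h.2⟩, hτ⟩, h'⟩
          rintro rfl; exact hτ (Lift.refl _)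
    rw [this, encard_fib_period hd]
    simp
  · exact Set.disjoint_left.2 fun τ hτ hτ' => hτ'.1.2 hτ.1.2

end Total

/-! ### The gaps of the lamination -/

section Topology
variable {R : Setoid Circle}

/-- The region of the disk beneath the chord of an arc and above all chords beneath it. -/
def gapRegion (R : Setoid Circle) (s t : ℝ) : Set ℂ :=
  {x | ‖x‖ < 1 ∧ 0 < chordHeight s t x ∧
    ∀ u v, s < u → u < v → v < t → Lift R u v → chordHeight u v x < 0}

/-- The points of an arc that are not separated from it by a pair of related points. -/
def visible (R : Setoid Circle) (s t : ℝ) : Set ℝ :=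
  {w | w ∈ Icc s t ∧ ∀ u v, s < u → u < w → w < v → v < t → ¬ Lift R u v}

theorem chordHeight_circ_nonpos {u v w : ℝ} (h1 : v ≤ w) (h2 : w ≤ u + 1) (h3 : u ≤ v) :
    chordHeight u v (circ w) ≤ 0 := by
  have := chordHeight_circ_nonneg (u := v) (v := u + 1) h1 h2 (by linarith)
  rw [chordHeight_swap] at this
  linarith

theorem chordHeight_circ_neg {u v w : ℝ} (h1 : v < w) (h2 : w < u + 1) (h3 : u ≤ v) :
    chordHeight u v (circ w) < 0 := by
  have := chordHeight_circ_pos (u := v) (v := u + 1) h1 h2 (by linarith)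
  rw [chordHeight_swap] at this
  linarith

theorem chordHeight_self_neg {u : ℝ} {x : ℂ} (hx : ‖x‖ < 1) : chordHeight u u x < 0 := by
  have := chordHeight_full_pos (u := u) hx
  rw [chordHeight_swap] at this
  linarith

/-- Strictly between a point beneath the chord and a visible point of the circle. -/
theorem combo_mem_gapRegion {s t : ℝ} {x y : ℂ} (hx : x ∈ gapRegion R s t) (hy : ‖y‖ ≤ 1)
    (h1 : 0 ≤ chordHeight s t y)
    (h2 : ∀ u v, s < u → u < v → v < t → Lift R u v → chordHeight u v y ≤ 0) {a b : ℝ}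
    (ha : 0 < a) (hb : 0 ≤ b) (hab : a + b = 1) : a • x + b • y ∈ gapRegion R s t := by
  refine ⟨?_, ?_, fun u v hu huv hv hr => ?_⟩
  · calc ‖a • x + b • y‖ ≤ ‖a • x‖ + ‖b • y‖ := norm_add_le _ _
      _ = a * ‖x‖ + b * ‖y‖ := by
        rw [norm_smul, norm_smul, Real.norm_of_nonneg ha.le, Real.norm_of_nonneg hb]
      _ < 1 := by nlinarith [hx.1]
  · rw [chordHeight_combo _ _ _ _ hab]
    have := mul_pos ha hx.2.1
    have := mul_nonneg hb h1
    linarith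
  · rw [chordHeight_combo _ _ _ _ hab]
    have := mul_neg_of_pos_of_neg ha (hx.2.2 u v hu huv hv hr)
    have := mul_nonpos_of_nonneg_of_nonpos hb (h2 u v hu huv hv hr)
    linarith

theorem convex_gapRegion (s t : ℝ) : Convex ℝ (gapRegion R s t) := by
  intro x hx y hy a b ha hb hab
  rcases ha.eq_or_lt with rfl | ha
  · have : b = 1 := by linarith
    simpa [this] using hy
  · exact combo_mem_gapRegion hx hy.1.le hy.2.1.le
      (fun u v h1 h2 h3 h4 => (hy.2.2 u v h1 h2 h3 h4).le) ha hb hab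

theorem closure_gapRegion_subset {s t : ℝ} {x : ℂ} (hx : x ∈ closure (gapRegion R s t)) :
    0 ≤ chordHeight s t x ∧
      ∀ u v, s < u → u < v → v < t → Lift R u v → chordHeight u v x ≤ 0 := by
  constructor
  · have hc : IsClosed {x | 0 ≤ chordHeight s t x} :=
      isClosed_le continuous_const (continuous_chordHeight_right s t)
    exact closure_minimal (fun y hy => hy.2.1.le) hc hx
  · intro u v h1 h2 h3 h4
    have hc : IsClosed {x | chordHeight u v x ≤ 0} :=
      isClosed_le (continuous_chordHeight_right u v) continuous_const
    exact closure_minimal (fun y hy => (hy.2.2 u v h1 h2 h3 h4).le) hc hx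

/-- The open segment from a point of the region to a visible point stays in the region. A point of
the circle enclosed by a related pair lies strictly above its chord, hence off the closure. -/
theorem gapTrace_gapRegion {s t : ℝ} (hA : IsArc R s t) (hne : (gapRegion R s t).Nonempty) :
    gapTrace (gapRegion R s t) = circ '' visible R s t := by
  have hlt := hA.lt
  have hle := hA.le
  ext z
  constructor
  · intro hz
    obtain ⟨h1, h2⟩ := closure_gapRegion_subset hz
    obtain ⟨w, hw, rfl⟩ := exists_circ_eq z s
    refine ⟨w, ⟨⟨hw.1, ?_⟩, fun u v hu huw hwv hv hr => ?_⟩, rfl⟩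
    · by_contra h
      exact absurd h1 (not_le.2 (chordHeight_circ_neg (not_le.1 h) hw.2 hlt.le))
    · have := chordHeight_circ_pos huw hwv (by linarith)
      linarith [h2 u v hu (huw.trans hwv) hv hr]
  · rintro ⟨w, ⟨⟨hw1, hw2⟩, hw⟩, rfl⟩
    obtain ⟨x, hx⟩ := hne
    have hsub : openSegment ℝ x (circ w : ℂ) ⊆ gapRegion R s t := by
      rintro _ ⟨a, b, ha, hb, hab, rfl⟩
      refine combo_mem_gapRegion hx (Circle.norm_coe _).le
        (chordHeight_circ_nonneg hw1 hw2 hle) (fun u v hu huv hv hr => ?_) ha hb.le hab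
      rcases le_or_gt w u with h | h
      · rw [← circ_add_one]
        exact chordHeight_circ_nonpos (by linarith) (by linarith) huv.le
      · rcases le_or_gt v w with h' | h'
        · exact chordHeight_circ_nonpos h' (by linarith) huv.le
        · exact absurd hr (hw u v hu h h' hv)
    exact closure_mono hsub (segment_subset_closure_openSegment (right_mem_segment ℝ _ _))

/-- A class that meets the open arc lies in `[u, v]`, where `u` and `v` are its extreme points
there, so its hull is above that chord. Any other class lies on the far side of the chord of the
arc. -/
theorem gapRegion_disjoint_hull (hT : IsTreelike R) {s t : ℝ} (hA : IsArc R s t) {x : ℂ}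
    (hx : x ∈ gapRegion R s t) {A : Set Circle} (hAc : A ∈ R.classes) : x ∉ circleHull A := by
  intro hxA
  have hlt := hA.lt
  have hle := hA.le
  by_cases hm : ∃ τ ∈ Ioo s t, circ τ ∈ A
  · obtain ⟨τ, hτ, hτA⟩ := hm
    obtain rfl := eq_cls_of_mem hAc hτA
    have hn := hA.none τ hτ.1 hτ.2
    have hc := isClosed_related hT τ
    obtain ⟨u, ⟨⟨hu1, hu2⟩, hu3⟩, hu⟩ := ((isCompact_Icc (a := s) (b := t)).inter_right
      hc).exists_isLeast ⟨τ, Ioo_subset_Icc_self hτ, Lift.refl τ⟩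
    obtain ⟨v, ⟨⟨hv1, hv2⟩, hv3⟩, hv⟩ := ((isCompact_Icc (a := s) (b := t)).inter_right
      hc).exists_isGreatest ⟨τ, Ioo_subset_Icc_self hτ, Lift.refl τ⟩
    replace hu3 : Lift R τ u := hu3
    replace hv3 : Lift R τ v := hv3
    have hsu : s < u := lt_of_le_of_ne hu1 fun h => hn (h ▸ hu3.symm)
    have hvt : v < t := lt_of_le_of_ne hv2 fun h => hn (hA.rel.trans (h ▸ hv3.symm))
    have huv : u ≤ v := (hu ⟨Ioo_subset_Icc_self hτ, Lift.refl τ⟩).trans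
      (hv ⟨Ioo_subset_Icc_self hτ, Lift.refl τ⟩)
    have hall : ∀ z ∈ cls R τ, 0 ≤ chordHeight u v z := by
      intro z hz
      obtain ⟨w, -, rfl⟩ := exists_circ_eq z 0
      obtain ⟨m, hm⟩ := exists_int_mem_Ioo hT hA.rel hτ.1 hτ.2 hn (Lift.symm hz)
      have hrel := (Lift.symm hz).trans (lift_add_int w m)
      rw [← circ_add_int w m]
      exact chordHeight_circ_nonneg (hu ⟨Ioo_subset_Icc_self hm, hrel⟩)
        (hv ⟨Ioo_subset_Icc_self hm, hrel⟩) (by linarith)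
    have h := chordHeight_nonneg_of_mem_hull hall hxA
    rcases huv.eq_or_lt with rfl | huv
    · exact absurd h (not_le.2 (chordHeight_self_neg hx.1))
    · exact absurd h (not_le.2 (hx.2.2 u v hsu huv hvt (hu3.symm.trans hv3)))
  · have hall : ∀ z ∈ A, 0 ≤ chordHeight t (s + 1) z := by
      intro z hz
      obtain ⟨w, hw, rfl⟩ := exists_circ_eq z s
      rcases hw.1.eq_or_lt with rfl | hsw
      · rw [← circ_add_one]
        exact chordHeight_circ_nonneg (by linarith) le_rfl (by linarith)
      · refine chordHeight_circ_nonneg ?_ hw.2.le (by linarith)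
        by_contra h
        exact hm ⟨w, ⟨hsw, not_le.1 h⟩, hz⟩
    have h := chordHeight_nonneg_of_mem_hull hall hxA
    rw [chordHeight_swap] at h
    linarith [hx.2.1]

/-! ### Closed hulls, and the components of the complement of the leaves. -/

theorem isClosed_class (hT : IsTreelike R) {A : Set Circle} (hA : A ∈ R.classes) : IsClosed A := by
  obtain ⟨y, rfl⟩ := hA
  exact hT.isClosed.preimage (by fun_prop : Continuous fun z : Circle => (z, y))

/-- By Carathéodory three points suffice in the plane, so the hull is a continuous image of a
compact set of triples with weights; shorter combinations are padded with zero weights. -/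
theorem IsCompact.convexHull_complex {S : Set ℂ} (hS : IsCompact S) :
    IsCompact (convexHull ℝ S) := by
  set K : Set ((ℂ × ℂ × ℂ) × (ℝ × ℝ × ℝ)) :=
    ((S ×ˢ S ×ˢ S) ×ˢ (Icc 0 1 ×ˢ Icc 0 1 ×ˢ Icc 0 1)) ∩ {p | p.2.1 + p.2.2.1 + p.2.2.2 = 1} with hKdef
  have hK : IsCompact K := ((hS.prod (hS.prod hS)).prod
    (isCompact_Icc.prod (isCompact_Icc.prod isCompact_Icc))).inter_right
    (isClosed_eq (by fun_prop) continuous_const)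
  have himage : convexHull ℝ S = (fun p : (ℂ × ℂ × ℂ) × (ℝ × ℝ × ℝ) =>
      p.2.1 • p.1.1 + p.2.2.1 • p.1.2.1 + p.2.2.2 • p.1.2.2) '' K := by
    refine Subset.antisymm (fun x hx => ?_) ?_
    · obtain ⟨ι, _, z, w, hz, hind, hpos, hsum, hx⟩ := eq_pos_convex_span_of_mem_convexHull hx
      have hzS : ∀ i, z i ∈ S := fun i => hz (mem_range_self i)
      have hcard : Fintype.card ι ≤ 3 := by
        have h1 := hind.card_le_finrank_succ
        have h2 := (vectorSpan ℝ (range z)).finrank_le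
        rw [Complex.finrank_real_complex] at h2
        omega
      have hle : ∀ i, w i ∈ Icc (0 : ℝ) 1 := fun i => ⟨(hpos i).le, by
        rw [← hsum]
        exact Finset.single_le_sum (fun j _ => (hpos j).le) (Finset.mem_univ i)⟩
      have h0 : (0 : ℝ) ∈ Icc (0 : ℝ) 1 := by simp
      obtain ⟨k, hk⟩ : ∃ k, Fintype.card ι = k := ⟨_, rfl⟩
      have e := (Fintype.equivFinOfCardEq hk).symm
      rw [← e.sum_comp] at hsum hx
      rw [hk] at hcard
      interval_cases k
      · simp at hsum
      · rw [Fin.sum_univ_one] at hsum hx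
        exact ⟨((z (e 0), z (e 0), z (e 0)), (w (e 0), 0, 0)),
          ⟨⟨⟨hzS _, hzS _, hzS _⟩, ⟨hle _, h0, h0⟩⟩, by simpa using hsum⟩, by simpa using hx⟩
      · rw [Fin.sum_univ_two] at hsum hx
        exact ⟨((z (e 0), z (e 1), z (e 0)), (w (e 0), w (e 1), 0)),
          ⟨⟨⟨hzS _, hzS _, hzS _⟩, ⟨hle _, hle _, h0⟩⟩, by simpa using hsum⟩, by simpa using hx⟩
      · rw [Fin.sum_univ_three] at hsum hx
        exact ⟨((z (e 0), z (e 1), z (e 2)), (w (e 0), w (e 1), w (e 2))),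
          ⟨⟨⟨hzS _, hzS _, hzS _⟩, ⟨hle _, hle _, hle _⟩⟩, hsum⟩, hx⟩
    · rintro _ ⟨⟨⟨a, b, c⟩, ⟨p, q, r⟩⟩, ⟨⟨⟨ha, hb, hc⟩, ⟨hp, hq, hr⟩⟩, hsum⟩, rfl⟩
      have := (convex_convexHull ℝ S).sum_mem (t := Finset.univ) (w := ![p, q, r])
        (z := ![a, b, c]) ?_ ?_ ?_
      · simpa [Fin.sum_univ_three] using this
      · intro i _
        fin_cases i
        exacts [hp.1, hq.1, hr.1]
      · simpa [Fin.sum_univ_three] using hsum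
      · intro i _
        fin_cases i
        exacts [subset_convexHull ℝ S ha, subset_convexHull ℝ S hb, subset_convexHull ℝ S hc]
  rw [himage]
  exact hK.image (by fun_prop)

theorem isClosed_circleHull (hT : IsTreelike R) {A : Set Circle} (hA : A ∈ R.classes) :
    IsClosed (circleHull A) := by
  have : IsCompact A := (isClosed_class hT hA).isCompact
  exact (this.image continuous_subtype_val).convexHull_complex.isClosed

theorem mem_ball_diff_of_notMem_hull {x : ℂ} (hx : ‖x‖ < 1) (hT : IsTreelike R)
    (h : ∀ A ∈ R.classes, x ∉ circleHull A) : x ∈ Metric.ball (0 : ℂ) 1 \ leafUnion R := by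
  refine ⟨by simpa using hx, fun hl => ?_⟩
  simp only [leafUnion, mem_iUnion] at hl
  obtain ⟨A, hA, hf, -⟩ := hl
  exact h A hA ((isClosed_circleHull hT hA).frontier_subset hf)

/-- A connected set that avoids the frontier of a hull cannot pass from its exterior to its
interior. -/
theorem notMem_hull_of_preconnected {C : Set ℂ} (hC : IsPreconnected C)
    (hsub : C ⊆ Metric.ball (0 : ℂ) 1 \ leafUnion R) {A : Set Circle} (hA : A ∈ R.classes) {x y : ℂ}
    (hx : x ∈ C) (hy : y ∈ C) (hxA : x ∉ circleHull A) : y ∉ circleHull A := by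
  intro hyA
  have hfront : ∀ z ∈ C, z ∉ frontier (circleHull A) := by
    intro z hz hf
    refine (hsub hz).2 ?_
    simp only [leafUnion, mem_iUnion]
    exact ⟨A, hA, hf, (hsub hz).1⟩
  have hint : ∀ z ∈ C, z ∈ circleHull A → z ∈ interior (circleHull A) := fun z hz hzA => by
    by_contra h
    exact hfront z hz ⟨subset_closure hzA, h⟩
  have hext : ∀ z ∈ C, z ∉ circleHull A → z ∈ interior (circleHull A)ᶜ := fun z hz hzA => by
    by_contra h
    rw [interior_compl, notMem_compl_iff] at h
    exact hfront z hz ⟨h, fun h' => hzA (interior_subset h')⟩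
  obtain ⟨z, -, hz1, hz2⟩ := hC _ _ isOpen_interior isOpen_interior
    (fun z hz => (em (z ∈ circleHull A)).imp (hint z hz) (hext z hz)) ⟨y, hy, hint y hy hyA⟩
    ⟨x, hx, hext x hx hxA⟩
  exact interior_subset hz2 (interior_subset hz1)

theorem chordHeight_ne_zero {u v : ℝ} (h1 : u < v) (h2 : v ≤ u + 1) (huv : Lift R u v) {x : ℂ}
    (hx : ‖x‖ < 1) (h : ∀ A ∈ R.classes, x ∉ circleHull A) : chordHeight u v x ≠ 0 := by
  intro h0
  rcases h2.eq_or_lt with rfl | h2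
  · exact absurd h0 (chordHeight_full_pos hx).ne'
  · exact h _ (cls_mem_classes u) (segment_subset_circleHull (mem_cls.2 (Lift.refl u))
      (mem_cls.2 huv.symm) (mem_segment_of_chordHeight_eq_zero h1 h2 hx.le h0))

/-- The region is convex, hence connected. Conversely no chord of related points meets the
component, so by the intermediate value theorem the signs that define the region persist on it. -/
theorem connectedComponentIn_gapRegion (hT : IsTreelike R) {s t : ℝ} (hA : IsArc R s t) {x : ℂ}
    (hx : x ∈ gapRegion R s t) :
    connectedComponentIn (Metric.ball (0 : ℂ) 1 \ leafUnion R) x = gapRegion R s t := by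
  have hG : gapRegion R s t ⊆ Metric.ball (0 : ℂ) 1 \ leafUnion R := fun y hy =>
    mem_ball_diff_of_notMem_hull hy.1 hT fun A hAc => gapRegion_disjoint_hull hT hA hy hAc
  refine Subset.antisymm ?_ ((convex_gapRegion s t).isPreconnected.subset_connectedComponentIn hx hG)
  intro y hy
  set C := connectedComponentIn (Metric.ball (0 : ℂ) 1 \ leafUnion R) x
  have hC : IsPreconnected C := isPreconnected_connectedComponentIn
  have hsub : C ⊆ Metric.ball (0 : ℂ) 1 \ leafUnion R := connectedComponentIn_subset _ _
  have hxC : x ∈ C := mem_connectedComponentIn (hG hx)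
  have hball : ∀ z ∈ C, ‖z‖ < 1 := fun z hz => by simpa using (hsub hz).1
  have hne : ∀ z ∈ C, ∀ u v, u < v → v ≤ u + 1 → Lift R u v → chordHeight u v z ≠ 0 :=
    fun z hz u v h1 h2 h3 => chordHeight_ne_zero h1 h2 h3 (hball z hz) fun A hAc =>
      notMem_hull_of_preconnected hC hsub hAc hxC hz (gapRegion_disjoint_hull hT hA hx hAc)
  have hlt := hA.lt
  have hle := hA.le
  refine ⟨hball y hy, ?_, fun u v hu huv hv hr => ?_⟩
  · by_contra h
    obtain ⟨z, hz, hz0⟩ := hC.intermediate_value hy hxC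
      (continuous_chordHeight_right s t).continuousOn ⟨not_lt.1 h, hx.2.1.le⟩
    exact hne z hz s t hlt hle hA.rel hz0
  · by_contra h
    obtain ⟨z, hz, hz0⟩ := hC.intermediate_value hxC hy
      (continuous_chordHeight_right u v).continuousOn
      ⟨(hx.2.2 u v hu huv hv hr).le, not_lt.1 h⟩
    exact hne z hz u v huv (by linarith) hr hz0

/-- Every point of the disk that belongs to no hull lies in the region of an arc. -/
theorem exists_gapRegion (hT : IsTreelike R) (α : ℝ) {x : ℂ} (hx : ‖x‖ < 1)
    (h : ∀ A ∈ R.classes, x ∉ circleHull A) :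
    ∃ s t, α ≤ s ∧ t ≤ α + 1 ∧ Gapped R s t ∧ x ∈ gapRegion R s t := by
  have hcont : Continuous fun p : ℝ × ℝ => chordHeight p.1 p.2 x :=
    continuous_chordHeight.comp (by fun_prop : Continuous fun p : ℝ × ℝ => (p, x))
  have hM : IsCompact ((Icc α (α + 1) ×ˢ Icc α (α + 1)) ∩ {p : ℝ × ℝ | Lift R p.1 p.2} ∩
      {p : ℝ × ℝ | p.1 ≤ p.2} ∩ {p : ℝ × ℝ | 0 ≤ chordHeight p.1 p.2 x}) :=
    (((isCompact_Icc.prod isCompact_Icc).inter_right (isClosed_lift hT)).inter_right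
      (isClosed_le continuous_fst continuous_snd)).inter_right (isClosed_le continuous_const hcont)
  -- Take a shortest related pair with `x` at nonnegative height; the full turn `(α, α + 1)` is a
  -- candidate.
  obtain ⟨⟨s, t⟩, ⟨⟨⟨⟨hs, ht⟩, hst⟩, hle⟩, hpos⟩, hmin⟩ :=
    hM.exists_isMinOn (f := fun p => p.2 - p.1)
    ⟨(α, α + 1), ⟨⟨⟨⟨⟨le_rfl, by linarith⟩, ⟨by linarith, le_rfl⟩⟩, lift_add_one α⟩,
      by change α ≤ α + 1; linarith⟩, (chordHeight_full_pos hx).le⟩⟩ (by fun_prop)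
  simp only [mem_Icc] at hs ht
  replace hst : Lift R s t := hst
  replace hle : s ≤ t := hle
  replace hpos : 0 ≤ chordHeight s t x := hpos
  have hmin' : ∀ u v, α ≤ u → v ≤ α + 1 → u ≤ v → Lift R u v → 0 ≤ chordHeight u v x →
      t - s ≤ v - u := fun u v h1 h2 h3 h4 h5 =>
    hmin (a := (u, v)) ⟨⟨⟨⟨⟨h1, h3.trans h2⟩, ⟨h1.trans h3, h2⟩⟩, h4⟩, h3⟩, h5⟩
  have hlt : s < t := by
    refine lt_of_le_of_ne hle ?_
    rintro rfl
    exact absurd hpos (not_le.2 (chordHeight_self_neg hx))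
  have hpos' : 0 < chordHeight s t x := lt_of_le_of_ne hpos
    (chordHeight_ne_zero hlt (by linarith) hst hx h).symm
  have hneg : ∀ u v, s ≤ u → u ≤ v → v ≤ t → v - u < t - s → Lift R u v →
      chordHeight u v x < 0 := by
    intro u v h1 h2 h3 h4 h5
    by_contra h6
    linarith [hmin' u v (by linarith) (by linarith) h2 h5 (not_lt.1 h6)]
  -- A related point `w` in between would put `x` in the triangle `s, w, t`; for `t = s + 1` the two
  -- chords at `w` coincide and require opposite signs.
  have hA : IsArc R s t := by
    refine ⟨hlt, by linarith, hst, fun w h1 h2 h3 => ?_⟩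
    have n1 := hneg s w le_rfl h1.le h2.le (by linarith) h3
    have n2 := hneg w t h1.le h2.le le_rfl (by linarith) (h3.symm.trans hst)
    rcases (show t ≤ s + 1 by linarith).eq_or_lt with rfl | h4
    · rw [chordHeight_swap] at n2
      linarith
    · refine h _ (cls_mem_classes s) (convexHull_mono ?_
        (mem_convexHull_triangle h1 h2 h4 hpos n1.le n2.le))
      rintro _ (rfl | rfl | rfl)
      · exact ⟨circ s, Lift.refl s, rfl⟩
      · exact ⟨circ w, h3.symm, rfl⟩
      · exact ⟨circ t, hst.symm, rfl⟩
  refine ⟨s, t, hs.1, ht.2, ⟨hA, ?_⟩, hx, hpos', fun u v h1 h2 h3 h4 =>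
    hneg u v h1.le h2.le h3.le (by linarith) h4⟩
  -- The bound for `Gapped` is the greatest length of a pair in `[s, t]`, related or not, with `x`
  -- at nonpositive height. It is less than `t - s` because the height above `(s, t)` is positive.
  have hM2 : IsCompact ((Icc s t ×ˢ Icc s t) ∩ {p : ℝ × ℝ | chordHeight p.1 p.2 x ≤ 0}) :=
    (isCompact_Icc.prod isCompact_Icc).inter_right (isClosed_le hcont continuous_const)
  obtain ⟨⟨u, v⟩, ⟨⟨hu, hv⟩, huv⟩, hmax⟩ := hM2.exists_isMaxOn (f := fun p => p.2 - p.1)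
    ⟨(s, s), ⟨⟨⟨le_rfl, hle⟩, ⟨le_rfl, hle⟩⟩, (chordHeight_self_neg hx).le⟩⟩ (by fun_prop)
  simp only [mem_Icc] at hu hv
  replace huv : chordHeight u v x ≤ 0 := huv
  refine ⟨v - u, ?_, fun u' v' h1 h2 h3 h4 => ?_⟩
  · refine lt_of_le_of_ne (by linarith) fun he => ?_
    obtain rfl : u = s := by linarith
    obtain rfl : v = t := by linarith
    linarith
  · exact hmax (a := (u', v')) ⟨⟨⟨h1.le, by linarith⟩, ⟨by linarith, h3.le⟩⟩,
      (hneg u' v' h1.le h2 h3.le (by linarith) h4).le⟩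

theorem IsMaxPair.left_mem_visible (hT : IsTreelike R) {s t u v : ℝ} (hA : IsArc R s t)
    (h : IsMaxPair R s t u v) : u ∈ visible R s t := by
  refine ⟨⟨h.left.le, (h.le.trans_lt h.right).le⟩, fun u' v' h1 h2 h3 h4 h5 => ?_⟩
  have := (h.contains hT hA h1 h4 h5 (h2.le.trans h.le) h3.le).1
  linarith

theorem exists_visible (hT : IsTreelike R) {s t : ℝ} (hG : Gapped R s t) :
    ∃ w ∈ visible R s t, s < w ∧ w < t := by
  have hlt := hG.1.lt
  obtain ⟨u, v, h, -⟩ := exists_isMaxPair hT hG (τ := (s + t) / 2) (by linarith) (by linarith)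
  exact ⟨u, h.left_mem_visible hT hG.1, h.left, h.le.trans_lt h.right⟩

/-- The midpoint of the chord from `s` to a visible point strictly inside the arc belongs to the
region. -/
theorem gapRegion_nonempty (hT : IsTreelike R) {s t : ℝ} (hG : Gapped R s t) :
    (gapRegion R s t).Nonempty := by
  obtain ⟨w, ⟨-, hw⟩, hsw, hwt⟩ := exists_visible hT hG
  have hlt := hG.1.lt
  have hle := hG.1.le
  have hhalf : (1 / 2 : ℝ) + 1 / 2 = 1 := by norm_num
  refine ⟨(1 / 2 : ℝ) • (circ s : ℂ) + (1 / 2 : ℝ) • (circ w : ℂ), ?_, ?_, ?_⟩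
  · refine norm_combo_lt_of_ne (Circle.norm_coe _).le (Circle.norm_coe _).le (fun h => ?_)
      (by norm_num) (by norm_num) hhalf
    have := eq_of_circ_eq (Circle.coe_injective h) (by linarith) (by linarith)
    linarith
  · rw [chordHeight_combo _ _ _ _ hhalf]
    have := chordHeight_circ_pos hsw hwt hle
    have := chordHeight_circ_nonneg (le_refl s) hlt.le hle
    linarith
  · intro u v h1 h2 h3 h4
    rw [chordHeight_combo _ _ _ _ hhalf]
    have e1 : chordHeight u v (circ s) < 0 := by
      rw [← circ_add_one]
      exact chordHeight_circ_neg (by linarith) (by linarith) h2.le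
    have e2 : chordHeight u v (circ w) ≤ 0 := by
      rcases le_or_gt w u with h | h
      · rw [← circ_add_one]
        exact chordHeight_circ_nonpos (by linarith) (by linarith) h2.le
      · rcases le_or_gt v w with h' | h'
        · exact chordHeight_circ_nonpos h' (by linarith) h2.le
        · exact absurd h4 (hw u v h1 h h' h3)
    linarith

theorem isIntactGap_gapRegion (hT : IsTreelike R) {s t : ℝ} (hG : Gapped R s t) :
    IsIntactGap R (gapRegion R s t) := by
  have hne := gapRegion_nonempty hT hG
  constructor
  · obtain ⟨x, hx⟩ := hne
    exact ⟨x, mem_ball_diff_of_notMem_hull hx.1 hT fun A hA =>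
      gapRegion_disjoint_hull hT hG.1 hx hA, (connectedComponentIn_gapRegion hT hG.1 hx).symm⟩
  · rw [gapTrace_gapRegion hG.1 hne]
    intro hc
    obtain ⟨w, hw, hsw, hwt⟩ := exists_visible hT hG
    have hs : s ∈ visible R s t :=
      ⟨⟨le_rfl, hG.1.lt.le⟩, fun u v h1 h2 => absurd h1 (not_lt.2 h2.le)⟩
    have h1 := eq_cls_of_mem hc (mem_image_of_mem circ hs)
    have h2 : circ w ∈ cls R s := h1 ▸ mem_image_of_mem circ hw
    exact hG.1.none w hsw hwt (Lift.symm h2)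

/-- A gap that meets the hull of a class touches the circle in that class. -/
theorem gapTrace_of_mem_hull (hT : IsTreelike R) {x : ℂ}
    (hx : x ∈ Metric.ball (0 : ℂ) 1 \ leafUnion R) {A : Set Circle} (hA : A ∈ R.classes)
    (hxA : x ∈ circleHull A) :
    gapTrace (connectedComponentIn (Metric.ball (0 : ℂ) 1 \ leafUnion R) x) = A := by
  have hconv : Convex ℝ (circleHull A) := convex_convexHull ℝ _
  have hclosed := isClosed_circleHull hT hA
  have hfront : ∀ y ∈ Metric.ball (0 : ℂ) 1 \ leafUnion R, y ∉ frontier (circleHull A) := by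
    intro y hy hf
    refine hy.2 ?_
    simp only [leafUnion, mem_iUnion]
    exact ⟨A, hA, hf, hy.1⟩
  have hint : ∀ y ∈ Metric.ball (0 : ℂ) 1 \ leafUnion R, y ∈ circleHull A →
      y ∈ interior (circleHull A) := by
    intro y hy hyA
    by_contra h
    exact hfront y hy ⟨subset_closure hyA, h⟩
  have hsub : interior (circleHull A) ⊆ Metric.ball (0 : ℂ) 1 \ leafUnion R := by
    intro y hy
    constructor
    · have := interior_mono (circleHull_subset_closedBall A) hy
      rwa [interior_closedBall (0 : ℂ) one_ne_zero] at this
    · intro hl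
      simp only [leafUnion, mem_iUnion] at hl
      obtain ⟨B, hB, hf, -⟩ := hl
      by_cases hAB : A = B
      · subst hAB
        exact hf.2 hy
      · exact Set.disjoint_left.1 (hT.disjoint_hulls A hA B hB hAB) (interior_subset hy)
          ((isClosed_circleHull hT hB).frontier_subset hf)
  have hcomp : connectedComponentIn (Metric.ball (0 : ℂ) 1 \ leafUnion R) x =
      interior (circleHull A) := by
    refine Subset.antisymm (fun y hy => ?_)
      (hconv.interior.isPreconnected.subset_connectedComponentIn (hint x hx hxA) hsub)
    have hyb := connectedComponentIn_subset _ _ hy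
    refine hint y hyb ?_
    by_contra hyA
    exact notMem_hull_of_preconnected isPreconnected_connectedComponentIn
      (connectedComponentIn_subset _ _) hA hy (mem_connectedComponentIn hx) hyA hxA
  rw [hcomp]
  ext z
  rw [gapTrace, mem_ofPred_eq,
    hconv.closure_interior_eq_closure_of_nonempty_interior ⟨x, hint x hx hxA⟩, hclosed.closure_eq]
  constructor
  · intro hz
    obtain ⟨t, -, rfl⟩ := exists_circ_eq z 0
    by_contra hzA
    have hne : A ≠ cls R t := by
      rintro rfl
      exact hzA (Lift.refl t)
    exact Set.disjoint_left.1 (hT.disjoint_hulls A hA _ (cls_mem_classes t) hne) hz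
      (subset_convexHull ℝ _ ⟨circ t, Lift.refl t, rfl⟩)
  · exact fun hz => subset_convexHull ℝ _ ⟨z, hz, rfl⟩

/-- A gap inside a hull is collapsed, and any other lies beneath the shortest chord above it; `α`
fixes the choice of lifts. -/
theorem isIntactGap_iff (hT : IsTreelike R) (α : ℝ) (G : Set ℂ) : IsIntactGap R G ↔
    ∃ s t, α ≤ s ∧ t ≤ α + 1 ∧ Gapped R s t ∧ G = gapRegion R s t := by
  constructor
  · rintro ⟨⟨x, hx, rfl⟩, hn⟩
    obtain ⟨s, t, hs, ht, hG, hxG⟩ := exists_gapRegion hT α (by simpa using hx.1) fun A hA hxA =>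
      hn (by rwa [gapTrace_of_mem_hull hT hx hA hxA])
    exact ⟨s, t, hs, ht, hG, connectedComponentIn_gapRegion hT hG.1 hxG⟩
  · rintro ⟨s, t, -, -, hG, rfl⟩
    exact isIntactGap_gapRegion hT hG

/-- For nested arcs the inner chord separates the regions; for disjoint arcs a visible point of the
first is strictly below the chord of the second; other positions contradict the arc condition. -/
theorem gapRegion_injective (hT : IsTreelike R) {α s t s' t' : ℝ} (hs : α ≤ s) (ht : t ≤ α + 1)
    (hs' : α ≤ s') (ht' : t' ≤ α + 1) (hG : Gapped R s t) (hG' : Gapped R s' t')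
    (h : gapRegion R s t = gapRegion R s' t') : s = s' ∧ t = t' := by
  wlog hss : s ≤ s' generalizing s t s' t'
  · have := this hs' ht' hs ht hG' hG h.symm (le_of_not_ge hss)
    exact ⟨this.1.symm, this.2.symm⟩
  have hA := hG.1
  have hA' := hG'.1
  have hlt := hA.lt
  have hlt' := hA'.lt
  obtain ⟨x, hx⟩ := gapRegion_nonempty hT hG
  have hx' := h ▸ hx
  rcases hss.eq_or_lt with rfl | hss
  · refine ⟨rfl, ?_⟩
    rcases lt_trichotomy t t' with h1 | h1 | h1
    · exact absurd hA.rel (hA'.none t hlt h1)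
    · exact h1
    · exact absurd hA'.rel (hA.none t' hlt' h1)
  exfalso
  rcases lt_or_ge s' t with h1 | h1
  · rcases lt_trichotomy t' t with h2 | h2 | h2
    · have := hx.2.2 s' t' hss hlt' h2 hA'.rel
      linarith [hx'.2.1]
    · exact hA.none s' hss h1 (hA.rel.trans (h2 ▸ hA'.rel.symm))
    · exact hA.none s' hss h1
        (lift_of_weak_crossing hT hss.le h1.le h2.le (by linarith) hA.rel hA'.rel)
  · obtain ⟨w, hw, hsw, hwt⟩ := exists_visible hT hG
    have hwm : circ w ∈ gapTrace (gapRegion R s t) := by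
      rw [gapTrace_gapRegion hA ⟨x, hx⟩]
      exact mem_image_of_mem circ hw
    rw [h] at hwm
    have h3 := (closure_gapRegion_subset hwm).1
    rw [← circ_add_one] at h3
    have := chordHeight_circ_neg (u := s') (v := t') (w := w + 1) (by linarith) (by linarith) hlt'.le
    linarith

end Topology

/-! ### The degree of a gap -/

section GapDegree
variable {d : ℕ} {R : Setoid Circle}

theorem rightEnds_subset_visible {s t : ℝ} : rightEnds R s t ⊆ visible R s t :=
  fun _ hz => ⟨Ico_subset_Icc_self hz.1, hz.2.1⟩

theorem rightEnds_unique {s t z z' : ℝ} (hz : z ∈ rightEnds R s t) (hz' : z' ∈ rightEnds R s t)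
    (h : Lift R z z') : z = z' := by
  rcases lt_trichotomy z z' with h1 | h1 | h1
  · exact absurd h (hz.2.2 z' h1 hz'.1.2)
  · exact h1
  · exact absurd h.symm (hz'.2.2 z h1 hz.1.2)

/-- A visible point inside the arc is an end of the maximal pair around it, and the right end of
that pair represents it. -/
theorem exists_rightEnd (hT : IsTreelike R) {s t w : ℝ} (hG : Gapped R s t)
    (hw : w ∈ visible R s t) : ∃ z ∈ rightEnds R s t, Lift R w z := by
  rcases hw.1.1.eq_or_lt with rfl | h1
  · exact ⟨_, left_mem_rightEnds hG.1, Lift.refl _⟩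
  rcases hw.1.2.eq_or_lt with rfl | h2
  · exact ⟨_, left_mem_rightEnds hG.1, hG.1.rel.symm⟩
  obtain ⟨u, v, h, hu, hv⟩ := exists_isMaxPair hT hG h1 h2
  refine ⟨v, h.right_mem_rightEnds hT hG.1, ?_⟩
  rcases hu.eq_or_lt with rfl | hu
  · exact h.rel
  rcases hv.eq_or_lt with rfl | hv
  · exact Lift.refl _
  exact absurd h.rel (hw.2 u v h.left hu hv h.right)

/-- A visible point related to a right end lies after the preceding right ends and not after its
own. The exception is `t`, which belongs to the class of `s`; a rotation takes care of it. -/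
theorem circlePos_visible_of_lt {s t z₁ z₂ z₃ w₁ w₂ w₃ : ℝ} (hA : IsArc R s t)
    (hz₁ : z₁ ∈ rightEnds R s t) (hz₂ : z₂ ∈ rightEnds R s t) (hz₃ : z₃ ∈ rightEnds R s t)
    (hw₁ : w₁ ∈ visible R s t) (hw₂ : w₂ ∈ visible R s t) (hw₃ : w₃ ∈ visible R s t)
    (h₁ : Lift R w₁ z₁) (h₂ : Lift R w₂ z₂) (h₃ : Lift R w₃ z₃) (h12 : z₁ < z₂) (h23 : z₂ < z₃) :
    circlePos (circ w₁) (circ w₂) (circ w₃) := by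
  have hlt := hA.lt
  have hle := hA.le
  have key : ∀ {z z' w' : ℝ}, z ∈ rightEnds R s t → z' ∈ rightEnds R s t → w' ∈ visible R s t →
      Lift R w' z' → z < z' → z < w' ∧ w' ≤ z' ∧ w' < t := by
    intro z z' w' hz hz' hw' h' hzz
    have hsz' : s < z' := hz.1.1.trans_lt hzz
    have hns := hA.none z' hsz' hz'.1.2
    have hsw : s < w' := lt_of_le_of_ne hw'.1.1 fun h => hns (h ▸ h')
    have hwt : w' < t := lt_of_le_of_ne hw'.1.2 fun h => hns (hA.rel.trans (h ▸ h'))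
    refine ⟨?_, ?_, hwt⟩
    · by_contra h
      rcases (not_lt.1 h).eq_or_lt with rfl | h
      · exact hz.2.2 z' hzz hz'.1.2 h'
      · exact hz.2.1 w' z' hsw h hzz hz'.1.2 h'
    · by_contra h
      exact hz'.2.2 w' (not_le.1 h) hwt h'.symm
  obtain ⟨a1, a2, a3⟩ := key hz₁ hz₂ hw₂ h₂ h12
  obtain ⟨b1, b2, b3⟩ := key hz₂ hz₃ hw₃ h₃ h23
  have hw23 : w₂ < w₃ := a2.trans_lt b1
  have hsz := hz₁.1.1
  rcases hw₁.1.2.eq_or_lt with rfl | hw1t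
  · refine circlePos_rotate (circlePos_rotate (circlePos_of_lt hw23 b3 ?_))
    linarith
  · have hw1 : w₁ ≤ z₁ := by
      by_contra h
      exact hz₁.2.2 w₁ (not_le.1 h) hw1t h₁.symm
    refine circlePos_of_lt (by linarith) hw23 ?_
    linarith [hw₁.1.1]

theorem circlePos_visible {s t z₁ z₂ z₃ w₁ w₂ w₃ : ℝ} (hA : IsArc R s t)
    (hz₁ : z₁ ∈ rightEnds R s t) (hz₂ : z₂ ∈ rightEnds R s t) (hz₃ : z₃ ∈ rightEnds R s t)
    (hw₁ : w₁ ∈ visible R s t) (hw₂ : w₂ ∈ visible R s t) (hw₃ : w₃ ∈ visible R s t)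
    (h₁ : Lift R w₁ z₁) (h₂ : Lift R w₂ z₂) (h₃ : Lift R w₃ z₃) (h : CyclicLt z₁ z₂ z₃) :
    circlePos (circ w₁) (circ w₂) (circ w₃) := by
  rcases h with h | h | h
  · exact circlePos_visible_of_lt hA hz₁ hz₂ hz₃ hw₁ hw₂ hw₃ h₁ h₂ h₃ h.1 h.2
  · exact circlePos_rotate (circlePos_rotate
      (circlePos_visible_of_lt hA hz₂ hz₃ hz₁ hw₂ hw₃ hw₁ h₂ h₃ h₁ h.1 h.2))
  · exact circlePos_rotate
      (circlePos_visible_of_lt hA hz₃ hz₁ hz₂ hw₃ hw₁ hw₂ h₃ h₁ h₂ h.1 h.2)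

theorem cyclicLt_or {a b c : ℝ} (h1 : a ≠ b) (h2 : b ≠ c) (h3 : a ≠ c) :
    CyclicLt a b c ∨ CyclicLt c b a := by
  unfold CyclicLt
  rcases lt_or_gt_of_ne h1 with h1 | h1 <;> rcases lt_or_gt_of_ne h2 with h2 | h2 <;>
    rcases lt_or_gt_of_ne h3 with h3 | h3 <;> simp_all

theorem CyclicLt.ne {a b c : ℝ} (h : CyclicLt a b c) : a ≠ b ∧ b ≠ c ∧ a ≠ c := by
  rcases h with h | h | h
  · exact ⟨h.1.ne, h.2.ne, (h.1.trans h.2).ne⟩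
  · exact ⟨(h.1.trans h.2).ne', h.1.ne, h.2.ne'⟩
  · exact ⟨h.2.ne, (h.1.trans h.2).ne', h.1.ne'⟩

/-- The images of right endpoints are related only when they are equal. -/
theorem circ_eq_of_lift_mul (hd : 1 ≤ d) (hR : IsDegreeInvariant d R) {s t z z' : ℝ}
    (hA : IsArc R s t) (hz : z ∈ rightEnds R s t) (hz' : z' ∈ rightEnds R s t)
    (h : Lift R (d * z) (d * z')) : circ (d * z) = circ (d * z') := by
  -- Constancy equates the floor and the ceiling of `d z' - d z`, so this number is an integer.
  have h1 := floor_sub_floor_eq hd hR hA hz hz' h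
  have e : (d * z - d * z' : ℝ) = -(d * z' - d * z) := by ring
  rw [e, Int.floor_neg] at h1
  simp only [sub_self, Int.floor_zero, zero_sub, sub_zero, neg_neg] at h1
  rw [circ_eq_circ]
  refine ⟨-⌊(d * z' - d * z : ℝ)⌋, ?_⟩
  have h2 := Int.floor_le (d * z' - d * z : ℝ)
  have h3 := Int.le_ceil (d * z' - d * z : ℝ)
  rw [h1] at h3
  push_cast
  linarith

/-- If each `p i` immediately follows `q i` around the circle, then the points `p` have the same
orientation as the points `q`. -/
theorem circlePos_of_floor {qa qb qc pa pb pc : ℝ} (h : circlePos (circ qa) (circ qb) (circ qc))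
    (hab : circ pa ≠ circ pb) (hbc : circ pb ≠ circ pc) (hac : circ pa ≠ circ pc)
    (eab : ⌊pb - qa⌋ = ⌊pb - pa⌋ + ⌊pa - qa⌋) (eac : ⌊pc - qa⌋ = ⌊pc - pa⌋ + ⌊pa - qa⌋)
    (ebc : ⌊pc - qb⌋ = ⌊pc - pb⌋ + ⌊pb - qb⌋) (eca : ⌊pa - qc⌋ = ⌊pa - pc⌋ + ⌊pc - qc⌋) :
    circlePos (circ pa) (circ pb) (circ pc) := by
  -- The identity `⌊b - q⌋ = ⌊b - a⌋ + ⌊a - q⌋` says that, going forward from `q`, one meets `a` no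
  -- later than `b`. It is invariant under integer shifts, so all points may be moved into `[qa, qa
  -- + 1)`.
  have shift : ∀ x : ℝ, ∃ m : ℤ, ∃ y ∈ Ico qa (qa + 1), x = y + m := fun x => by
    refine ⟨⌊x - qa⌋, x - ⌊x - qa⌋, ⟨?_, ?_⟩, by ring⟩
    · linarith [Int.floor_le (x - qa)]
    · linarith [Int.lt_floor_add_one (x - qa)]
  obtain ⟨i, qb, hqb, rfl⟩ := shift qb
  obtain ⟨j, qc, hqc, rfl⟩ := shift qc
  obtain ⟨k, pa, hpa, rfl⟩ := shift pa
  obtain ⟨l, pb, hpb, rfl⟩ := shift pb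
  obtain ⟨n, pc, hpc, rfl⟩ := shift pc
  simp only [circ_add_int] at *
  have r : ∀ (x y : ℝ) (a b : ℤ), ⌊x + a - (y + b)⌋ = ⌊x - y⌋ + (a - b) := by
    intro x y a b
    rw [← Int.floor_add_intCast]
    congr 1
    push_cast
    ring
  have r' : ∀ (x y : ℝ) (a : ℤ), ⌊x + a - y⌋ = ⌊x - y⌋ + a := by
    intro x y a
    rw [← Int.floor_add_intCast]
    congr 1
    ring
  simp only [r, r'] at eab eac ebc eca
  replace eab : ⌊pb - qa⌋ = ⌊pb - pa⌋ + ⌊pa - qa⌋ := by omega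
  replace eac : ⌊pc - qa⌋ = ⌊pc - pa⌋ + ⌊pa - qa⌋ := by omega
  replace ebc : ⌊pc - qb⌋ = ⌊pc - pb⌋ + ⌊pb - qb⌋ := by omega
  replace eca : ⌊pa - qc⌋ = ⌊pa - pc⌋ + ⌊pc - qc⌋ := by omega
  have f0 : ∀ x y : ℝ, x ∈ Ico qa (qa + 1) → y ∈ Ico qa (qa + 1) → y ≤ x → ⌊x - y⌋ = 0 := by
    intro x y hx hy hxy
    rw [Int.floor_eq_zero_iff]
    exact ⟨by linarith, by linarith [hx.2, hy.1]⟩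
  have f1 : ∀ x y : ℝ, x ∈ Ico qa (qa + 1) → y ∈ Ico qa (qa + 1) → x < y → ⌊x - y⌋ = -1 := by
    intro x y hx hy hxy
    rw [Int.floor_eq_iff]
    push_cast
    exact ⟨by linarith [hx.1, hy.2], by linarith⟩
  have hqa : qa ∈ Ico qa (qa + 1) := ⟨le_rfl, by linarith⟩
  have hab' : pa ≠ pb := fun h => hab (by rw [h])
  have hbc' : pb ≠ pc := fun h => hbc (by rw [h])
  have hac' : pa ≠ pc := fun h => hac (by rw [h])
  have hq : qa < qb ∧ qb < qc := by
    rcases cyclicLt_of_circlePos hqa hqb hqc h with h | h | h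
    · exact h
    · exact absurd h.2 (not_lt.2 hqc.1)
    · exact absurd h.1 (not_lt.2 hqc.1)
  have h1 : pa < pb := by
    by_contra h
    have := lt_of_le_of_ne (not_lt.1 h) hab'.symm
    rw [f0 _ _ hpb hqa hpb.1, f0 _ _ hpa hqa hpa.1, f1 _ _ hpb hpa this] at eab
    omega
  have h2 : pa < pc := by
    by_contra h
    have := lt_of_le_of_ne (not_lt.1 h) hac'.symm
    rw [f0 _ _ hpc hqa hpc.1, f0 _ _ hpa hqa hpa.1, f1 _ _ hpc hpa this] at eac
    omega
  have h3 : pb < pc := by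
    by_contra h
    have hlt := lt_of_le_of_ne (not_lt.1 h) hbc'.symm
    rw [f1 _ _ hpc hpb hlt] at ebc
    have hpcqb : pc < qb := by
      by_contra h'
      rw [f0 _ _ hpc hqb (not_lt.1 h'), f0 _ _ hpb hqb ((not_lt.1 h').trans hlt.le)] at ebc
      omega
    rw [f1 _ _ hpa hqc (by linarith), f1 _ _ hpa hpc h2, f1 _ _ hpc hqc (by linarith)] at eca
    omega
  exact circlePos_of_lt h1 h3 (by linarith [hpc.2, hpa.1])

/-- Between two right endpoints with the same image there is one in the fibre of any other. -/
theorem exists_rightEnd_between (hd : 1 ≤ d) (hR : IsDegreeInvariant d R) {s t z z' p : ℝ}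
    (hG : Gapped R s t) (hz : z ∈ rightEnds R s t) (hz' : z' ∈ rightEnds R s t)
    (hp : p ∈ rightEnds R s t) (hlt : z < z') (h : circ (d * z) = circ (d * z')) :
    ∃ y ∈ rightEnds R s t, y ∈ Ioc z z' ∧ y ∈ fib d (d * p) := by
  refine exists_rightEnd_of_encard_le hd hR hG hz hz' hlt hp ?_
  obtain ⟨m, hm⟩ := circ_eq_circ.1 h.symm
  rw [encard_fib_Ioc hd, encard_fib_Ioc hd]
  have e : ∀ δ : ℝ, ⌊d * z' - δ⌋ - ⌊d * z - δ⌋ = m := by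
    intro δ
    have : (d * z' - δ : ℝ) = d * z - δ + m := by rw [hm]; ring
    rw [this, Int.floor_add_intCast]
    ring
  rw [e, e]

/-- Right endpoints with no point of a given fibre between them are mapped in order. -/
theorem circlePos_mul_of_lt (hd : 1 ≤ d) (hR : IsDegreeInvariant d R) {s t a b c : ℝ}
    (hG : Gapped R s t) (ha : a ∈ rightEnds R s t) (hb : b ∈ rightEnds R s t)
    (hc : c ∈ rightEnds R s t) (hab : a < b) (hbc : b < c)
    (hno : ∀ z ∈ rightEnds R s t, z ∈ Ioc a c → z ∉ fib d (d * s)) :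
    circlePos (circ (d * a)) (circ (d * b)) (circ (d * c)) := by
  have hs := left_mem_rightEnds hG.1
  have hinj : ∀ {z z' : ℝ}, z ∈ rightEnds R s t → z' ∈ rightEnds R s t → a ≤ z → z' ≤ c →
      z < z' → circ (d * z) ≠ circ (d * z') := by
    intro z z' hz hz' h1 h2 h3 h4
    obtain ⟨y, hy, hy', hyf⟩ := exists_rightEnd_between hd hR hG hz hz' hs h3 h4
    exact hno y hy ⟨by linarith [hy'.1], hy'.2.trans h2⟩ hyf
  have shift : ∀ x : ℝ, ∃ m : ℤ, ∃ y ∈ Ico (d * a : ℝ) (d * a + 1), x = y + m := fun x => by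
    refine ⟨⌊x - d * a⌋, x - ⌊x - d * a⌋, ⟨?_, ?_⟩, by ring⟩
    · linarith [Int.floor_le (x - d * a)]
    · linarith [Int.lt_floor_add_one (x - d * a)]
  have n1 := hinj ha hb le_rfl hbc.le hab
  have n2 := hinj hb hc hab.le le_rfl hbc
  have n3 := hinj ha hc le_rfl le_rfl (hab.trans hbc)
  obtain ⟨i, B, hB, eB⟩ := shift (d * b)
  obtain ⟨j, C, hC, eC⟩ := shift (d * c)
  have cB : circ (d * b) = circ B := by rw [eB, circ_add_int]
  have cC : circ (d * c) = circ C := by rw [eC, circ_add_int]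
  have hB' : d * a < B := lt_of_le_of_ne hB.1 fun h => n1 (by rw [h, cB])
  have hC' : d * a < C := lt_of_le_of_ne hC.1 fun h => n3 (by rw [h, cC])
  rcases lt_trichotomy B C with h | h | h
  · rw [cB, cC]
    exact circlePos_of_lt hB' h hC.2
  · exact absurd (by rw [cB, cC, h]) n2
  · exfalso
    -- If `C < B`, the fibre through `c` has as many points in `(a, b]` as the fibre through `b`, so
    -- some right end before `c` has the same image as `c`.
    obtain ⟨z, hz, hz', hzf⟩ := exists_rightEnd_of_encard_le hd hR hG ha hb hab hc (by
      rw [encard_fib_Ioc hd, encard_fib_Ioc hd, eB, eC]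
      have r : ∀ (x y : ℝ) (a b : ℤ), ⌊x + a - (y + b)⌋ = ⌊x - y⌋ + (a - b) := by
        intro x y a b
        rw [← Int.floor_add_intCast]
        congr 1
        push_cast
        ring
      have r' : ∀ (x y : ℝ) (b : ℤ), ⌊x - (y + b)⌋ = ⌊x - y⌋ - b := by
        intro x y b
        rw [← Int.floor_sub_intCast]
        congr 1
        ring
      have g1 : ⌊B - C⌋ = 0 := by
        rw [Int.floor_eq_zero_iff]
        exact ⟨by linarith, by linarith [hB.2]⟩
      have g2 : ⌊(d * a : ℝ) - C⌋ = -1 := by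
        rw [Int.floor_eq_iff]
        push_cast
        exact ⟨by linarith [hC.2], by linarith⟩
      have g3 : ⌊(d * a : ℝ) - B⌋ = -1 := by
        rw [Int.floor_eq_iff]
        push_cast
        exact ⟨by linarith [hB.2], by linarith⟩
      rw [r, r, r', r', g1, g2, g3]
      simp only [sub_self, Int.floor_zero]
      refine le_of_eq ?_
      congr 2
      omega)
    refine hinj hz hc hz'.1.le le_rfl (hz'.2.trans_lt hbc) ?_
    rw [← circ_pow]
    exact mem_fib_iff.1 hzf

/-- Each point of the quotient is represented by its right end `ρ`. The right ends in the fibre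
through `s` have one image, which bounds the degree below. Cutting just before each of them gives a
partition into intervals on which the map is injective and preserves the order. -/
theorem circDegree_gap (hd : 1 ≤ d) (hR : IsDegreeInvariant d R) {s t : ℝ} (hG : Gapped R s t) :
    circDegree (modPos R (circ '' visible R s t))
      (modPos R ((fun z : Circle => z ^ d) '' (circ '' visible R s t)))
      (powMod hR (circ '' visible R s t)) = arcDegree d R s t := by
  have hT := hR.treelike
  have hA := hG.1
  have hs := left_mem_rightEnds hA
  set T := circ '' visible R s t with hTdef
  have hex : ∀ u : ModR R T, ∃ z, ∃ hz : z ∈ rightEnds R s t,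
      u = Quotient.mk _ ⟨circ z, mem_image_of_mem circ (rightEnds_subset_visible hz)⟩ := by
    intro u
    induction u using Quotient.inductionOn with
    | h a =>
      obtain ⟨_, w, hw, rfl⟩ := a
      obtain ⟨z, hz, hwz⟩ := exists_rightEnd hT hG hw
      exact ⟨z, hz, Quotient.sound hwz⟩
  choose ρ hρ hmk using hex
  have hrep : ∀ (a : T) (u : ModR R T), Quotient.mk _ a = u →
      ∃ w ∈ visible R s t, circ w = a ∧ Lift R w (ρ u) := by
    rintro ⟨_, w, hw, rfl⟩ u hu
    refine ⟨w, hw, rfl, ?_⟩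
    rw [hmk u] at hu
    have := Quotient.exact hu
    exact this
  have hρinj : Function.Injective ρ := by
    intro u v h
    rw [hmk u, hmk v]
    congr 2
    rw [h]
  have hρmk : ∀ z (hz : z ∈ rightEnds R s t), ρ (Quotient.mk _
      ⟨circ z, mem_image_of_mem circ (rightEnds_subset_visible hz)⟩) = z := by
    intro z hz
    refine (rightEnds_unique hz (hρ _) ?_).symm
    have := Quotient.exact (hmk (Quotient.mk _
      ⟨circ z, mem_image_of_mem circ (rightEnds_subset_visible hz)⟩))
    exact this
  have hρIco : ∀ u, ρ u ∈ Ico s (s + 1) := fun u =>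
    ⟨(hρ u).1.1, by linarith [(hρ u).1.2, hA.le]⟩
  have hpos : ∀ u v w : ModR R T, modPos R T u v w ↔ CyclicLt (ρ u) (ρ v) (ρ w) := by
    intro u v w
    constructor
    · rintro ⟨h1, h2, h3, a, b, c, ha, hb, hc, h⟩
      rcases cyclicLt_or (fun e => h1 (hρinj e)) (fun e => h2 (hρinj e))
        (fun e => h3 (hρinj e)) with h' | h'
      · exact h'
      · exfalso
        obtain ⟨x, hx, hxa, hxu⟩ := hrep a u ha
        obtain ⟨y, hy, hyb, hyv⟩ := hrep b v hb
        obtain ⟨z, hz, hzc, hzw⟩ := hrep c w hc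
        have := circlePos_visible hA (hρ w) (hρ v) (hρ u) hz hy hx hzw hyv hxu h'
        rw [hxa, hyb, hzc] at this
        exact circlePos_asymm h this
    · intro h
      obtain ⟨h1, h2, h3⟩ := h.ne
      exact ⟨fun e => h1 (by rw [e]), fun e => h2 (by rw [e]), fun e => h3 (by rw [e]),
        _, _, _, (hmk u).symm, (hmk v).symm, (hmk w).symm,
        circlePos_of_cyclicLt (hρIco u) (hρIco v) (hρIco w) h⟩
  set g := powMod hR T with hg
  have hgeq : ∀ u v, g u = g v ↔ Lift R (d * ρ u) (d * ρ v) := by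
    intro u v
    conv_lhs => rw [hmk u, hmk v]
    rw [Lift, ← circ_pow, ← circ_pow]
    exact Quotient.eq
  have hgeq' : ∀ u v, g u = g v ↔ circ (d * ρ u) = circ (d * ρ v) := fun u v =>
    (hgeq u v).trans ⟨circ_eq_of_lift_mul hd hR hA (hρ u) (hρ v), lift_of_circ_eq⟩
  -- By `floor_sub_floor_eq`, going forward from any representative of `g u`, one meets the image of
  -- `ρ u` no later than the image of any other right end. This is the input of
  -- `circlePos_of_floor`.
  have hrep' : ∀ (a : (fun z : Circle => z ^ d) '' T) (u : ModR R T), Quotient.mk _ a = g u →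
      ∃ w, circ w = a ∧ ∀ v, ⌊d * ρ v - w⌋ = ⌊d * ρ v - d * ρ u⌋ + ⌊d * ρ u - w⌋ := by
    rintro ⟨_, _, ⟨w, hw, rfl⟩, rfl⟩ u hu
    refine ⟨d * w, (circ_pow w d).symm, fun v => ?_⟩
    obtain ⟨z, hz, hwz⟩ := exists_rightEnd hT hG hw
    have h1 : Lift R (d * w) (d * ρ u) := by
      rw [hmk u] at hu
      have := Quotient.exact hu
      rw [Lift, ← circ_pow, ← circ_pow]
      exact this
    have h2 := floor_sub_floor_eq hd hR hA (hρ v) (hρ u) h1.symm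
    simp only [sub_self, Int.floor_zero] at h2
    omega
  have hpos' : ∀ u v w : ModR R T,
      modPos R ((fun z : Circle => z ^ d) '' T) (g u) (g v) (g w) ↔
        circlePos (circ (d * ρ u)) (circ (d * ρ v)) (circ (d * ρ w)) := by
    intro u v w
    rw [modPos, Ne, Ne, Ne, hgeq', hgeq', hgeq']
    constructor
    · rintro ⟨h1, h2, h3, a, b, c, ha, hb, hc, h⟩
      obtain ⟨x, hx, hxu⟩ := hrep' a u ha
      obtain ⟨y, hy, hyv⟩ := hrep' b v hb
      obtain ⟨z, hz, hzw⟩ := hrep' c w hc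
      rw [← hx, ← hy, ← hz] at h
      exact circlePos_of_floor h h1 h2 h3 (hxu v) (hxu w) (hyv w) (hzw u)
    · intro h
      obtain ⟨h1, h2, h3⟩ := circlePos_ne h
      have hm : ∀ u, circ (d * ρ u) ∈ (fun z : Circle => z ^ d) '' T := fun u =>
        ⟨circ (ρ u), mem_image_of_mem circ (rightEnds_subset_visible (hρ u)), circ_pow _ d⟩
      have hq : ∀ u, Quotient.mk _ ⟨circ (d * ρ u), hm u⟩ = g u := by
        intro u
        conv_rhs => rw [hmk u]
        refine Quotient.sound ?_
        change R (circ (d * ρ u)) (circ (ρ u) ^ d)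
        rw [circ_pow]
      exact ⟨h1, h2, h3, _, _, _, hq u, hq v, hq w, h⟩
  set F : Set ℝ := rightEnds R s t ∩ fib d (d * s) with hF
  refine le_antisymm ?_ ?_
  · have hFfin : F.Finite := by
      refine Set.Finite.subset (s := Ico s t ∩ fib d (d * s)) ?_ fun z hz => ⟨hz.1.1, hz.2⟩
      rw [← encard_ne_top_iff, encard_fib_Ico hd]
      exact ENat.natCast_ne_top _
    -- The blocks are indexed by the last point of `F` up to `ρ u`, which exists because `F` is
    -- finite and contains `s`.
    have hex : ∀ u, ∃ z ∈ F, z ≤ ρ u ∧ ∀ z' ∈ F, z' ≤ ρ u → z' ≤ z := by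
      intro u
      obtain ⟨z, hz, hmax⟩ := Set.exists_max_image (F ∩ Iic (ρ u)) id
        (hFfin.subset inter_subset_left) ⟨s, ⟨hs, mem_fib_self s⟩, (hρ u).1.1⟩
      exact ⟨z, hz.1, hz.2, fun z' h1 h2 => hmax z' ⟨h1, h2⟩⟩
    choose π hπF hπle hπmax using hex
    have hmono : ∀ u v, ρ u ≤ ρ v → π u ≤ π v := fun u v h =>
      hπmax v _ (hπF u) ((hπle u).trans h)
    have hno : ∀ u v, π u = π v → ∀ z ∈ rightEnds R s t, z ∈ Ioc (ρ u) (ρ v) →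
        z ∉ fib d (d * s) := by
      intro u v h z hz hz' hzf
      have := hπmax v z ⟨hz, hzf⟩ hz'.2
      linarith [hπle u, hz'.1]
    have hinj : ∀ u v, π u = π v → g u = g v → u = v := by
      intro u v h h'
      rw [hgeq'] at h'
      apply hρinj
      rcases lt_trichotomy (ρ u) (ρ v) with h1 | h1 | h1
      · obtain ⟨y, hy, hy', hyf⟩ := exists_rightEnd_between hd hR hG (hρ u) (hρ v) hs h1 h'
        exact absurd hyf (hno u v h y hy hy')
      · exact h1
      · obtain ⟨y, hy, hy', hyf⟩ := exists_rightEnd_between hd hR hG (hρ v) (hρ u) hs h1 h'.symm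
        exact absurd hyf (hno v u h.symm y hy hy')
    have hcyc : ∀ u v w, π u = π v → π v = π w → CyclicLt (ρ u) (ρ v) (ρ w) →
        circlePos (circ (d * ρ u)) (circ (d * ρ v)) (circ (d * ρ w)) := by
      intro u v w h1 h2 h
      rcases h with h | h | h
      · exact circlePos_mul_of_lt hd hR hG (hρ u) (hρ v) (hρ w) h.1 h.2 (hno u w (h1.trans h2))
      · exact circlePos_rotate (circlePos_rotate
          (circlePos_mul_of_lt hd hR hG (hρ v) (hρ w) (hρ u) h.1 h.2 (hno v u h1.symm)))
      · exact circlePos_rotate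
          (circlePos_mul_of_lt hd hR hG (hρ w) (hρ u) (hρ v) h.1 h.2 (hno w v h2.symm))
    have hPcard : (Setoid.ker π).classes.encard ≤ F.encard := by
      have hsub : (Setoid.ker π).classes ⊆ (fun z => π ⁻¹' {z}) '' F := by
        rintro J ⟨u, rfl⟩
        exact ⟨π u, hπF u, rfl⟩
      exact (encard_le_encard hsub).trans (encard_image_le _ _)
    refine le_trans (iInf₂_le (Setoid.ker π).classes
      ⟨Setoid.isPartition_classes _, ?_⟩) hPcard
    rintro J ⟨x, rfl⟩
    have hJ : ∀ u, u ∈ {y | (Setoid.ker π) y x} ↔ π u = π x := fun u => Iff.rfl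
    refine ⟨⟨LinearOrder.lift' (fun j : {y | (Setoid.ker π) y x} => ρ j)
      (hρinj.comp Subtype.val_injective), ?_, ?_⟩, ?_, ?_⟩
    · intro a b c hab hbc
      exact (hpos _ _ _).2 (Or.inl ⟨hab, hbc⟩)
    · intro a b y hab h
      have hab' : ρ a < ρ b := hab
      have h1 : ρ a < ρ y ∧ ρ y < ρ b := by
        rcases (hpos _ _ _).1 h with h | h | h
        · exact h
        · exact absurd h.2 (not_lt.2 hab'.le)
        · exact absurd h.1 (not_lt.2 hab'.le)
      have ha := (hJ a).1 a.2
      have hb := (hJ b).1 b.2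
      refine (hJ y).2 (le_antisymm ?_ ?_)
      · exact (hmono _ _ h1.2.le).trans hb.le
      · exact ha.symm.le.trans (hmono _ _ h1.1.le)
    · intro a ha b hb h
      exact hinj a b (((hJ a).1 ha).trans ((hJ b).1 hb).symm) h
    · intro a ha b hb c hc
      have h1 : π a = π b := ((hJ a).1 ha).trans ((hJ b).1 hb).symm
      have h2 : π b = π c := ((hJ b).1 hb).trans ((hJ c).1 hc).symm
      rw [hpos, hpos']
      constructor
      · intro h
        obtain ⟨n1, n2, n3⟩ := circlePos_ne h
        rcases cyclicLt_or (a := ρ a) (b := ρ b) (c := ρ c) (fun e => n1 (by rw [e]))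
          (fun e => n2 (by rw [e])) (fun e => n3 (by rw [e])) with h' | h'
        · exact h'
        · exact absurd (hcyc c b a h2.symm h1.symm h') (circlePos_asymm h)
      · exact hcyc a b c h1 h2
  · refine le_trans ?_ (encard_le_circDegree _ _ g {u | ρ u ∈ F} fun u hu v hv => ?_)
    · have : F ⊆ ρ '' {u | ρ u ∈ F} := by
        intro z hz
        refine ⟨_, ?_, hρmk z hz.1⟩
        rw [mem_ofPred_eq, hρmk z hz.1]
        exact hz
      exact (encard_le_encard this).trans (encard_image_le _ _)
    · have h1 := mem_fib_iff.1 (show ρ u ∈ F from hu).2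
      have h2 := mem_fib_iff.1 (show ρ v ∈ F from hv).2
      rw [hgeq', ← circ_pow, ← circ_pow, h1, h2]

/-- The degree of the gap beneath an arc. -/
theorem gapDegree_gapRegion (hd : 1 ≤ d) (hR : IsDegreeInvariant d R) {s t : ℝ}
    (hG : Gapped R s t) : gapDegree hR (gapRegion R s t) = arcDegree d R s t := by
  unfold gapDegree
  rw [gapTrace_gapRegion hG.1 (gapRegion_nonempty hR.treelike hG)]
  exact circDegree_gap hd hR hG

end GapDegree

/-! ### The total criticality -/

section Criticality
variable {d : ℕ} {R : Setoid Circle}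

/-- A related pair beneath the arc stays on one side of the visible point, so it is no longer than
the longer side. -/
theorem IsArc.gapped_of_visible {s t w : ℝ} (hA : IsArc R s t) (h1 : s < w) (h2 : w < t)
    (hw : w ∈ visible R s t) : Gapped R s t := by
  refine ⟨hA, max (w - s) (t - w), max_lt (by linarith) (by linarith), fun u v hu huv hv hr => ?_⟩
  by_cases huw : u < w
  · have hvw : v ≤ w := not_lt.1 fun h => hw.2 u v hu huw h hv hr
    exact le_max_of_le_left (by linarith)
  · exact le_max_of_le_right (by linarith)

theorem gapped_of_one_lt_arcDegree {p : ℝ × ℝ} (hA : IsArc R p.1 p.2)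
    (h : 1 < arcDegree d R p.1 p.2) : Gapped R p.1 p.2 := by
  obtain ⟨x, hx, y, hy, hxy⟩ := two_points_of_one_lt_encard h
  exact hA.gapped_of_visible (hx.1.1.1.trans_lt hxy) hy.1.1.2 (rightEnds_subset_visible hy.1)

theorem total_image {α β : Type*} (c : β → ENNReal) {g : α → β} {S : Set α} (h : InjOn g S) :
    total c (g '' S) = total (c ∘ g) S :=
  tsum_image c h

/-- The class of `α` and those met in `(α, α + 1)` are all the classes, and noncritical ones weigh
nothing. -/
theorem tsum_criticalClasses (d : ℕ) (R : Setoid Circle) (α : ℝ) :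
    ((∑' A : criticalClasses d R, (powDegreeOn d A - 1) : ℕ∞) : ENNReal) =
      weight d R (Sum.inl (cls R α)) + total (weight d R) (Sum.inl ''
        {U | U ∈ R.classes ∧ U ≠ cls R α ∧ ∃ τ ∈ Ioo α (α + 1), circ τ ∈ U}) := by
  rw [toENNReal_tsum, total_image _ Sum.inl_injective.injOn]
  set c : Set Circle → ENNReal := weight d R ∘ Sum.inl
  rw [← show c (cls R α) = weight d R (Sum.inl (cls R α)) from rfl, ← total_singleton c (cls R α),
    ← total_union c (by rw [disjoint_singleton_left]; exact fun h => h.2.1 rfl)]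
  refine (total_eq_of_subset c (S := criticalClasses d R) ?_ ?_).symm
  · rintro A ⟨hA, -⟩
    by_cases h : A = cls R α
    · exact Or.inl h
    · refine Or.inr ⟨hA, h, ?_⟩
      obtain ⟨a, rfl⟩ := exists_eq_cls hA
      obtain ⟨τ, hτ, hτa⟩ := exists_circ_eq (circ a) α
      have hτA : circ τ ∈ cls R a := by rw [hτa]; exact mem_cls.2 (Lift.refl a)
      refine ⟨τ, ⟨hτ.1.lt_of_ne ?_, hτ.2⟩, hτA⟩
      rintro rfl
      exact h (eq_cls_of_mem hA hτA)
  · intro A hA hn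
    have hA' : A ∈ R.classes := by
      rcases hA with rfl | hA
      · exact cls_mem_classes α
      · exact hA.1
    by_contra h0
    exact hn ⟨hA', one_lt_of_sub_one_ne_zero h0⟩

/-- An arc of positive weight is gapped, and gapped arcs in `[α, α + 1]` correspond bijectively to
intact gaps. -/
theorem tsum_intactCriticalGaps (hd : 1 ≤ d) (hR : IsDegreeInvariant d R) (α : ℝ) :
    ((∑' G : intactCriticalGaps hR, (gapDegree hR G - 1) : ℕ∞) : ENNReal) =
      total (weight d R) (Sum.inr '' {p | IsArc R p.1 p.2 ∧ α ≤ p.1 ∧ p.2 ≤ α + 1}) := by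
  have hT := hR.treelike
  rw [toENNReal_tsum, total_image _ Sum.inr_injective.injOn]
  set c : ℝ × ℝ → ENNReal := weight d R ∘ Sum.inr
  set P : Set (ℝ × ℝ) := {p | Gapped R p.1 p.2 ∧ α ≤ p.1 ∧ p.2 ≤ α + 1 ∧
    1 < arcDegree d R p.1 p.2}
  have hinj : InjOn (fun p : ℝ × ℝ => gapRegion R p.1 p.2) P := by
    intro p hp q hq h
    obtain ⟨h1, h2⟩ := gapRegion_injective hT hp.2.1 hp.2.2.1 hq.2.1 hq.2.2.1 hp.1 hq.1 h
    exact Prod.ext h1 h2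
  have himage : intactCriticalGaps hR = (fun p : ℝ × ℝ => gapRegion R p.1 p.2) '' P := by
    ext G
    constructor
    · rintro ⟨hG, h⟩
      obtain ⟨s, t, hs, ht, hst, rfl⟩ := (isIntactGap_iff hT α G).1 hG
      rw [gapDegree_gapRegion hd hR hst] at h
      exact ⟨(s, t), ⟨hst, hs, ht, h⟩, rfl⟩
    · rintro ⟨p, ⟨hG, -, -, h⟩, rfl⟩
      refine ⟨isIntactGap_gapRegion hT hG, ?_⟩
      rwa [gapDegree_gapRegion hd hR hG]
  have hsub : total c {p | IsArc R p.1 p.2 ∧ α ≤ p.1 ∧ p.2 ≤ α + 1} = total c P := by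
    refine total_eq_of_subset c (fun p hp => ⟨hp.1.1, hp.2.1, hp.2.2.1⟩) fun p hp hn => ?_
    by_contra h0
    have h := one_lt_of_sub_one_ne_zero h0
    exact hn ⟨gapped_of_one_lt_arcDegree hp.1 h, hp.2.1, hp.2.2, h⟩
  rw [hsub, himage]
  change total (fun G => ((gapDegree hR G - 1 : ℕ∞) : ENNReal)) _ = _
  rw [total_image _ hinj]
  refine tsum_congr fun p => ?_
  change ((gapDegree hR (gapRegion R p.1.1 p.1.2) - 1 : ℕ∞) : ENNReal) = _
  rw [gapDegree_gapRegion hd hR p.2.1]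
  rfl

end Criticality

end

theorem mainTheorem9 (d : ℕ) (hd : 1 ≤ d) (R : Setoid Circle) (hR : IsDegreeInvariant d R) :
    (∑' A : criticalClasses d R, (powDegreeOn d A - 1)) +
      (∑' G : intactCriticalGaps hR, (gapDegree hR G - 1)) = ((d - 1 : ℕ) : ℕ∞) := by
  have h := total_weight_eq hd hR 0
  unfold region at h
  rw [total_union _ (by
    rw [Set.disjoint_left]
    rintro _ ⟨U, -, rfl⟩ ⟨p, -, hp⟩
    cases hp), ← add_assoc, ← tsum_criticalClasses d R 0, ← tsum_intactCriticalGaps hd hR 0,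
    ← ENat.toENNReal_add, ← ENat.toENNReal_one, ← ENat.toENNReal_add, ← ENat.toENNReal_coe,
    ENat.toENNReal_inj] at h
  have hd' : (d : ℕ∞) = ((d - 1 : ℕ) : ℕ∞) + 1 := by
    rw [← Nat.cast_add_one, Nat.sub_add_cancel hd]
  rw [hd'] at h
  exact (ENat.add_left_injective_of_ne_top ENat.one_ne_top) h
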